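/- **Setting.** Let $d\in\{2,3\}$ and let $\Omega\subset\mathbb R^d$ be a bounded polygonal (polyhedral) domain. For each of the two boundary conditions (displacement/stress and pressure/velocity) let $\partial\Omega=\Gamma_D\cup\Gamma_N$, the two parts overlapping in a null set at most, with $|\Gamma_D|>0$; write $\Gamma_D^{displ},\Gamma_N^{stress}$ and $\Gamma_D^{pres},\Gamma_N^{vel}$. Let $\mathcal T_h$ be a conforming partition of $\Omega$ into triangles ($d=2$), into tetrahedra ($d=3$), or into convex quadrilaterals ($d=2$), such that every boundary facet (edge if $d=2$, face if $d=3$) lies in one of the two parts of each splitting and * each element has at most one facet on $\Gamma_N^{stress}$; * in the case of quadrilaterals, either $h<h_0$, where $h_0>0$ depends only on $\Omega$, $\Gamma_D^{displ}$, $\Gamma_N^{stress}$, or all elements are parallelograms and at least two edges lie on $\Gamma_D^{displ}$. Let $F_E:\hat E\to E$ be the affine (bilinear on quadrilaterals) map from the reference simplex (square) onto $E\in\mathcal T_h$, and $J_E=|\det DF_E|$. Let $Z_h$ be the lowest order Brezzi–Douglas–Marini space $\mathcal{BDM}_1$ (mapped by the Piola transformation, normal components continuous across facets, $\zeta\cdot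 n=0$ on $\Gamma_N^{vel}$); $\mathbb X_h$ the matrix fields with rows in $\mathcal{BDM}_1$ and $\tau n=0$ on $\Gamma_N^{stress}$; $V_h$ and $W_h$ the piecewise constant vector fields and scalars; $\mathbb Q_h$ the continuous skew-symmetric matrix fields that are mapped from $\mathcal P_1$ (simplices) or $\mathcal Q_1$ (quadrilaterals) on each element. Let $(\varphi,\psi)_Q=\sum_E\frac{|\hat E|}{s}\sum_{i=1}^s\varphi|_E(\mathbf r_i)\cdot\psi|_E(\mathbf r_i)\,J_E(\hat{\mathbf r}_i)$ be the vertex quadrature rule ($s$ is the number of vertices of $E$, and $\mathbf r_i$, $\hat{\mathbf r}_i$ are the vertices of $E$, $\hat E$). Let $A(x)$ be a symmetric positive definite linear operator on $d\times d$ matrices and $K(x)$ a symmetric positive definite $d\times d$ matrix at each point of each closed element (both may jump across facets); let $c_0\ge 0$, $0<\alpha\le 1$ and $\Delta t>0$. In arbitrary bases of the five spaces let $A_{\sigma\sigma},A_{\sigma u},A_{\sigma\gamma},A_{\sigma p},A_{zz},A_{zp},A_{pp}$ be the matrices of $$(A\sigma,\tau)_Q,\quad (\mathrm{div}\,\sigma,v),\quad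 (\sigma,\xi)_Q,\quad \alpha(A\sigma,wI)_Q,\quad (K^{-1}z,\zeta)_Q,\quad -(\mathrm{div}\,z,w),\quad (c_0p,w)+\alpha(A\alpha pI,wI)_Q ,$$ rows being indexed by the test function. One backward Euler step of the five-field method for the Biot system (last equation multiplied by $\Delta t$, with given right-hand sides $f$, $g$) is $$\begin{aligned} &A_{\sigma\sigma}\sigma+A_{\sigma u}^Tu+A_{\sigma\gamma}^T\gamma+A_{\sigma p}^Tp=0,\qquad -A_{\sigma u}\sigma=f,\qquad -A_{\sigma\gamma}\sigma=0,\\ &A_{zz}z+A_{zp}^Tp=0,\qquad A_{\sigma p}\sigma-\Delta t\,A_{zp}z+A_{pp}p=g . \end{aligned}$$ Put $A_{u\sigma u}=A_{\sigma u}A_{\sigma\sigma}^{-1}A_{\sigma u}^T$, $A_{u\sigma\gamma}=A_{\sigma u}A_{\sigma\sigma}^{-1}A_{\sigma\gamma}^T$, $A_{\gamma\sigma\gamma}=A_{\sigma\gamma}A_{\sigma\sigma}^{-1}A_{\sigma\gamma}^T$, $A_{u\sigma p}=A_{\sigma u}A_{\sigma\sigma}^{-1}A_{\sigma p}^T$,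 $A_{\gamma\sigma p}=A_{\sigma\gamma}A_{\sigma\sigma}^{-1}A_{\sigma p}^T$, $A_{p\sigma zp}=A_{pp}-A_{\sigma p}A_{\sigma\sigma}^{-1}A_{\sigma p}^T+\Delta t\,A_{zp}A_{zz}^{-1}A_{zp}^T$, and $$\mathcal A=\begin{pmatrix}A_{11}&A_{12}\\A_{21}&A_{22}\end{pmatrix}=\begin{pmatrix}A_{u\sigma u}-A_{u\sigma\gamma}A_{\gamma\sigma\gamma}^{-1}A_{u\sigma\gamma}^T & A_{u\sigma p}-A_{u\sigma\gamma}A_{\gamma\sigma\gamma}^{-1}A_{\gamma\sigma p}\\ -A_{u\sigma p}^T+A_{\gamma\sigma p}^TA_{\gamma\sigma\gamma}^{-1}A_{u\sigma\gamma}^T & A_{p\sigma zp}+A_{\gamma\sigma p}^TA_{\gamma\sigma\gamma}^{-1}A_{\gamma\sigma p}\end{pmatrix}.$$ **Proposition.** The matrices $A_{\sigma\sigma}$, $A_{zz}$, $A_{\gamma\sigma\gamma}$ are symmetric positive definite, so stress, velocity and rotation can be eliminated: $(\sigma,u,\gamma,z,p)$ solves the five-field system if and only if $\sigma=-A_{\sigma\sigma}^{-1}(A_{\sigma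 u}^Tu+A_{\sigma\gamma}^T\gamma+A_{\sigma p}^Tp)$, $z=-A_{zz}^{-1}A_{zp}^Tp$, $\gamma=-A_{\gamma\sigma\gamma}^{-1}(A_{\gamma\sigma p}p+A_{u\sigma\gamma}^Tu)$ and $\mathcal A\binom up=\binom fg$. The displacement–pressure matrix $\mathcal A$ is block-skew-symmetric, $A_{21}=-A_{12}^T$; its diagonal blocks $A_{11}$ and $A_{22}$ are symmetric and positive definite; and $\mathcal A$ is positive definite, i.e. $x^T\mathcal Ax>0$ for all $x\neq0$. -/

import Mathlib

open MeasureTheory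
open scoped Matrix

noncomputable section

namespace Biot

/-- Points and vectors of `ℝ^d`. -/
abbrev Vec (d : ℕ) := Fin d → ℝ

/-- Real `d × d` matrices. -/
abbrev Mat (d : ℕ) := Matrix (Fin d) (Fin d) ℝ

/-- Frobenius inner product `σ : τ`. -/
def frob {d : ℕ} (σ τ : Mat d) : ℝ := ∑ a, ∑ b, σ a b * τ a b

/-! ### Reference elements -/

/-- The reference elements: the unit simplex of `ℝ^d`, and the unit square. -/
inductive Shape : ℕ → Type
  | simplex (d : ℕ) : Shape d
  | square : Shape 2

namespace Shape

/-- Number of vertices; it is also the number of facets. -/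
def nv : {d : ℕ} → Shape d → ℕ
  | _, simplex d => d + 1
  | _, square => 4

/-- Vertices of the reference element; those of the square are listed in cyclic order. -/
def refVert : {d : ℕ} → (s : Shape d) → Fin s.nv → Vec d
  | _, simplex d => fun i : Fin (d + 1) => Fin.cases 0 (fun j => Pi.single j 1) i
  | _, square => fun i : Fin 4 => ![![0, 0], ![1, 0], ![1, 1], ![0, 1]] i

/-- The closed reference element. -/
def refElem {d : ℕ} (s : Shape d) : Set (Vec d) := convexHull ℝ (Set.range s.refVert)

/-- Nodal shape functions: barycentric coordinates on the simplex, bilinear functions on the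
square. -/
def shapeFn : {d : ℕ} → (s : Shape d) → Fin s.nv → Vec d → ℝ
  | _, simplex d => fun (i : Fin (d + 1)) x => Fin.cases (1 - ∑ j, x j) (fun j => x j) i
  | _, square => fun (i : Fin 4) x =>
      ![(1 - x 0) * (1 - x 1), x 0 * (1 - x 1), x 0 * x 1, (1 - x 0) * x 1] i

/-- Vertices of the `i`-th facet: on the simplex the facet opposite to vertex `i`,
on the square the edge from vertex `i` to the next one. -/
def facetVerts : {d : ℕ} → (s : Shape d) → Fin s.nv → Finset (Fin s.nv)
  | _, simplex d => fun i : Fin (d + 1) => Finset.univ.erase i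
  | _, square => fun i : Fin 4 => ({i, i + 1} : Finset (Fin 4))

/-- Scalar polynomial functions of total degree at most one. -/
def P1 (d : ℕ) : Submodule ℝ (Vec d → ℝ) where
  carrier := {f | ∃ (c : ℝ) (g : Vec d), f = fun x => c + g ⬝ᵥ x}
  zero_mem' := ⟨0, 0, by ext; simp⟩
  add_mem' := by
    rintro _ _ ⟨c, g, rfl⟩ ⟨c', g', rfl⟩
    exact ⟨c + c', g + g', by ext x; simp [add_dotProduct]; ring⟩
  smul_mem' := by
    rintro r _ ⟨c, g, rfl⟩
    exact ⟨r * c, r • g, by ext x; simp [smul_dotProduct]; ring⟩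

/-- Scalar polynomial functions on `ℝ²` of degree at most one in each variable. -/
def Q1 : Submodule ℝ (Vec 2 → ℝ) where
  carrier := {f | ∃ a b c e : ℝ, f = fun x => a + b * x 0 + c * x 1 + e * (x 0 * x 1)}
  zero_mem' := ⟨0, 0, 0, 0, by ext; simp⟩
  add_mem' := by
    rintro _ _ ⟨a, b, c, e, rfl⟩ ⟨a', b', c', e', rfl⟩
    exact ⟨a + a', b + b', c + c', e + e', by ext x; simp; ring⟩
  smul_mem' := by
    rintro r _ ⟨a, b, c, e, rfl⟩
    exact ⟨r * a, r * b, r * c, r * e, by ext x; simp; ring⟩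

/-- Vector fields all of whose components are polynomials of degree at most one. -/
def P1Vec (d : ℕ) : Submodule ℝ (Vec d → Vec d) where
  carrier := {f | ∀ a, (fun x => f x a) ∈ P1 d}
  zero_mem' := fun _ => (P1 d).zero_mem
  add_mem' := fun hf hg a => (P1 d).add_mem (hf a) (hg a)
  smul_mem' := fun r _ hf a => (P1 d).smul_mem r (hf a)

/-- The lowest order Brezzi-Douglas-Marini space on the reference element: `P₁^d` on the simplex,
`P₁² + span {curl (x² y), curl (x y²)}` on the square, where `curl φ = (∂₂ φ, -∂₁ φ)`. -/
def bdm : {d : ℕ} → Shape d → Submodule ℝ (Vec d → Vec d)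
  | _, simplex d => P1Vec d
  | _, square => P1Vec 2 ⊔ Submodule.span ℝ
      {(fun x => ![x 0 ^ 2, -(2 * x 0 * x 1)]), (fun x => ![2 * x 0 * x 1, -(x 1 ^ 2)])}

/-- Scalar space for the rotations on the reference element: `P₁` on the simplex, `Q₁` on the
square. -/
def nodal : {d : ℕ} → Shape d → Submodule ℝ (Vec d → ℝ)
  | _, simplex d => P1 d
  | _, square => Q1

/-- Is the reference element the square? -/
def IsSquare : {d : ℕ} → Shape d → Prop
  | _, simplex _ => False
  | _, square => True

end Shape

/-! ### Meshes -/

/-- A finite collection of elements: points `pt` and, for each element, its list of vertices.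
Element `E` is the image of the reference element under `F E`. -/
structure Cells {d : ℕ} (s : Shape d) (nE nV : ℕ) where
  pt : Fin nV → Vec d
  cell : Fin nE → Fin s.nv → Fin nV

namespace Cells

variable {d : ℕ} {s : Shape d} {nE nV : ℕ} (M : Cells s nE nV)

/-- The element map: affine on the simplex, bilinear on the square. -/
def F (E : Fin nE) (x : Vec d) : Vec d := ∑ i, s.shapeFn i x • M.pt (M.cell E i)

/-- Jacobian matrix of the element map. -/
def DF (E : Fin nE) (x : Vec d) : Mat d :=
  Matrix.of fun a b => fderiv ℝ (M.F E) x (Pi.single b 1) a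

/-- `J_E = |det DF_E|`. -/
def J (E : Fin nE) (x : Vec d) : ℝ := |(M.DF E x).det|

/-- The closed element `E`. -/
def cellSet (E : Fin nE) : Set (Vec d) := M.F E '' s.refElem

/-- Vertices of element `E`. -/
def verts (E : Fin nE) : Finset (Fin nV) := Finset.univ.image (M.cell E)

/-- Vertices of the `f`-th facet (edge if `d = 2`, face if `d = 3`) of element `E`. -/
def facet (E : Fin nE) (f : Fin s.nv) : Finset (Fin nV) := (s.facetVerts f).image (M.cell E)

/-- The closed facet as a set of points. -/
def facetSet (E : Fin nE) (f : Fin s.nv) : Set (Vec d) :=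
  convexHull ℝ (M.pt '' (M.facet E f : Set (Fin nV)))

/-- The facet belongs to one element only. -/
def IsBoundary (E : Fin nE) (f : Fin s.nv) : Prop :=
  ∀ E' f', M.facet E' f' = M.facet E f → E' = E

/-- The facet is a boundary facet contained in the part `Γ` of the boundary. -/
def IsOn (Γ : Set (Vec d)) (E : Fin nE) (f : Fin s.nv) : Prop :=
  M.IsBoundary E f ∧ M.facetSet E f ⊆ Γ

end Cells

/-- A conforming finite element partition of `Ω` into triangles, tetrahedra or convex
quadrilaterals. -/
structure Mesh {d : ℕ} (s : Shape d) (Ω : Set (Vec d)) (nE nV : ℕ) extends Cells s nE nV where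
  pt_injective : Function.Injective pt
  /-- each element map is a bijection from the reference element onto the element -/
  F_injOn : ∀ E, Set.InjOn (toCells.F E) s.refElem
  /-- no element is degenerate; on quadrilaterals this forces strict convexity -/
  det_ne_zero : ∀ E, ∀ x ∈ s.refElem, (toCells.DF E x).det ≠ 0
  interior_disjoint : ∀ E E', E ≠ E' →
    Disjoint (interior (toCells.cellSet E)) (interior (toCells.cellSet E'))
  /-- two elements meet exactly in the convex hull of their common vertices -/
  conforming : ∀ E E', E ≠ E' → toCells.cellSet E ∩ toCells.cellSet E' =
    convexHull ℝ (pt '' ((toCells.verts E ∩ toCells.verts E' : Finset (Fin nV)) : Set (Fin nV)))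
  cover : ⋃ E, toCells.cellSet E = closure Ω
  /-- the boundary of `Ω` consists of the facets that belong to one element only -/
  boundary : ⋃ E, ⋃ f, ⋃ _ : toCells.IsBoundary E f, toCells.facetSet E f = frontier Ω

/-- A splitting of `∂Ω` into a Dirichlet part of positive surface measure and a Neumann part,
overlapping in a null set at most.  (As usual, the closed parts are meant.) -/
structure BoundarySplit {d : ℕ} (Ω : Set (Vec d)) where
  D : Set (Vec d)
  N : Set (Vec d)
  union : D ∪ N = frontier Ω
  overlap : Measure.hausdorffMeasure ((d : ℝ) - 1) (D ∩ N) = 0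
  D_pos : 0 < Measure.hausdorffMeasure ((d : ℝ) - 1) D

namespace Cells

variable {d : ℕ} {s : Shape d} {nE nV : ℕ} (M : Cells s nE nV)

/-- Every boundary facet lies entirely in one of the two parts of the boundary. -/
def Resolves {Ω : Set (Vec d)} (Γ : BoundarySplit Ω) : Prop :=
  ∀ E f, M.IsBoundary E f → M.facetSet E f ⊆ Γ.D ∨ M.facetSet E f ⊆ Γ.N

/-- Each element has at most one facet on the Neumann part. -/
def AtMostOneNeumann {Ω : Set (Vec d)} (Γ : BoundarySplit Ω) : Prop :=
  ∀ E f f', M.IsOn Γ.N E f → M.IsOn Γ.N E f' → f = f'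

/-- Element `E` is the image of the reference element under an affine map; for quadrilaterals this
means that `E` is a parallelogram. -/
def IsAffine (E : Fin nE) : Prop := ∀ x y, M.DF E x = M.DF E y

/-- The fineness required of quadrilateral grids: the elements have diameter less than `h₀`, unless
they are all parallelograms and the Dirichlet part contains at least two edges. -/
def FineEnough {Ω : Set (Vec d)} (Γ : BoundarySplit Ω) (h₀ : ℝ) : Prop :=
  (∀ E, Metric.diam (M.cellSet E) < h₀) ∨
  ((∀ E, M.IsAffine E) ∧
    ∃ E f E' f', M.IsOn Γ.D E f ∧ M.IsOn Γ.D E' f' ∧ (E, f) ≠ (E', f'))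

/-! ### Finite element spaces

A discrete field is given by its mapped functions on the reference element, one for each `E`.
The physical field at the point `F_E x` of `E` is obtained by the transformations below. -/

/-- Piola transformation of vector fields: `ζ = J⁻¹ DF ζ̂`, evaluated at `F_E x`. -/
def velocity (ζ : Fin nE → Vec d → Vec d) (E : Fin nE) (x : Vec d) : Vec d :=
  (M.J E x)⁻¹ • (M.DF E x *ᵥ ζ E x)

/-- Row-wise Piola transformation of stresses: `τᵀ = J⁻¹ DF τ̂ᵀ`, evaluated at `F_E x`. -/
def stress (τ : Fin nE → Vec d → Mat d) (E : Fin nE) (x : Vec d) : Mat d :=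
  (M.J E x)⁻¹ • (τ E x * (M.DF E x)ᵀ)

/-- Weights of a point of a facet in barycentric coordinates of the facet. -/
def IsWeight (e : Finset (Fin nV)) (w : Fin nV → ℝ) : Prop :=
  (∀ v ∈ e, 0 ≤ w v) ∧ ∑ v ∈ e, w v = 1

/-- The point of the reference element whose image under `F_E` is the point `∑ w v • pt v` of the
`f`-th facet of `E`. -/
def refPoint (E : Fin nE) (f : Fin s.nv) (w : Fin nV → ℝ) : Vec d :=
  ∑ i ∈ s.facetVerts f, w (M.cell E i) • s.refVert i

/-- The vector `n` is normal to the `f`-th facet of `E`. -/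
def IsNormal (E : Fin nE) (f : Fin s.nv) (n : Vec d) : Prop :=
  ∀ v ∈ M.facet E f, ∀ v' ∈ M.facet E f, n ⬝ᵥ (M.pt v - M.pt v') = 0

/-- The velocity space `Z_h`: mapped `BDM₁` fields in `H(div)`, i.e. with continuous normal
component across the facets, whose normal component vanishes on `Γ_N`. -/
def Zh (ΓN : Set (Vec d)) : Submodule ℝ (Fin nE → Vec d → Vec d) where
  carrier := {ζ | (∀ E, ζ E ∈ s.bdm) ∧
    (∀ E E' f f', M.facet E f = M.facet E' f' → ∀ n, M.IsNormal E f n →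
      ∀ w, IsWeight (M.facet E f) w →
      n ⬝ᵥ M.velocity ζ E (M.refPoint E f w) = n ⬝ᵥ M.velocity ζ E' (M.refPoint E' f' w)) ∧
    (∀ E f, M.IsOn ΓN E f → ∀ n, M.IsNormal E f n →
      ∀ w, IsWeight (M.facet E f) w → n ⬝ᵥ M.velocity ζ E (M.refPoint E f w) = 0)}
  zero_mem' := ⟨fun _ => s.bdm.zero_mem, by simp [velocity], by simp [velocity]⟩
  add_mem' := by
    rintro ζ η ⟨h1, h2, h3⟩ ⟨k1, k2, k3⟩
    have key : ∀ E x, M.velocity (ζ + η) E x = M.velocity ζ E x + M.velocity η E x := by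
      intro E x; simp [velocity, Matrix.mulVec_add]
    refine ⟨fun E => s.bdm.add_mem (h1 E) (k1 E), ?_, ?_⟩
    · intro E E' f f' hf n hn w hw
      rw [key, key, dotProduct_add, dotProduct_add, h2 E E' f f' hf n hn w hw,
        k2 E E' f f' hf n hn w hw]
    · intro E f hf n hn w hw
      rw [key, dotProduct_add, h3 E f hf n hn w hw, k3 E f hf n hn w hw, add_zero]
  smul_mem' := by
    rintro r ζ ⟨h1, h2, h3⟩
    have key : ∀ E x, M.velocity (r • ζ) E x = r • M.velocity ζ E x := by
      intro E x; simp [velocity, Matrix.mulVec_smul, smul_comm r]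
    refine ⟨fun E => s.bdm.smul_mem r (h1 E), ?_, ?_⟩
    · intro E E' f f' hf n hn w hw
      rw [key, key, dotProduct_smul, dotProduct_smul, h2 E E' f f' hf n hn w hw]
    · intro E f hf n hn w hw
      rw [key, dotProduct_smul, h3 E f hf n hn w hw, smul_zero]

/-- The stress space `X_h`: mapped fields with rows in `BDM₁`, in `H(div)`, i.e. with continuous
normal stress `τ n` across the facets, and `τ n = 0` on `Γ_N`. -/
def Xh (ΓN : Set (Vec d)) : Submodule ℝ (Fin nE → Vec d → Mat d) where
  carrier := {τ | (∀ E a, (fun x => τ E x a) ∈ s.bdm) ∧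
    (∀ E E' f f', M.facet E f = M.facet E' f' → ∀ n, M.IsNormal E f n →
      ∀ w, IsWeight (M.facet E f) w →
      M.stress τ E (M.refPoint E f w) *ᵥ n = M.stress τ E' (M.refPoint E' f' w) *ᵥ n) ∧
    (∀ E f, M.IsOn ΓN E f → ∀ n, M.IsNormal E f n →
      ∀ w, IsWeight (M.facet E f) w → M.stress τ E (M.refPoint E f w) *ᵥ n = 0)}
  zero_mem' := ⟨fun _ _ => s.bdm.zero_mem, by simp [stress], by simp [stress]⟩
  add_mem' := by
    rintro ζ η ⟨h1, h2, h3⟩ ⟨k1, k2, k3⟩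
    have key : ∀ E x, M.stress (ζ + η) E x = M.stress ζ E x + M.stress η E x := by
      intro E x; simp [stress, Matrix.add_mul]
    refine ⟨fun E a => s.bdm.add_mem (h1 E a) (k1 E a), ?_, ?_⟩
    · intro E E' f f' hf n hn w hw
      rw [key, key, Matrix.add_mulVec, Matrix.add_mulVec, h2 E E' f f' hf n hn w hw,
        k2 E E' f f' hf n hn w hw]
    · intro E f hf n hn w hw
      rw [key, Matrix.add_mulVec, h3 E f hf n hn w hw, k3 E f hf n hn w hw, add_zero]
  smul_mem' := by
    rintro r ζ ⟨h1, h2, h3⟩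
    have key : ∀ E x, M.stress (r • ζ) E x = r • M.stress ζ E x := by
      intro E x; simp [stress, smul_comm r]
    refine ⟨fun E a => s.bdm.smul_mem r (h1 E a), ?_, ?_⟩
    · intro E E' f f' hf n hn w hw
      rw [key, key, Matrix.smul_mulVec, Matrix.smul_mulVec, h2 E E' f f' hf n hn w hw]
    · intro E f hf n hn w hw
      rw [key, Matrix.smul_mulVec, h3 E f hf n hn w hw, smul_zero]

/-- The rotation space `Q_h`: skew-symmetric matrix fields, mapped from `P₁` or `Q₁`,
continuous across the facets. -/
def Qh : Submodule ℝ (Fin nE → Vec d → Mat d) where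
  carrier := {ξ | (∀ E x, (ξ E x)ᵀ = -ξ E x) ∧ (∀ E a b, (fun x => ξ E x a b) ∈ s.nodal) ∧
    (∀ E E' f f', M.facet E f = M.facet E' f' → ∀ w, IsWeight (M.facet E f) w →
      ξ E (M.refPoint E f w) = ξ E' (M.refPoint E' f' w))}
  zero_mem' := ⟨by simp, fun _ _ _ => s.nodal.zero_mem, by simp⟩
  add_mem' := by
    rintro ζ η ⟨h1, h2, h3⟩ ⟨k1, k2, k3⟩
    refine ⟨fun E x => ?_, fun E a b => s.nodal.add_mem (h2 E a b) (k2 E a b), ?_⟩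
    · simp [h1 E x, k1 E x, add_comm]
    · intro E E' f f' hf w hw
      simp [h3 E E' f f' hf w hw, k3 E E' f f' hf w hw]
  smul_mem' := by
    rintro r ζ ⟨h1, h2, h3⟩
    refine ⟨fun E x => ?_, fun E a b => s.nodal.smul_mem r (h2 E a b), ?_⟩
    · simp [h1 E x]
    · intro E E' f f' hf w hw
      simp [h3 E E' f f' hf w hw]

end Cells

/-- The displacement space `V_h` of piecewise constant vector fields. -/
abbrev Vh (d nE : ℕ) := Fin nE → Vec d

/-- The pressure space `W_h` of piecewise constants. -/
abbrev Wh (nE : ℕ) := Fin nE → ℝ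

/-- The data of the problem.  The tensors may be discontinuous across facets, so they are given on
each closed element. -/
structure Coefficients {d : ℕ} {s : Shape d} {nE nV : ℕ} (M : Cells s nE nV) where
  /-- compliance tensor -/
  A : Fin nE → Vec d → (Mat d →ₗ[ℝ] Mat d)
  A_symm : ∀ E, ∀ x ∈ M.cellSet E, ∀ σ τ, frob (A E x σ) τ = frob σ (A E x τ)
  A_pos : ∀ E, ∀ x ∈ M.cellSet E, ∀ τ, τ ≠ 0 → 0 < frob (A E x τ) τ
  /-- permeability divided by viscosity -/
  K : Fin nE → Vec d → Mat d
  K_pos : ∀ E, ∀ x ∈ M.cellSet E, (K E x).PosDef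
  /-- storativity -/
  c₀ : ℝ
  c₀_nonneg : 0 ≤ c₀
  /-- Biot-Willis constant -/
  α : ℝ
  α_pos : 0 < α
  α_le_one : α ≤ 1

namespace Cells

variable {d : ℕ} {s : Shape d} {nE nV : ℕ} (M : Cells s nE nV)

/-! ### Bilinear forms -/

/-- The vertex quadrature rule `∑_E |Ê| / s ∑_i φ_E(r_i) J_E(r̂_i)`; the argument is the integrand
at the `i`-th vertex of `E`. -/
def quad (φ : Fin nE → Fin s.nv → ℝ) : ℝ :=
  ∑ E, volume.real s.refElem / s.nv * ∑ i, φ E i * M.J E (s.refVert i)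

/-- The integral over `Ω`, computed elementwise on the reference element; `φ E x` is the value of
the integrand at the point `F_E x` of `E`. -/
def integral (φ : Fin nE → Vec d → ℝ) : ℝ :=
  ∑ E, ∫ x in s.refElem, φ E x * M.J E x

/-- Divergence of a vector field on the reference element. -/
def refDiv (f : Vec d → Vec d) (x : Vec d) : ℝ := ∑ b, fderiv ℝ f x (Pi.single b 1) b

/-- Divergence of the velocity at `F_E x`: the Piola transformation gives `div ζ = J⁻¹ div ζ̂`. -/
def divVelocity (ζ : Fin nE → Vec d → Vec d) (E : Fin nE) (x : Vec d) : ℝ :=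
  (M.J E x)⁻¹ * refDiv (ζ E) x

/-- Row-wise divergence of the stress at `F_E x`. -/
def divStress (τ : Fin nE → Vec d → Mat d) (E : Fin nE) (x : Vec d) : Vec d :=
  fun a => (M.J E x)⁻¹ * refDiv (fun y => τ E y a) x

variable {M} (c : Coefficients M)

/-- The compliance tensor at the `i`-th vertex of `E`. -/
def Avert (E : Fin nE) (i : Fin s.nv) : Mat d →ₗ[ℝ] Mat d := c.A E (M.pt (M.cell E i))

variable (M) in
/-- The stress at the `i`-th vertex of `E`. -/
def sVert (τ : Fin nE → Vec d → Mat d) (E : Fin nE) (i : Fin s.nv) : Mat d :=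
  M.stress τ E (s.refVert i)

/-- `(A σ, τ)_Q` -/
def formσσ (σ τ : Fin nE → Vec d → Mat d) : ℝ :=
  M.quad fun E i => frob (Avert c E i (M.sVert σ E i)) (M.sVert τ E i)

variable (M) in
/-- `(div σ, v)` -/
def formσu (σ : Fin nE → Vec d → Mat d) (v : Vh d nE) : ℝ :=
  M.integral fun E x => M.divStress σ E x ⬝ᵥ v E

variable (M) in
/-- `(σ, ξ)_Q` -/
def formσγ (σ ξ : Fin nE → Vec d → Mat d) : ℝ :=
  M.quad fun E i => frob (M.sVert σ E i) (ξ E (s.refVert i))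

/-- `α (A σ, w I)_Q` -/
def formσp (σ : Fin nE → Vec d → Mat d) (w : Wh nE) : ℝ :=
  c.α * M.quad fun E i => frob (Avert c E i (M.sVert σ E i)) (w E • (1 : Mat d))

/-- `(K⁻¹ z, ζ)_Q` -/
def formzz (z ζ : Fin nE → Vec d → Vec d) : ℝ :=
  M.quad fun E i => ((c.K E (M.pt (M.cell E i)))⁻¹ *ᵥ M.velocity z E (s.refVert i)) ⬝ᵥ
    M.velocity ζ E (s.refVert i)

variable (M) in
/-- `-(div z, w)` -/
def formzp (z : Fin nE → Vec d → Vec d) (w : Wh nE) : ℝ :=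
  -M.integral fun E x => M.divVelocity z E x * w E

/-- `(c₀ p, w) + α (A α p I, w I)_Q` -/
def formpp (p w : Wh nE) : ℝ :=
  (M.integral fun E _ => c.c₀ * p E * w E) +
    c.α * M.quad fun E i => frob (Avert c E i ((c.α * p E) • (1 : Mat d))) (w E • (1 : Mat d))

end Cells

/-! ### The algebraic system and its reduction -/

/-- The matrices of the five-field system; `X, V, Q, Z, W` index the degrees of freedom of stress,
displacement, rotation, velocity and pressure. -/
structure Blocks (X V Q Z W : Type*) where
  σσ : Matrix X X ℝ
  σu : Matrix V X ℝ
  σγ : Matrix Q X ℝ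
  σp : Matrix W X ℝ
  zz : Matrix Z Z ℝ
  zp : Matrix W Z ℝ
  pp : Matrix W W ℝ

/-- The matrices of the discrete problem in given bases of the five finite element spaces. -/
def assemble {d : ℕ} {s : Shape d} {nE nV : ℕ} {M : Cells s nE nV} (c : Coefficients M)
    {Γu Γp : Set (Vec d)} {X V Q Z W : Type*}
    (bX : Module.Basis X ℝ (M.Xh Γu)) (bV : Module.Basis V ℝ (Vh d nE))
    (bQ : Module.Basis Q ℝ M.Qh) (bZ : Module.Basis Z ℝ (M.Zh Γp))
    (bW : Module.Basis W ℝ (Wh nE)) : Blocks X V Q Z W where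
  σσ := Matrix.of fun i j => Cells.formσσ c (bX j : Fin nE → Vec d → Mat d) (bX i)
  σu := Matrix.of fun i j => M.formσu (bX j) (bV i)
  σγ := Matrix.of fun i j => M.formσγ (bX j) (bQ i)
  σp := Matrix.of fun i j => Cells.formσp c (bX j) (bW i)
  zz := Matrix.of fun i j => Cells.formzz c (bZ j : Fin nE → Vec d → Vec d) (bZ i)
  zp := Matrix.of fun i j => M.formzp (bZ j) (bW i)
  pp := Matrix.of fun i j => Cells.formpp c (bW j) (bW i)

namespace Blocks

variable {X V Q Z W : Type*} [Fintype X] [Fintype V] [Fintype Q] [Fintype Z] [Fintype W]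
  [DecidableEq X] [DecidableEq V] [DecidableEq Q] [DecidableEq Z] [DecidableEq W]
  (B : Blocks X V Q Z W)

/-- The five-field system of one backward Euler step of length `Δt` (the last equation is multiplied
by `Δt`); `f` and `g` are the right-hand sides of the second and the last equation. -/
def IsSolution (Δt : ℝ) (σ : X → ℝ) (u : V → ℝ) (γ : Q → ℝ) (z : Z → ℝ) (p : W → ℝ)
    (f : V → ℝ) (g : W → ℝ) : Prop :=
  B.σσ *ᵥ σ + B.σuᵀ *ᵥ u + B.σγᵀ *ᵥ γ + B.σpᵀ *ᵥ p = 0 ∧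
  -(B.σu *ᵥ σ) = f ∧
  -(B.σγ *ᵥ σ) = 0 ∧
  B.zz *ᵥ z + B.zpᵀ *ᵥ p = 0 ∧
  B.σp *ᵥ σ - Δt • (B.zp *ᵥ z) + B.pp *ᵥ p = g

def uσu : Matrix V V ℝ := B.σu * B.σσ⁻¹ * B.σuᵀ
def uσγ : Matrix V Q ℝ := B.σu * B.σσ⁻¹ * B.σγᵀ
def γσγ : Matrix Q Q ℝ := B.σγ * B.σσ⁻¹ * B.σγᵀ
def uσp : Matrix V W ℝ := B.σu * B.σσ⁻¹ * B.σpᵀ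
def γσp : Matrix Q W ℝ := B.σγ * B.σσ⁻¹ * B.σpᵀ
def pσzp (Δt : ℝ) : Matrix W W ℝ :=
  B.pp - B.σp * B.σσ⁻¹ * B.σpᵀ + Δt • (B.zp * B.zz⁻¹ * B.zpᵀ)

def A11 : Matrix V V ℝ := B.uσu - B.uσγ * B.γσγ⁻¹ * B.uσγᵀ
def A12 : Matrix V W ℝ := B.uσp - B.uσγ * B.γσγ⁻¹ * B.γσp
def A21 : Matrix W V ℝ := -B.uσpᵀ + B.γσpᵀ * B.γσγ⁻¹ * B.uσγᵀ
def A22 (Δt : ℝ) : Matrix W W ℝ := B.pσzp Δt + B.γσpᵀ * B.γσγ⁻¹ * B.γσp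

/-- The displacement-pressure matrix. -/
def reduced (Δt : ℝ) : Matrix (V ⊕ W) (V ⊕ W) ℝ :=
  Matrix.fromBlocks B.A11 B.A12 B.A21 (B.A22 Δt)

end Blocks

end Biot

end

-- The algebra is short. If `σσ` and `zz` are positive definite and the transposed couplings `(u, γ)
-- ↦ σuᵀ u + σγᵀ γ` and `p ↦ zpᵀ p` are injective, then `γσγ` and `A11` are congruences of `σσ⁻¹` by
-- injective matrices. `A22` is the sum of the storage Schur complement `pp - σp σσ⁻¹ σpᵀ`, which is
-- semidefinite because `(A(τ - αpI), τ - αpI)_Q ≥ 0`, the definite Darcy term, and a semidefinite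
-- rotation term. The off-diagonal blocks cancel in the quadratic form of the whole matrix.
-- Definiteness of `σσ` and `zz` holds because a `BDM₁` field is determined by its values at the
-- vertices, so the quadrature rule detects every nonzero field.
--
-- The real content is the two injectivity statements, which are inf-sup conditions without
-- constants. Both are tested with corner fields: for a facet and one of its vertices, a field of
-- `Z_h` supported on the elements sharing the facet, with zero normal component on all other
-- facets, constant reference divergence, and a nonzero value at that one vertex only. For the flow
-- this says that the pressure does not jump across interior facets and vanishes next to a Dirichlet
-- facet; since the mesh is connected through facets, `p = 0`.
--
-- For elasticity, corner fields times constant vectors give, at each vertex `i` of a facet, one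
-- vector equation between `v` and the single value `ξ_i` (`residual_interior`,
-- `residual_boundary`). On simplices they reduce to `(ξ_i - ξ_j)(P' - P) = 0` for interior facets,
-- where `P`, `P'` are the apexes on the two sides, and to `ξ_i (P_i - P) = 0` on Dirichlet facets.
-- In the plane a nonzero skew matrix is injective, so `ξ` is constant along every edge off `Γ_N`
-- and zero at Dirichlet edges. In space these equations only say that jumps of the axial vector are
-- parallel to the apex displacement. A nonzero jump `δ` is then excluded by an extremal argument:
-- among the elements with a jump parallel to `δ`, take the one furthest in direction `δ`; two
-- different neighbours would both be displaced in direction `-δ`, and they would overlap.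
--
-- On quadrilaterals the vanishing of `ξ` at one vertex spreads over the whole mesh, so one zero has
-- to be found. On parallelograms `ξ` is a constant `X`, and two Dirichlet edges give `X (m₁ - m₂) =
-- 0` for distinct sums `m₁`, `m₂` of end points. On fine meshes one turns around a vertex near a
-- point in the relative interior of the Dirichlet part: a corner value of `v` and `ξ` is preserved
-- across interior edges, and two boundary edges at the vertex force `ξ = 0` there.

attribute [reducible] Biot.Shape.nv

noncomputable section

set_option linter.unusedSectionVars false

/-! ### Block elimination and Schur complements -/

namespace Biot

namespace Blocks

variable {X V Q Z W : Type*} [Fintype X] [Fintype V] [Fintype Q] [Fintype Z] [Fintype W]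
  [DecidableEq X] [DecidableEq V] [DecidableEq Q] [DecidableEq Z] [DecidableEq W]
  {B : Blocks X V Q Z W}

theorem uσγ_transpose (hσ : B.σσ.PosDef) : B.uσγᵀ = B.σγ * B.σσ⁻¹ * B.σuᵀ := by
  have h : (B.σσ⁻¹)ᵀ = B.σσ⁻¹ := hσ.inv.isHermitian
  simp [uσγ, Matrix.transpose_mul, h, Matrix.mul_assoc]

theorem uσp_transpose (hσ : B.σσ.PosDef) : B.uσpᵀ = B.σp * B.σσ⁻¹ * B.σuᵀ := by
  have h : (B.σσ⁻¹)ᵀ = B.σσ⁻¹ := hσ.inv.isHermitian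
  simp [uσp, Matrix.transpose_mul, h, Matrix.mul_assoc]

theorem γσp_transpose (hσ : B.σσ.PosDef) : B.γσpᵀ = B.σp * B.σσ⁻¹ * B.σγᵀ := by
  have h : (B.σσ⁻¹)ᵀ = B.σσ⁻¹ := hσ.inv.isHermitian
  simp [γσp, Matrix.transpose_mul, h, Matrix.mul_assoc]

/-- A congruence of `σσ⁻¹` by `σγᵀ`, which is injective by the case `u = 0` of `hk`. -/
theorem γσγ_posDef (hσ : B.σσ.PosDef)
    (hk : ∀ u γ, B.σuᵀ *ᵥ u + B.σγᵀ *ᵥ γ = 0 → u = 0 ∧ γ = 0) : B.γσγ.PosDef := by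
  have := hσ.inv.conjTranspose_mul_mul_same (B := B.σγᵀ) (by
    intro x y hxy
    have h := (hk 0 (x - y) (by simpa [Matrix.mulVec_sub, sub_eq_zero] using hxy)).2
    exact sub_eq_zero.1 h)
  simpa [γσγ, Matrix.conjTranspose_eq_transpose_of_trivial] using this

theorem A21_eq (hσ : B.σσ.PosDef)
    (hk : ∀ u γ, B.σuᵀ *ᵥ u + B.σγᵀ *ᵥ γ = 0 → u = 0 ∧ γ = 0) : B.A21 = -B.A12ᵀ := by
  have h : (B.γσγ⁻¹)ᵀ = B.γσγ⁻¹ := (γσγ_posDef hσ hk).inv.isHermitian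
  simp [A21, A12, Matrix.transpose_mul, h, Matrix.mul_assoc]
  abel

/-- The Schur complement is again a congruence of `σσ⁻¹`, by the matrix sending `u` to `σuᵀ u + σγᵀ
γ` with the rotation `γ = -γσγ⁻¹ uσγᵀ u` eliminated. By `hk` this vector vanishes only for `u = 0`.
-/
theorem A11_posDef (hσ : B.σσ.PosDef)
    (hk : ∀ u γ, B.σuᵀ *ᵥ u + B.σγᵀ *ᵥ γ = 0 → u = 0 ∧ γ = 0) : B.A11.PosDef := by
  have hG := γσγ_posDef hσ hk
  have hG' : (B.γσγ⁻¹)ᵀ = B.γσγ⁻¹ := hG.inv.isHermitian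
  have hGu : B.γσγ * B.γσγ⁻¹ = 1 :=
    Matrix.mul_nonsing_inv _ ((Matrix.isUnit_iff_isUnit_det _).1 hG.isUnit)
  have := hσ.inv.conjTranspose_mul_mul_same (B := B.σuᵀ - B.σγᵀ * (B.γσγ⁻¹ * B.uσγᵀ)) (by
    intro x y hxy
    have h := (hk (x - y) (-((B.γσγ⁻¹ * B.uσγᵀ) *ᵥ (x - y))) (by
      have : (B.σuᵀ - B.σγᵀ * (B.γσγ⁻¹ * B.uσγᵀ)) *ᵥ (x - y) = 0 := by
        rw [Matrix.mulVec_sub]; exact sub_eq_zero.2 hxy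
      rw [Matrix.sub_mulVec, ← Matrix.mulVec_mulVec] at this
      rw [Matrix.mulVec_neg, ← sub_eq_add_neg, this])).1
    exact sub_eq_zero.1 h)
  have e : (B.σuᵀ - B.σγᵀ * (B.γσγ⁻¹ * B.uσγᵀ))ᴴ = B.σu - B.uσγ * B.γσγ⁻¹ * B.σγ := by
    simp [Matrix.conjTranspose_eq_transpose_of_trivial, Matrix.transpose_mul, hG', Matrix.mul_assoc]
  -- After one factor `γσγ γσγ⁻¹` cancels, the last three terms are copies of `uσγ γσγ⁻¹ uσγᵀ` with
  -- signs -, -, +, so one negative copy is left.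
  have e1 : (B.σu - B.uσγ * B.γσγ⁻¹ * B.σγ) * B.σσ⁻¹ * (B.σuᵀ - B.σγᵀ * (B.γσγ⁻¹ * B.uσγᵀ))
      = B.σu * B.σσ⁻¹ * B.σuᵀ - (B.σu * B.σσ⁻¹ * B.σγᵀ) * B.γσγ⁻¹ * B.uσγᵀ
        - B.uσγ * B.γσγ⁻¹ * (B.σγ * B.σσ⁻¹ * B.σuᵀ)
        + B.uσγ * B.γσγ⁻¹ * ((B.σγ * B.σσ⁻¹ * B.σγᵀ) * B.γσγ⁻¹) * B.uσγᵀ := by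
    simp only [Matrix.sub_mul, Matrix.mul_sub, Matrix.mul_assoc]
    abel
  rw [← uσγ_transpose hσ] at e1
  change _ = B.uσu - B.uσγ * _ * _ - _ + _ * (B.γσγ * _) * _ at e1
  rw [e, e1, hGu] at this
  simpa [A11] using this

/-- Semidefinite storage part, definite Darcy part, semidefinite rotation part. Strictness comes
from the Darcy part alone, so `c₀ = 0` does no harm. -/
theorem A22_posDef {Δt : ℝ} (hΔt : 0 < Δt) (hσ : B.σσ.PosDef) (hz : B.zz.PosDef)
    (hpp : B.ppᵀ = B.pp)
    (hk : ∀ u γ, B.σuᵀ *ᵥ u + B.σγᵀ *ᵥ γ = 0 → u = 0 ∧ γ = 0)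
    (hzp : ∀ p, B.zpᵀ *ᵥ p = 0 → p = 0)
    (hs : ∀ p y, 0 ≤ p ⬝ᵥ (B.pp *ᵥ p) - 2 * (y ⬝ᵥ (B.σpᵀ *ᵥ p)) + y ⬝ᵥ (B.σσ *ᵥ y)) :
    (B.A22 Δt).PosDef := by
  have hG := γσγ_posDef hσ hk
  have hS' : (B.σσ⁻¹)ᵀ = B.σσ⁻¹ := hσ.inv.isHermitian
  have hSu : B.σσ * B.σσ⁻¹ = 1 :=
    Matrix.mul_nonsing_inv _ ((Matrix.isUnit_iff_isUnit_det _).1 hσ.isUnit)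
  have h1 : (B.pp - B.σp * B.σσ⁻¹ * B.σpᵀ).PosSemidef := by
    refine Matrix.PosSemidef.of_dotProduct_mulVec_nonneg ?_ ?_
    · change _ᴴ = _
      simp [Matrix.conjTranspose_eq_transpose_of_trivial, Matrix.transpose_mul, hS', hpp,
        Matrix.mul_assoc]
    · intro p
      -- This `y` minimizes the quadratic expression in `hs`; the minimum is the Schur complement.
      have := hs p (B.σσ⁻¹ *ᵥ (B.σpᵀ *ᵥ p))
      have e2 : B.σσ *ᵥ (B.σσ⁻¹ *ᵥ (B.σpᵀ *ᵥ p)) = B.σpᵀ *ᵥ p := by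
        rw [Matrix.mulVec_mulVec, hSu, Matrix.one_mulVec]
      rw [e2] at this
      have e3 : p ⬝ᵥ ((B.σp * B.σσ⁻¹ * B.σpᵀ) *ᵥ p)
          = (B.σσ⁻¹ *ᵥ (B.σpᵀ *ᵥ p)) ⬝ᵥ (B.σpᵀ *ᵥ p) := by
        rw [Matrix.mul_assoc, ← Matrix.mulVec_mulVec, Matrix.dotProduct_mulVec,
          ← Matrix.mulVec_transpose, ← Matrix.mulVec_mulVec, dotProduct_comm]
      rw [star_trivial, Matrix.sub_mulVec, dotProduct_sub, e3]
      linarith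
  have h2 : (Δt • (B.zp * B.zz⁻¹ * B.zpᵀ)).PosDef := by
    refine Matrix.PosDef.smul ?_ hΔt
    have := hz.inv.conjTranspose_mul_mul_same (B := B.zpᵀ) (by
      intro x y hxy
      have h := hzp (x - y) (by simpa [Matrix.mulVec_sub, sub_eq_zero] using hxy)
      exact sub_eq_zero.1 h)
    simpa [Matrix.conjTranspose_eq_transpose_of_trivial] using this
  have h3 : (B.γσpᵀ * B.γσγ⁻¹ * B.γσp).PosSemidef := by
    have := hG.inv.posSemidef.conjTranspose_mul_mul_same B.γσp
    simpa [Matrix.conjTranspose_eq_transpose_of_trivial] using this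
  exact (Matrix.PosDef.posSemidef_add h1 h2).add_posSemidef h3

theorem posDef_mulVec_add_eq_zero_iff {n : Type*} [Fintype n] [DecidableEq n] {S : Matrix n n ℝ}
    (hS : S.PosDef) (x y : n → ℝ) : S *ᵥ x + y = 0 ↔ x = -(S⁻¹ *ᵥ y) := by
  have hu := (Matrix.isUnit_iff_isUnit_det _).1 hS.isUnit
  constructor
  · intro h
    have : S⁻¹ *ᵥ (S *ᵥ x + y) = 0 := by rw [h, Matrix.mulVec_zero]
    rw [Matrix.mulVec_add, Matrix.mulVec_mulVec, Matrix.nonsing_inv_mul _ hu,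
      Matrix.one_mulVec] at this
    exact eq_neg_of_add_eq_zero_left this
  · rintro rfl
    rw [Matrix.mulVec_neg, Matrix.mulVec_mulVec, Matrix.mul_nonsing_inv _ hu,
      Matrix.one_mulVec, neg_add_cancel]

theorem isSolution_iff {Δt : ℝ} (hσ : B.σσ.PosDef) (hz : B.zz.PosDef)
    (hk : ∀ u γ, B.σuᵀ *ᵥ u + B.σγᵀ *ᵥ γ = 0 → u = 0 ∧ γ = 0)
    (σ : X → ℝ) (u : V → ℝ) (γ : Q → ℝ) (z : Z → ℝ) (p : W → ℝ) (f : V → ℝ) (g : W → ℝ) :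
    B.IsSolution Δt σ u γ z p f g ↔
      (σ = -(B.σσ⁻¹ *ᵥ (B.σuᵀ *ᵥ u + B.σγᵀ *ᵥ γ + B.σpᵀ *ᵥ p)) ∧
       z = -(B.zz⁻¹ *ᵥ (B.zpᵀ *ᵥ p)) ∧
       γ = -(B.γσγ⁻¹ *ᵥ (B.γσp *ᵥ p + B.uσγᵀ *ᵥ u)) ∧
       B.reduced Δt *ᵥ Sum.elim u p = Sum.elim f g) := by
  have hG := γσγ_posDef hσ hk
  unfold IsSolution
  rw [add_assoc, add_assoc, posDef_mulVec_add_eq_zero_iff hσ, ← add_assoc,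
    posDef_mulVec_add_eq_zero_iff hz, ← posDef_mulVec_add_eq_zero_iff hG]
  have hred : B.reduced Δt *ᵥ Sum.elim u p = Sum.elim f g ↔
      B.A11 *ᵥ u + B.A12 *ᵥ p = f ∧ B.A21 *ᵥ u + B.A22 Δt *ᵥ p = g := by
    rw [reduced, Matrix.fromBlocks_mulVec]
    simp only [Sum.elim_comp_inl, Sum.elim_comp_inr]
    constructor
    · intro h
      exact ⟨funext fun i => congrFun h (Sum.inl i), funext fun i => congrFun h (Sum.inr i)⟩
    · rintro ⟨h1, h2⟩; rw [h1, h2]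
  rw [hred]
  constructor
  · rintro ⟨h1, h2, h3, h4, h5⟩
    have h3' : B.γσγ *ᵥ γ + (B.γσp *ᵥ p + B.uσγᵀ *ᵥ u) = 0 := by
      rw [h1] at h3
      rw [uσγ_transpose hσ, γσγ, γσp]
      simp only [Matrix.mulVec_neg, Matrix.mulVec_add, Matrix.mulVec_mulVec, neg_neg,
        Matrix.mul_assoc] at h3 ⊢
      rw [← h3]; abel
    refine ⟨h1, h4, h3', ?_⟩
    have hγ := (posDef_mulVec_add_eq_zero_iff hG _ _).1 h3'
    constructor
    · rw [← h2, h1, hγ, A11, A12, uσu, uσp]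
      simp only [Matrix.mulVec_neg, Matrix.mulVec_add, Matrix.sub_mulVec, neg_neg, neg_add,
        Matrix.mulVec_mulVec, uσγ, Matrix.mul_assoc]
      abel
    · rw [← h5, h1, h4, hγ, A21, A22, pσzp, uσp_transpose hσ, γσp_transpose hσ]
      simp only [Matrix.mulVec_neg, Matrix.mulVec_add, Matrix.sub_mulVec, neg_neg, neg_add,
        Matrix.mulVec_mulVec, Matrix.mul_assoc, Matrix.add_mulVec, Matrix.neg_mulVec, smul_neg,
        Matrix.smul_mulVec]
      abel
  · rintro ⟨h1, h4, h3', h2, h5⟩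
    have hγ := (posDef_mulVec_add_eq_zero_iff hG _ _).1 h3'
    refine ⟨h1, ?_, ?_, h4, ?_⟩
    · rw [← h2, h1, hγ, A11, A12, uσu, uσp]
      simp only [Matrix.mulVec_neg, Matrix.mulVec_add, Matrix.sub_mulVec, neg_neg, neg_add,
        Matrix.mulVec_mulVec, uσγ, Matrix.mul_assoc]
      abel
    · rw [h1, ← h3']
      rw [uσγ_transpose hσ, γσγ, γσp]
      simp only [Matrix.mulVec_neg, Matrix.mulVec_add, Matrix.mulVec_mulVec, neg_neg,
        Matrix.mul_assoc]
      abel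
    · rw [← h5, h1, h4, hγ, A21, A22, pσzp, uσp_transpose hσ, γσp_transpose hσ]
      simp only [Matrix.mulVec_neg, Matrix.mulVec_add, Matrix.sub_mulVec, neg_neg, neg_add,
        Matrix.mulVec_mulVec, Matrix.mul_assoc, Matrix.add_mulVec, Matrix.neg_mulVec, smul_neg,
        Matrix.smul_mulVec]
      abel

/-- The two off-diagonal contributions to the quadratic form cancel by block skew-symmetry. -/
theorem reduced_pos {Δt : ℝ} (h11 : B.A11.PosDef) (h22 : (B.A22 Δt).PosDef)
    (h21 : B.A21 = -B.A12ᵀ) (x : V ⊕ W → ℝ) (hx : x ≠ 0) :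
    0 < x ⬝ᵥ (B.reduced Δt *ᵥ x) := by
  obtain ⟨u, p, rfl⟩ : ∃ u p, x = Sum.elim u p :=
    ⟨x ∘ Sum.inl, x ∘ Sum.inr, (Sum.elim_comp_inl_inr x).symm⟩
  rw [reduced, Matrix.fromBlocks_mulVec]
  simp only [Sum.elim_comp_inl, Sum.elim_comp_inr, sumElim_dotProduct_sumElim]
  have h : p ⬝ᵥ (B.A21 *ᵥ u) = -(u ⬝ᵥ (B.A12 *ᵥ p)) := by
    rw [h21, Matrix.neg_mulVec, dotProduct_neg, Matrix.mulVec_transpose, dotProduct_comm,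
      ← Matrix.dotProduct_mulVec]
  rw [dotProduct_add, dotProduct_add, h]
  by_cases hu : u = 0
  · have hp : p ≠ 0 := by
      rintro rfl; apply hx; ext i; cases i <;> simp [hu]
    have := h22.dotProduct_mulVec_pos hp
    simp only [star_trivial] at this
    simpa [hu] using this
  · have h1 := h11.dotProduct_mulVec_pos hu
    have h2 := h22.posSemidef.dotProduct_mulVec_nonneg p
    simp only [star_trivial] at h1 h2
    linarith

end Blocks
end Biot

/-! ### Reference elements and shape functions -/

namespace Biot

namespace Shape

variable {d : ℕ}

/-- The vertex joined to vertex `i` by the edge at `i` that leaves the facet `f`. -/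
def opp : {d : ℕ} → (s : Shape d) → Fin s.nv → Fin s.nv → Fin s.nv
  | _, simplex _ => fun f _ => f
  | _, square => fun (f i : Fin 4) => if i = f then f + 3 else f + 2

/-- The second vertex of an edge of the square. -/
def along (f i : Fin 4) : Fin 4 := if i = f then f + 1 else f

/-- Quadratic function on the square vanishing on the two edges adjacent to the edge `f`. -/
def bubble (f : Fin 4) (x : Vec 2) : ℝ :=
  ![x 0 ^ 2 - x 0, x 1 ^ 2 - x 1, x 0 ^ 2 - x 0, x 1 ^ 2 - x 1] f / 2

/-- The reference `BDM₁` field whose normal component on the facet `f` is nonzero only at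
vertex `i`, and whose normal components on the other facets vanish. -/
def hat : {d : ℕ} → (s : Shape d) → Fin s.nv → Fin s.nv → Vec d → Vec d
  | _, simplex d => fun f i x =>
      (simplex d).shapeFn i x • ((simplex d).refVert i - (simplex d).refVert f)
  | _, square => fun f i x =>
      square.shapeFn i x • (square.refVert i - square.refVert (square.opp f i)) +
        -- The first summand alone already has the right normal components, but its term `x y` is
        -- not in `BDM₁`. The bubble completes it to a curl; it is tangential on `f` and on the
        -- opposite edge, and vanishes on the other two.
        bubble f x • (square.refVert (along f i) - square.refVert i)

/-- The constant divergence of `hat`. -/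
def hatDiv : {d : ℕ} → Shape d → ℝ
  | _, simplex _ => 1
  | _, square => 1 / 2

theorem simplex_shapeFn_zero (x : Vec d) :
    (simplex d).shapeFn (0 : Fin (d + 1)) x = 1 - ∑ j, x j := rfl

theorem simplex_shapeFn_succ (x : Vec d) (j : Fin d) :
    (simplex d).shapeFn (j.succ : Fin (d + 1)) x = x j := rfl

theorem simplex_refVert_zero : (simplex d).refVert (0 : Fin (d + 1)) = 0 := rfl

theorem simplex_refVert_succ (j : Fin d) :
    (simplex d).refVert (j.succ : Fin (d + 1)) = Pi.single j 1 := rfl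

theorem sum_shapeFn (s : Shape d) (x : Vec d) : ∑ i, s.shapeFn i x = 1 := by
  cases s with
  | simplex =>
    change ∑ i : Fin (d + 1), _ = _
    rw [Fin.sum_univ_succ]
    simp [simplex_shapeFn_zero, simplex_shapeFn_succ]
  | square =>
    change ∑ i : Fin 4, _ = _
    simp [Fin.sum_univ_four, shapeFn]; ring

theorem sum_shapeFn_smul_refVert (s : Shape d) (x : Vec d) :
    ∑ i, s.shapeFn i x • s.refVert i = x := by
  cases s with
  | simplex =>
    change ∑ i : Fin (d + 1), _ = _
    rw [Fin.sum_univ_succ]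
    simp only [simplex_shapeFn_succ, simplex_refVert_zero, simplex_refVert_succ, smul_zero,
      zero_add]
    ext j
    simp [Finset.sum_apply, Pi.single_apply]
  | square =>
    change ∑ i : Fin 4, _ = _
    ext j
    fin_cases j <;> simp [Fin.sum_univ_four, shapeFn, refVert] <;> ring

theorem simplex_shapeFn_affine (i : Fin (d + 1)) (ι : Type*) (t : Finset ι) (w : ι → ℝ)
    (p : ι → Vec d) (hw : ∑ j ∈ t, w j = 1) :
    (simplex d).shapeFn i (∑ j ∈ t, w j • p j) = ∑ j ∈ t, w j * (simplex d).shapeFn i (p j) := by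
  refine Fin.cases ?_ (fun k => ?_) i
  · simp only [simplex_shapeFn_zero, Finset.sum_apply, Pi.smul_apply, smul_eq_mul, mul_sub,
      mul_one, Finset.sum_sub_distrib, hw, Finset.mul_sum]
    rw [Finset.sum_comm]
  · simp [simplex_shapeFn_succ, Finset.sum_apply]

theorem shapeFn_refVert (s : Shape d) (i j : Fin s.nv) :
    s.shapeFn i (s.refVert j) = if i = j then 1 else 0 := by
  cases s with
  | simplex =>
    change Fin (d + 1) at i j
    refine Fin.cases ?_ (fun k => ?_) i <;> refine Fin.cases ?_ (fun l => ?_) j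
    · simp [simplex_shapeFn_zero, simplex_refVert_zero]
    · rw [simplex_shapeFn_zero, simplex_refVert_succ]
      simp [Fin.ext_iff, Finset.sum_pi_single']
    · rw [simplex_shapeFn_succ, simplex_refVert_zero, if_neg (Fin.succ_ne_zero _)]; rfl
    · rw [simplex_shapeFn_succ, simplex_refVert_succ]
      simp [Pi.single_apply, Fin.ext_iff]
  | square =>
    change Fin 4 at i j
    fin_cases i <;> fin_cases j <;> simp [shapeFn, refVert, Fin.ext_iff]

theorem contDiff_shapeFn (s : Shape d) (i : Fin s.nv) : ContDiff ℝ 1 (s.shapeFn i) := by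
  cases s with
  | simplex =>
    change Fin (d + 1) at i
    refine Fin.cases ?_ (fun k => ?_) i
    · change ContDiff ℝ 1 fun x : Vec d => 1 - ∑ j, x j
      fun_prop
    · change ContDiff ℝ 1 fun x : Vec d => x k
      fun_prop
  | square =>
    change Fin 4 at i
    fin_cases i <;> simp only [shapeFn] <;> simp <;> fun_prop

theorem shapeFn_facet (s : Shape d) (f i : Fin s.nv) (w : Fin s.nv → ℝ)
    (hw : ∑ j ∈ s.facetVerts f, w j = 1) :
    s.shapeFn i (∑ j ∈ s.facetVerts f, w j • s.refVert j) =
      if i ∈ s.facetVerts f then w i else 0 := by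
  cases s with
  | simplex =>
    rw [simplex_shapeFn_affine (i := i) (hw := hw)]
    simp [shapeFn_refVert]
  | square =>
    change Fin 4 at i f
    change Fin 4 → ℝ at w
    have hf : square.facetVerts f = ({f, f + 1} : Finset (Fin 4)) := rfl
    have hne : f ≠ f + 1 := by fin_cases f <;> decide
    rw [hf] at hw ⊢
    rw [Finset.sum_pair hne] at hw ⊢
    have hw' : w f = 1 - w (f + 1) := by linarith
    fin_cases f <;> fin_cases i <;> simp [shapeFn, refVert] at hw hw' ⊢ <;> simp [hw']

theorem convex_refElem (s : Shape d) : Convex ℝ s.refElem := convex_convexHull ℝ _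

theorem refVert_mem (s : Shape d) (i : Fin s.nv) : s.refVert i ∈ s.refElem :=
  subset_convexHull ℝ _ ⟨i, rfl⟩

theorem isCompact_refElem (s : Shape d) : IsCompact s.refElem :=
  (Set.finite_range s.refVert).isCompact_convexHull ℝ

theorem mem_refElem_of_nonneg (s : Shape d) {x : Vec d} (hx : ∀ i, 0 ≤ s.shapeFn i x) :
    x ∈ s.refElem := by
  rw [← sum_shapeFn_smul_refVert s x]
  exact s.convex_refElem.sum_mem (fun i _ => hx i) (sum_shapeFn s x) fun i _ => s.refVert_mem i

theorem isOpen_pos (s : Shape d) : IsOpen {x | ∀ i, 0 < s.shapeFn i x} := by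
  simp only [Set.ofPred_forall]
  exact isOpen_iInter_of_finite fun i =>
    isOpen_lt continuous_const (contDiff_shapeFn s i).continuous

theorem mem_interior_refElem (s : Shape d) {x : Vec d} (hx : ∀ i, 0 < s.shapeFn i x) :
    x ∈ interior s.refElem :=
  interior_maximal (fun _ hy => s.mem_refElem_of_nonneg fun i => (hy i).le) s.isOpen_pos hx

theorem exists_shapeFn_pos (s : Shape d) : ∃ x, ∀ i, 0 < s.shapeFn i x := by
  cases s with
  | simplex =>
    refine ⟨∑ j : Fin (d + 1), (1 / (d + 1) : ℝ) • (simplex d).refVert j, fun i => ?_⟩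
    rw [simplex_shapeFn_affine (i := i) (hw := by simp; field_simp)]
    have : ∀ j : Fin (d + 1), (simplex d).shapeFn i ((simplex d).refVert j) =
      if i = j then 1 else 0 := fun j => shapeFn_refVert _ i j
    simp only [this, mul_ite, mul_one, mul_zero]
    erw [Finset.sum_ite_eq]
    simp; positivity
  | square =>
    refine ⟨![1 / 2, 1 / 2], fun (i : Fin 4) => ?_⟩
    fin_cases i <;> simp [shapeFn] <;> norm_num

theorem interior_refElem_nonempty (s : Shape d) : (interior s.refElem).Nonempty :=
  let ⟨x, hx⟩ := s.exists_shapeFn_pos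
  ⟨x, s.mem_interior_refElem hx⟩

theorem volume_real_refElem_pos (s : Shape d) : 0 < volume.real s.refElem := by
  rw [measureReal_def]
  refine ENNReal.toReal_pos ?_ s.isCompact_refElem.measure_lt_top.ne
  exact ((isOpen_interior.measure_pos _ s.interior_refElem_nonempty).trans_le
    (measure_mono interior_subset)).ne'

theorem nv_pos (s : Shape d) : 0 < s.nv := by
  cases s <;> simp [nv]

theorem refElem_subset_closure_interior (s : Shape d) :
    s.refElem ⊆ closure (interior s.refElem) := by
  rw [s.convex_refElem.closure_interior_eq_closure_of_nonempty_interior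
    s.interior_refElem_nonempty]
  exact subset_closure

theorem refVert_injective (s : Shape d) : Function.Injective s.refVert := by
  intro i j h
  have := shapeFn_refVert s i j
  rw [← h, shapeFn_refVert] at this
  by_contra hne
  simp [hne] at this

/-- Along a facet the shape functions are affine in the weights, also on the square. Hence
derivatives in tangential directions can be read off at every point of the facet. -/
theorem fderiv_shapeFn_facet (s : Shape d) (f i j k : Fin s.nv) (w : Fin s.nv → ℝ)
    (hw : ∑ j ∈ s.facetVerts f, w j = 1) (hj : j ∈ s.facetVerts f) (hk : k ∈ s.facetVerts f) :
    fderiv ℝ (s.shapeFn i) (∑ j ∈ s.facetVerts f, w j • s.refVert j)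
      (s.refVert j - s.refVert k) = (if i = j then 1 else 0) - (if i = k then 1 else 0) := by
  set x := ∑ j ∈ s.facetVerts f, w j • s.refVert j with hx
  have h1 : HasDerivAt (fun t : ℝ => s.shapeFn i (x + t • (s.refVert j - s.refVert k)))
      (fderiv ℝ (s.shapeFn i) x (s.refVert j - s.refVert k)) 0 := by
    have hd : HasFDerivAt (s.shapeFn i) (fderiv ℝ (s.shapeFn i) x)
        (x + (0 : ℝ) • (s.refVert j - s.refVert k)) := by
      rw [zero_smul, add_zero]
      exact ((contDiff_shapeFn s i).differentiable one_ne_zero x).hasFDerivAt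
    have hl : HasDerivAt (fun t : ℝ => x + t • (s.refVert j - s.refVert k))
        (s.refVert j - s.refVert k) 0 := by
      simpa using ((hasDerivAt_id (0 : ℝ)).smul_const (s.refVert j - s.refVert k)).const_add x
    exact hd.comp_hasDerivAt 0 hl
  set c : ℝ := (if i = j then 1 else 0) - (if i = k then 1 else 0) with hc
  have h2 : (fun t : ℝ => s.shapeFn i (x + t • (s.refVert j - s.refVert k))) =
      fun t => (if i ∈ s.facetVerts f then w i else 0) + t * c := by
    funext t
    have e : x + t • (s.refVert j - s.refVert k) = ∑ l ∈ s.facetVerts f,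
        (w l + t * ((if l = j then 1 else 0) - (if l = k then 1 else 0))) • s.refVert l := by
      simp only [add_smul, Finset.sum_add_distrib, ← hx, mul_sub, sub_smul,
        Finset.sum_sub_distrib, mul_ite, mul_one, mul_zero, ite_smul, zero_smul,
        Finset.sum_ite_eq', hj, hk, if_true, smul_sub]
    rw [e, shapeFn_facet]
    · by_cases hi : i ∈ s.facetVerts f
      · simp [hi, hc]
      · have h1 : i ≠ j := fun h => hi (h ▸ hj)
        have h2 : i ≠ k := fun h => hi (h ▸ hk)
        simp [hi, hc, h1, h2]
    · simp [Finset.sum_add_distrib, hw, ← Finset.mul_sum, Finset.sum_sub_distrib, hj, hk]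
  rw [h2] at h1
  have h3 : HasDerivAt (fun t : ℝ => (if i ∈ s.facetVerts f then w i else 0) + t * c) c 0 := by
    simpa using ((hasDerivAt_id (0 : ℝ)).mul_const c).const_add
      (if i ∈ s.facetVerts f then w i else 0)
  exact h1.unique h3

end Shape
end Biot

/-! ### Reference `BDM₁` fields attached to a facet and a vertex -/

namespace Biot

namespace Shape

variable {d : ℕ}

theorem opp_notMem (s : Shape d) {f i : Fin s.nv} (hi : i ∈ s.facetVerts f) :
    s.opp f i ∉ s.facetVerts f := by
  cases s with
  | simplex => simp [opp, facetVerts]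
  | square =>
    revert hi
    change Fin 4 at f i
    fin_cases f <;> fin_cases i <;> simp [opp, facetVerts]

theorem simplex_fderiv_shapeFn (i j k : Fin (d + 1)) (x : Vec d) :
    fderiv ℝ ((simplex d).shapeFn i) x ((simplex d).refVert j - (simplex d).refVert k) =
      (if i = j then 1 else 0) - (if i = k then 1 else 0) := by
  have h : ∀ v, fderiv ℝ ((simplex d).shapeFn i) x v =
      (simplex d).shapeFn i v - (simplex d).shapeFn i 0 := by
    intro v
    refine Fin.cases ?_ (fun k => ?_) i
    · have : HasFDerivAt ((simplex d).shapeFn (0 : Fin (d + 1)))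
          (-∑ j, ContinuousLinearMap.proj (R := ℝ) (φ := fun _ : Fin d => ℝ) j) x := by
        have := (HasFDerivAt.sum (u := Finset.univ) fun (j : Fin d) _ =>
          (ContinuousLinearMap.proj (R := ℝ) (φ := fun _ : Fin d => ℝ) j).hasFDerivAt
            (x := x)).const_sub 1
        refine this.congr_of_eventuallyEq (Filter.Eventually.of_forall fun y => ?_)
        simp [simplex_shapeFn_zero]
      rw [this.fderiv, simplex_shapeFn_zero, simplex_shapeFn_zero]
      simp
    · have : HasFDerivAt ((simplex d).shapeFn (k.succ : Fin (d + 1)))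
          (ContinuousLinearMap.proj (R := ℝ) (φ := fun _ : Fin d => ℝ) k) x :=
        (ContinuousLinearMap.proj (R := ℝ) (φ := fun _ : Fin d => ℝ) k).hasFDerivAt
      rw [this.fderiv, simplex_shapeFn_succ, simplex_shapeFn_succ]
      simp
  rw [map_sub, h, h, shapeFn_refVert, shapeFn_refVert]
  ring

theorem square_facetVerts (f : Fin 4) : square.facetVerts f = {f, f + 1} := rfl

/-- Facet point with all the weight on one vertex. -/
theorem refVert_eq_sum (s : Shape d) {f i : Fin s.nv} (hi : i ∈ s.facetVerts f) :
    s.refVert i = ∑ j ∈ s.facetVerts f, (if j = i then (1 : ℝ) else 0) • s.refVert j := by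
  simp [ite_smul, hi]

/-- On the square the two vertices span an edge, so the derivative at `i` is a tangential derivative
along that edge. -/
theorem fderiv_shapeFn_opp (s : Shape d) {f i : Fin s.nv} (hi : i ∈ s.facetVerts f)
    (k : Fin s.nv) :
    fderiv ℝ (s.shapeFn k) (s.refVert i) (s.refVert i - s.refVert (s.opp f i)) =
      (if k = i then 1 else 0) - (if k = s.opp f i then 1 else 0) := by
  cases s with
  | simplex => exact simplex_fderiv_shapeFn _ _ _ _
  | square =>
    obtain ⟨g, hg, hg'⟩ : ∃ g, i ∈ square.facetVerts g ∧ square.opp f i ∈ square.facetVerts g := by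
      revert hi
      change Fin 4 at f i
      simp only [square_facetVerts, opp]
      revert f i; decide
    have := fderiv_shapeFn_facet square g k i (square.opp f i)
      (fun j => if j = i then (1 : ℝ) else 0) (by simp [hg]) hg hg'
    rwa [← refVert_eq_sum _ hg] at this

theorem hat_refVert (s : Shape d) {f i : Fin s.nv} (hi : i ∈ s.facetVerts f) (j : Fin s.nv) :
    s.hat f i (s.refVert j) =
      if i = j then s.refVert i - s.refVert (s.opp f i) else 0 := by
  cases s with
  | simplex => simp [hat, shapeFn_refVert, opp]
  | square =>
    have : bubble f (square.refVert j) = 0 := by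
      change Fin 4 at f i j
      fin_cases f <;> fin_cases j <;> simp [bubble, refVert]
    simp [hat, shapeFn_refVert, this]

theorem bubble_facet {f g : Fin 4} (w : Fin 4 → ℝ) (hw : ∑ j ∈ square.facetVerts g, w j = 1)
    (h1 : g ≠ f) (h2 : g ≠ f + 2) :
    bubble f (∑ j ∈ square.facetVerts g, w j • square.refVert j) = 0 := by
  have hg1 : g ≠ g + 1 := by fin_cases g <;> decide
  rw [square_facetVerts] at hw ⊢
  rw [Finset.sum_pair hg1] at hw ⊢
  have hw' : w g = 1 - w (g + 1) := by linarith
  fin_cases f <;> fin_cases g <;> simp [bubble, refVert] at hw' h1 h2 ⊢ <;> simp [hw']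

/-- On the other facets the field is tangential. The tangent is written as a difference of two
vertices because this is the form that `DF` maps to a tangent of the physical facet. -/
theorem hat_facet_ne (s : Shape d) {f i g : Fin s.nv} (hi : i ∈ s.facetVerts f) (hfg : f ≠ g)
    (w : Fin s.nv → ℝ) (hw : ∑ j ∈ s.facetVerts g, w j = 1) :
    ∃ c : ℝ, ∃ j ∈ s.facetVerts g, ∃ k ∈ s.facetVerts g,
      s.hat f i (∑ j ∈ s.facetVerts g, w j • s.refVert j) =
        c • (s.refVert j - s.refVert k) := by
  have hne : (s.facetVerts g).Nonempty := by
    by_contra h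
    rw [Finset.not_nonempty_iff_eq_empty] at h
    simp [h] at hw
  cases s with
  | simplex =>
    simp only [hat]
    rw [shapeFn_facet _ _ _ _ hw]
    by_cases h : i ∈ (simplex d).facetVerts g
    · exact ⟨_, i, h, f, by simp [facetVerts, hfg], rfl⟩
    · obtain ⟨j, hj⟩ := hne
      exact ⟨0, j, hj, j, hj, by simp [h]⟩
  | square =>
    simp only [hat]
    rw [shapeFn_facet _ _ _ _ hw]
    by_cases h : i ∈ square.facetVerts g
    · have hopp : square.opp f i ∈ square.facetVerts g := by
        revert hi hfg h
        simp only [square_facetVerts, opp]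
        clear * -
        revert f i g; decide
      have hg : g ≠ (f + 2 : Fin 4) := by
        revert hi hfg h
        simp only [square_facetVerts]
        clear * -
        revert f i g; decide
      exact ⟨w i, i, h, _, hopp, by simp [h, bubble_facet w hw hfg.symm hg]⟩
    -- On the edge opposite to `f` only the bubble survives, and its direction is parallel to that
    -- edge.
    · by_cases hg : g = (f + 2 : Fin 4)
      · have : ∃ j ∈ square.facetVerts g, ∃ k ∈ square.facetVerts g,
            square.refVert (along f i) - square.refVert i =
              square.refVert j - square.refVert k := by
          have h' : square.opp f i ∈ square.facetVerts g := by
            subst hg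
            revert hi
            simp only [square_facetVerts, opp]
            clear * -
            revert f i; decide
          have h'' : square.opp f (along f i) ∈ square.facetVerts g := by
            subst hg
            revert hi
            simp only [square_facetVerts, opp, along]
            clear * -
            revert f i; decide
          refine ⟨_, h'', _, h', ?_⟩
          revert hi
          simp only [square_facetVerts]
          clear * -
          change Fin 4 at f i
          fin_cases f <;> fin_cases i <;> simp [opp, along, refVert]
        obtain ⟨j, hj, k, hk, e⟩ := this
        exact ⟨_, j, hj, k, hk, by simp only [h, if_false, zero_smul, zero_add, e]; rfl⟩
      · obtain ⟨j, hj⟩ := hne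
        exact ⟨0, j, hj, j, hj, by simp [h, bubble_facet w hw hfg.symm hg]⟩

theorem hat_facet_self (s : Shape d) {f i : Fin s.nv} (hi : i ∈ s.facetVerts f)
    (w : Fin s.nv → ℝ) (hw : ∑ j ∈ s.facetVerts f, w j = 1) :
    ∃ c : ℝ, ∃ j ∈ s.facetVerts f, ∃ k ∈ s.facetVerts f,
      s.hat f i (∑ j ∈ s.facetVerts f, w j • s.refVert j) =
        w i • (s.refVert i - s.refVert (s.opp f i)) + c • (s.refVert j - s.refVert k) := by
  cases s with
  | simplex =>
    refine ⟨0, i, hi, i, hi, ?_⟩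
    simp only [hat]
    rw [shapeFn_facet _ _ _ _ hw]
    simp [hi, opp]
  | square =>
    have ha : along f i ∈ square.facetVerts f := by
      simp only [square_facetVerts, along]
      clear * -
      revert f i; decide
    refine ⟨bubble f (∑ j ∈ square.facetVerts f, w j • square.refVert j), along f i, ha, i, hi, ?_⟩
    simp only [hat]
    rw [shapeFn_facet _ _ _ _ hw, if_pos hi]

theorem P1_coord (a : Fin d) : (fun x => x a) ∈ P1 d := ⟨0, Pi.single a 1, by simp⟩

theorem P1_simplex_shapeFn (i : Fin (d + 1)) : (simplex d).shapeFn i ∈ P1 d := by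
  refine Fin.cases ?_ (fun k => ?_) i
  · exact ⟨1, -1, by ext x; simp [simplex_shapeFn_zero, dotProduct]; ring⟩
  · exact P1_coord k

/-- Normal form of the elements of the reference space on the square. -/
def squareField (a b c e : ℝ) (g h : Vec 2) (x : Vec 2) : Vec 2 :=
  ![a + (g 0 * x 0 + g 1 * x 1) + c * x 0 ^ 2 + e * (2 * x 0 * x 1),
    b + (h 0 * x 0 + h 1 * x 1) - c * (2 * x 0 * x 1) - e * x 1 ^ 2]

theorem squareField_mem_bdm (a b c e : ℝ) (g h : Vec 2) :
    squareField a b c e g h ∈ square.bdm := by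
  refine Submodule.mem_sup.2 ⟨fun x => ![a + g ⬝ᵥ x, b + h ⬝ᵥ x], ?_,
    c • (fun x => ![x 0 ^ 2, -(2 * x 0 * x 1)]) +
      e • (fun x => ![2 * x 0 * x 1, -(x 1 ^ 2)]), ?_, ?_⟩
  · intro i
    fin_cases i
    · exact ⟨a, g, rfl⟩
    · exact ⟨b, h, rfl⟩
  · refine Submodule.add_mem _ (Submodule.smul_mem _ _ (Submodule.subset_span ?_))
      (Submodule.smul_mem _ _ (Submodule.subset_span ?_)) <;> simp
  · funext x
    ext i
    fin_cases i <;> simp [squareField] <;> ring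

theorem exists_squareField {f : Vec 2 → Vec 2} (hf : f ∈ square.bdm) :
    ∃ a b c e g h, f = squareField a b c e g h := by
  obtain ⟨p, hp, q, hq, rfl⟩ := Submodule.mem_sup.1 hf
  obtain ⟨c, e, rfl⟩ := Submodule.mem_span_pair.1 hq
  obtain ⟨a, g, h0⟩ := hp 0
  obtain ⟨b, h, h1⟩ := hp 1
  refine ⟨a, b, c, e, g, h, ?_⟩
  funext x
  ext i
  have h0 := congrFun h0 x
  have h1 := congrFun h1 x
  fin_cases i <;> simp [squareField, h0, h1, dotProduct, Fin.sum_univ_two] <;> ring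

theorem refDiv_squareField (a b c e : ℝ) (g h x : Vec 2) :
    Differentiable ℝ (squareField a b c e g h) ∧
      Cells.refDiv (squareField a b c e g h) x = g 0 + h 1 := by
  have hd : ∀ x, HasFDerivAt (squareField a b c e g h) (ContinuousLinearMap.pi
      ![(g 0 + 2 * c * x 0 + 2 * e * x 1) • ContinuousLinearMap.proj (R := ℝ) 0 +
          (g 1 + 2 * e * x 0) • ContinuousLinearMap.proj (R := ℝ) 1,
        (h 0 - 2 * c * x 1) • ContinuousLinearMap.proj (R := ℝ) 0 +
          (h 1 - 2 * c * x 0 - 2 * e * x 1) • ContinuousLinearMap.proj (R := ℝ) 1]) x := by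
    intro x
    have p0 := hasFDerivAt_apply (𝕜 := ℝ) (F' := fun _ : Fin 2 => ℝ) 0 x
    have p1 := hasFDerivAt_apply (𝕜 := ℝ) (F' := fun _ : Fin 2 => ℝ) 1 x
    refine hasFDerivAt_pi'' fun i => ?_
    fin_cases i
    · have := ((((p0.const_mul (g 0)).add (p1.const_mul (g 1))).const_add a).add
        ((p0.pow 2).const_mul c)).add (((p0.const_mul 2).mul p1).const_mul e)
      refine (this.congr_of_eventuallyEq (Filter.Eventually.of_forall fun y => ?_)).congr_fderiv ?_
      · simp [squareField]
      · ext v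
        simp
        ring
    · have := ((((p0.const_mul (h 0)).add (p1.const_mul (h 1))).const_add b).sub
        (((p0.const_mul 2).mul p1).const_mul c)).sub ((p1.pow 2).const_mul e)
      refine (this.congr_of_eventuallyEq (Filter.Eventually.of_forall fun y => ?_)).congr_fderiv ?_
      · simp [squareField]
      · ext v
        simp
        ring
  refine ⟨fun x => (hd x).differentiableAt, ?_⟩
  simp only [Cells.refDiv, (hd x).fderiv, Fin.sum_univ_two]
  simp

theorem square_hat_eq {f i : Fin 4} (hi : i ∈ square.facetVerts f) :
    ∃ a b c e g h, square.hat f i = squareField a b c e g h ∧ g 0 + h 1 = 1 / 2 := by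
  set p := square.refVert i 0 with hp
  set q := square.refVert i 1 with hq
  have hpq : ((f = 0 ∨ f = 2) ∨ (f = 1 ∨ f = 3)) := by clear * -; revert f; decide
  rw [square_facetVerts] at hi
  rcases hpq with hf | hf
  -- The coordinates `p, q ∈ {0, 1}` of the vertex `i` allow one formula for all vertices of the two
  -- horizontal edges; the vertical edges are treated by exchanging the coordinates.
  · refine ⟨0, -(1 - 2 * q) * (1 - p) * (1 - q), (1 - 2 * p) / 2, 0, ![-(1 - 2 * p) / 2, 0],
      ![(1 - 2 * q) * (1 - 2 * p) * (1 - q), 1 - p], ?_, by simp; ring⟩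
    funext x
    ext j
    rcases hf with rfl | rfl <;> fin_cases i <;> simp at hi <;> fin_cases j <;>
      simp [squareField, hat, bubble, shapeFn, along, opp, refVert, hp, hq] <;> ring
  · refine ⟨-(1 - 2 * p) * (1 - p) * (1 - q), 0, 0, -(1 - 2 * q) / 2,
      ![1 - q, (1 - 2 * q) * (1 - 2 * p) * (1 - p)], ![0, -(1 - 2 * q) / 2], ?_, by simp; ring⟩
    funext x
    ext j
    rcases hf with rfl | rfl <;> fin_cases i <;> simp at hi <;> fin_cases j <;>
      simp [squareField, hat, bubble, shapeFn, along, opp, refVert, hp, hq] <;> ring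

theorem hat_mem_bdm (s : Shape d) {f i : Fin s.nv} (hi : i ∈ s.facetVerts f) :
    s.hat f i ∈ s.bdm := by
  cases s with
  | simplex =>
    intro a
    have := (P1 d).smul_mem (((simplex d).refVert i - (simplex d).refVert f) a)
      (P1_simplex_shapeFn i)
    convert this using 1
    ext x
    simp [hat, mul_comm]
  | square =>
    obtain ⟨a, b, c, e, g, h, hh, -⟩ := square_hat_eq hi
    rw [hh]
    exact squareField_mem_bdm a b c e g h

theorem refDiv_hat (s : Shape d) {f i : Fin s.nv} (hi : i ∈ s.facetVerts f) (hif : i ≠ s.opp f i)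
    (x : Vec d) : Cells.refDiv (s.hat f i) x = s.hatDiv := by
  cases s with
  | simplex =>
    have hd := ((contDiff_shapeFn (simplex d) i).differentiable one_ne_zero x).hasFDerivAt.smul_const
      ((simplex d).refVert i - (simplex d).refVert f)
    have := simplex_fderiv_shapeFn i i f x
    simp only [Cells.refDiv]
    change ∑ b, fderiv ℝ (fun x => (simplex d).shapeFn i x •
      ((simplex d).refVert i - (simplex d).refVert f)) x _ _ = _
    rw [hd.fderiv]
    have hif' : i ≠ f := hif
    simp only [if_true, hif', if_false, sub_zero] at this
    rw [hatDiv]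
    refine Eq.trans ?_ this
    clear this
    set v := (simplex d).refVert i - (simplex d).refVert f
    conv_rhs => rw [← Finset.univ_sum_single v]
    rw [map_sum]
    refine Finset.sum_congr rfl fun b _ => ?_
    have : (Pi.single b (v b) : Vec d) = v b • Pi.single b 1 := by
      rw [← Pi.single_smul, smul_eq_mul, mul_one]
    rw [this, map_smul]
    simp [mul_comm]
  | square =>
    obtain ⟨a, b, c, e, g, h, hh, h2⟩ := square_hat_eq hi
    rw [hh, (refDiv_squareField a b c e g h x).2, h2, hatDiv]

/-- The quadratic fields on the square are curls, so only the linear part contributes to the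
divergence. This turns all divergence integrals into finite sums. -/
theorem bdm_differentiable (s : Shape d) {f : Vec d → Vec d} (hf : f ∈ s.bdm) :
    Differentiable ℝ f ∧ ∃ c, ∀ x, Cells.refDiv f x = c := by
  cases s with
  | simplex =>
    choose c g h using hf
    have hd : ∀ x, HasFDerivAt f (ContinuousLinearMap.pi fun a =>
        ∑ b, g a b • ContinuousLinearMap.proj (R := ℝ) (φ := fun _ : Fin d => ℝ) b) x := by
      intro x
      refine hasFDerivAt_pi'' fun a => ?_
      rw [h a]
      have := (HasFDerivAt.sum (u := Finset.univ) fun (j : Fin d) _ =>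
        (hasFDerivAt_apply (𝕜 := ℝ) (F' := fun _ : Fin d => ℝ) j x).const_mul (g a j)).const_add
          (c a)
      refine (this.congr_of_eventuallyEq
        (Filter.Eventually.of_forall fun y => ?_)).congr_fderiv ?_
      · simp [dotProduct]
      · ext v; simp
    refine ⟨fun x => (hd x).differentiableAt, ∑ b, g b b, fun x => ?_⟩
    simp only [Cells.refDiv, (hd x).fderiv]
    simp [Pi.single_apply]
  | square =>
    obtain ⟨a, b, c, e, g, h, rfl⟩ := exists_squareField hf
    exact ⟨(refDiv_squareField a b c e g h 0).1, _, fun x => (refDiv_squareField a b c e g h x).2⟩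

theorem P1_eq_zero {f : Vec d → ℝ} (hf : f ∈ P1 d)
    (h : ∀ i, f ((simplex d).refVert i) = 0) : f = 0 := by
  obtain ⟨c, g, rfl⟩ := hf
  have hc : c = 0 := by simpa [simplex_refVert_zero] using h (0 : Fin (d + 1))
  have hg : g = 0 := by
    ext j
    simpa [simplex_refVert_succ, hc] using h (j.succ : Fin (d + 1))
  ext x
  simp [hc, hg]

/-- Unisolvence of the vertex values, the reason why vertex quadrature is definite on `BDM₁`. On the
square eight coefficients face eight scalar values. -/
theorem bdm_eq_zero (s : Shape d) {f : Vec d → Vec d} (hf : f ∈ s.bdm)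
    (h : ∀ i, f (s.refVert i) = 0) : f = 0 := by
  cases s with
  | simplex =>
    funext x
    ext a
    exact congrFun (P1_eq_zero (hf a) fun i => by simp [h i]) x
  | square =>
    obtain ⟨a, b, c, e, g, k, rfl⟩ := exists_squareField hf
    have e0 := h (0 : Fin 4)
    have e1 := h (1 : Fin 4)
    have e2 := h (2 : Fin 4)
    have e3 := h (3 : Fin 4)
    simp [squareField, refVert] at e0 e1 e2 e3
    obtain ⟨a0, b0⟩ := e0
    subst a0 b0
    have z1 : g 1 = 0 := by simpa using e3.1
    have z2 : k 0 = 0 := by simpa using e1.2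
    have z3 : e = 0 := by linarith [e1.1, e2.1]
    have z4 : c = 0 := by linarith [e3.2, e2.2]
    have z5 : g 0 = 0 := by linarith [e1.1]
    have z6 : k 1 = 0 := by linarith [e3.2]
    funext x
    ext i
    fin_cases i <;> simp [squareField, *]

theorem nodal_eq_zero (s : Shape d) {f : Vec d → ℝ} (hf : f ∈ s.nodal)
    (h : ∀ i, f (s.refVert i) = 0) : f = 0 := by
  cases s with
  | simplex => exact P1_eq_zero hf h
  | square =>
    obtain ⟨a, b, c, e, rfl⟩ := hf
    have e0 := h (0 : Fin 4)
    have e1 := h (1 : Fin 4)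
    have e2 := h (2 : Fin 4)
    have e3 := h (3 : Fin 4)
    simp [refVert] at e0 e1 e2 e3
    subst e0
    have hb : b = 0 := by simpa using e1
    have hc : c = 0 := by simpa using e3
    have he : e = 0 := by linarith
    ext x
    simp [hb, hc, he]

end Shape
end Biot

/-! ### Element maps and Jacobians -/

namespace Biot

namespace Cells

variable {d : ℕ} {s : Shape d} {nE nV : ℕ} (M : Cells s nE nV)

/-- The `i`-th vertex of element `E`. -/
abbrev P (E : Fin nE) (i : Fin s.nv) : Vec d := M.pt (M.cell E i)

theorem F_refVert (E : Fin nE) (i : Fin s.nv) : M.F E (s.refVert i) = M.P E i := by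
  simp [F, Shape.shapeFn_refVert]

theorem contDiff_F (E : Fin nE) : ContDiff ℝ 1 (M.F E) :=
  ContDiff.sum fun i _ => (Shape.contDiff_shapeFn s i).smul contDiff_const

theorem fderiv_F (E : Fin nE) (x v : Vec d) :
    fderiv ℝ (M.F E) x v = ∑ i, fderiv ℝ (s.shapeFn i) x v • M.P E i := by
  have : HasFDerivAt (M.F E) (∑ i, (fderiv ℝ (s.shapeFn i) x).smulRight (M.P E i)) x :=
    HasFDerivAt.fun_sum fun i _ =>
      ((Shape.contDiff_shapeFn s i).differentiable one_ne_zero x).hasFDerivAt.smul_const _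
  rw [this.fderiv]
  simp

theorem DF_mulVec (E : Fin nE) (x v : Vec d) : M.DF E x *ᵥ v = fderiv ℝ (M.F E) x v := by
  conv_rhs => rw [← Finset.univ_sum_single v]
  rw [map_sum]
  ext a
  simp only [Matrix.mulVec, dotProduct, DF, Matrix.of_apply, Finset.sum_apply]
  refine Finset.sum_congr rfl fun b _ => ?_
  have : (Pi.single b (v b) : Vec d) = v b • Pi.single b 1 := by
    rw [← Pi.single_smul, smul_eq_mul, mul_one]
  rw [this, map_smul]
  simp [mul_comm]

/-- The element map is affine along every facet, even where it is bilinear inside, so `DF` takes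
reference edge vectors to physical ones at all points of the facet. -/
theorem DF_facet (E : Fin nE) {f j k : Fin s.nv} (w : Fin s.nv → ℝ)
    (hw : ∑ j ∈ s.facetVerts f, w j = 1) (hj : j ∈ s.facetVerts f) (hk : k ∈ s.facetVerts f) :
    M.DF E (∑ j ∈ s.facetVerts f, w j • s.refVert j) *ᵥ (s.refVert j - s.refVert k) =
      M.P E j - M.P E k := by
  simp only [DF_mulVec, fderiv_F, Shape.fderiv_shapeFn_facet s f _ j k w hw hj hk, sub_smul,
    Finset.sum_sub_distrib, ite_smul, one_smul, zero_smul, Finset.sum_ite_eq', Finset.mem_univ,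
    if_true]

theorem DF_opp (E : Fin nE) {f i : Fin s.nv} (hi : i ∈ s.facetVerts f) :
    M.DF E (s.refVert i) *ᵥ (s.refVert i - s.refVert (s.opp f i)) =
      M.P E i - M.P E (s.opp f i) := by
  simp only [DF_mulVec, fderiv_F, Shape.fderiv_shapeFn_opp s hi, sub_smul,
    Finset.sum_sub_distrib, ite_smul, one_smul, zero_smul, Finset.sum_ite_eq', Finset.mem_univ,
    if_true]

theorem continuous_DF (E : Fin nE) : Continuous (M.DF E) := by
  have h := (M.contDiff_F E).continuous_fderiv one_ne_zero
  refine continuous_matrix fun a b => ?_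
  exact (continuous_apply a).comp (h.clm_apply continuous_const)

theorem simplex_F_sum {M : Cells (Shape.simplex d) nE nV} (E : Fin nE) {ι : Type*} (t : Finset ι)
    (w : ι → ℝ) (p : ι → Vec d) (hw : ∑ j ∈ t, w j = 1) :
    M.F E (∑ j ∈ t, w j • p j) = ∑ j ∈ t, w j • M.F E (p j) := by
  simp only [F, Finset.smul_sum]
  rw [Finset.sum_comm]
  refine Finset.sum_congr rfl fun i _ => ?_
  rw [Shape.simplex_shapeFn_affine (i := i) (hw := hw), Finset.sum_smul]
  simp [mul_smul]

theorem simplex_DF_sub {M : Cells (Shape.simplex d) nE nV} (E : Fin nE) (x : Vec d)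
    (j k : Fin (d + 1)) :
    M.DF E x *ᵥ ((Shape.simplex d).refVert j - (Shape.simplex d).refVert k) =
      M.P E j - M.P E k := by
  simp only [DF_mulVec, fderiv_F]
  have : ∀ i : Fin (d + 1), _ := fun i => Shape.simplex_fderiv_shapeFn i j k x
  simp only [this, sub_smul,
    Finset.sum_sub_distrib, ite_smul, one_smul, zero_smul, Finset.sum_ite_eq', Finset.mem_univ,
    if_true]

theorem simplex_DF_apply {M : Cells (Shape.simplex d) nE nV} (E : Fin nE) (x : Vec d) (a : Fin d)
    (j : Fin d) :
    M.DF E x a j = M.P E (j.succ : Fin (d + 1)) a - M.P E (0 : Fin (d + 1)) a := by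
  have := congrFun (simplex_DF_sub (M := M) E x j.succ 0) a
  rw [Shape.simplex_refVert_zero, Shape.simplex_refVert_succ, sub_zero] at this
  simpa using this

/-- The matrix with rows `(1, P i)`. -/
def bordered (P : Fin (d + 1) → Vec d) : Matrix (Fin (d + 1)) (Fin (d + 1)) ℝ :=
  Matrix.of fun i => Fin.cons 1 (P i)

theorem bordered_zero (P : Fin (d + 1) → Vec d) (i : Fin (d + 1)) : bordered P i 0 = 1 := rfl

theorem bordered_succ (P : Fin (d + 1) → Vec d) (i : Fin (d + 1)) (j : Fin d) :
    bordered P i j.succ = P i j := rfl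

/-- Subtract the first row and expand along the first column. Unlike `DF`, the bordered matrix does
not single out a vertex, which permits comparing neighbours whose vertices are numbered differently.
-/
theorem simplex_J_eq {M : Cells (Shape.simplex d) nE nV} (E : Fin nE) (x : Vec d) :
    M.J E x = |(bordered (M.P E)).det| := by
  set N : Matrix (Fin (d + 1)) (Fin (d + 1)) ℝ := Matrix.of fun i =>
    Fin.cases (motive := fun _ => Fin (d + 1) → ℝ) (Fin.cons 1 (M.P E (0 : Fin (d + 1))))
      (fun j : Fin d => Fin.cons 0 (M.P E (j.succ : Fin (d + 1)) - M.P E (0 : Fin (d + 1)))) i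
    with hN
  have h1 : (bordered (M.P E)).det = N.det := by
    refine Matrix.det_eq_of_forall_row_eq_smul_add_const
      (fun i => if i = 0 then 0 else 1) 0 (by simp) fun i j => ?_
    refine Fin.cases ?_ (fun i => ?_) i <;> refine Fin.cases ?_ (fun j => ?_) j <;>
      simp [bordered, hN]
  have h2 : N.det = (M.DF E x).det := by
    rw [Matrix.det_succ_column_zero, Fin.sum_univ_succ]
    simp only [hN, Matrix.of_apply, Fin.cases_zero, Fin.cases_succ, Fin.cons_zero]
    simp only [mul_zero, zero_mul, Finset.sum_const_zero, add_zero, mul_one, Fin.val_zero,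
      pow_zero, one_mul]
    rw [← Matrix.det_transpose]
    congr 1
    ext a j
    simp [Matrix.submatrix, simplex_DF_apply]
  rw [J, h1, h2]

end Cells

/-! ### Interiors, vertices and facets of mesh elements -/

namespace Mesh

variable {d : ℕ} {s : Shape d} {Ω : Set (Vec d)} {nE nV : ℕ} (M : Mesh s Ω nE nV)

theorem J_pos (E : Fin nE) {x : Vec d} (hx : x ∈ s.refElem) : 0 < M.J E x :=
  abs_pos.2 (M.det_ne_zero E x hx)

/-- The derivative is surjective, so the element map is open at `x`. -/
theorem F_mem_interior (E : Fin nE) {x : Vec d} (hx : x ∈ interior s.refElem) :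
    M.F E x ∈ interior (M.cellSet E) := by
  have hd : HasStrictFDerivAt (M.F E) (fderiv ℝ (M.F E) x) x :=
    (M.contDiff_F E).contDiffAt.hasStrictFDerivAt one_ne_zero
  have hr : (fderiv ℝ (M.F E) x).range = ⊤ := by
    rw [LinearMap.range_eq_top]
    intro y
    have hu : IsUnit (M.DF E x).det := (M.det_ne_zero E x (interior_subset hx)).isUnit
    refine ⟨(M.DF E x)⁻¹ *ᵥ y, ?_⟩
    change fderiv ℝ (M.F E) x _ = y
    rw [← M.DF_mulVec, Matrix.mulVec_mulVec, Matrix.mul_nonsing_inv _ hu, Matrix.one_mulVec]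
  rw [mem_interior_iff_mem_nhds, ← hd.map_nhds_eq_of_surj hr]
  exact Filter.image_mem_map (mem_interior_iff_mem_nhds.1 hx)

theorem cellSet_subset (E : Fin nE) : M.cellSet E ⊆ closure (interior (M.cellSet E)) := by
  rintro _ ⟨x, hx, rfl⟩
  have h1 := s.refElem_subset_closure_interior hx
  have h2 := image_closure_subset_closure_image (M.contDiff_F E).continuous
    (Set.mem_image_of_mem (M.F E) h1)
  refine closure_mono ?_ h2
  rintro _ ⟨y, hy, rfl⟩
  exact M.F_mem_interior E hy

theorem isCompact_cellSet (E : Fin nE) : IsCompact (M.cellSet E) :=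
  s.isCompact_refElem.image (M.contDiff_F E).continuous

/-- `E'` lies in the closure of its interior, so an interior point of `E` in `E'` would make the
interiors meet. -/
theorem notMem_interior {E E' : Fin nE} (h : E ≠ E') {x : Vec d}
    (hx : x ∈ interior (M.cellSet E)) : x ∉ M.cellSet E' := by
  intro hx'
  obtain ⟨y, hy, hy'⟩ := mem_closure_iff.1 (M.cellSet_subset E' hx') _ isOpen_interior hx
  exact Set.disjoint_left.1 (M.interior_disjoint E E' h) hy hy'

theorem interior_cellSet_nonempty (E : Fin nE) : (interior (M.cellSet E)).Nonempty :=
  let ⟨_, hx⟩ := s.interior_refElem_nonempty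
  ⟨_, M.F_mem_interior E hx⟩

theorem P_mem (E : Fin nE) (i : Fin s.nv) : M.P E i ∈ M.cellSet E :=
  ⟨_, s.refVert_mem i, M.F_refVert E i⟩

theorem P_injective (E : Fin nE) : Function.Injective (M.P E) := by
  intro i j h
  apply s.refVert_injective
  apply M.F_injOn E (s.refVert_mem i) (s.refVert_mem j)
  rw [M.F_refVert, M.F_refVert, h]

theorem cell_injective (E : Fin nE) : Function.Injective (M.cell E) :=
  fun i j h => M.P_injective E (by simp only [Cells.P, h])

theorem exists_vertex_of_facet_eq {E E' : Fin nE} {f f' i : Fin s.nv}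
    (h : M.facet E f = M.facet E' f') (hi : i ∈ s.facetVerts f) :
    ∃ i' ∈ s.facetVerts f', M.cell E' i' = M.cell E i := by
  have : M.cell E i ∈ M.facet E f := Finset.mem_image_of_mem _ hi
  rw [h] at this
  simpa [Cells.facet] using this

theorem mem_facetVerts_of_mem_facet {E : Fin nE} {f i : Fin s.nv}
    (h : M.cell E i ∈ M.facet E f) : i ∈ s.facetVerts f := by
  obtain ⟨j, hj, e⟩ := Finset.mem_image.1 h
  rwa [← M.cell_injective E e]

theorem facet_injective (E : Fin nE) : Function.Injective (M.facet E) := by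
  intro f g h
  have h' : s.facetVerts f = s.facetVerts g :=
    Finset.image_injective (M.cell_injective E) h
  cases s with
  | simplex =>
    by_contra hne
    have : f ∈ (Shape.simplex d).facetVerts g := by simp [Shape.facetVerts, hne]
    rw [← h'] at this
    simp [Shape.facetVerts] at this
  | square =>
    revert h'
    simp only [Shape.square_facetVerts]
    clear * -
    revert f g; decide

section Simplex

variable {M : Mesh (Shape.simplex d) Ω nE nV}

theorem simplex_sum_mem_interior (E : Fin nE) (w : Fin (d + 1) → ℝ) (hw : ∀ i, 0 < w i)
    (h1 : ∑ i, w i = 1) : ∑ i, w i • M.P E i ∈ interior (M.cellSet E) := by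
  have h2 := Cells.simplex_F_sum (M := M.toCells) E Finset.univ w (Shape.simplex d).refVert h1
  simp only [M.F_refVert] at h2
  rw [← h2]
  apply M.F_mem_interior
  apply Shape.mem_interior_refElem
  intro (i : Fin (d + 1))
  rw [Shape.simplex_shapeFn_affine (i := i) (hw := h1)]
  have : ∀ j : Fin (d + 1), _ := fun j => Shape.shapeFn_refVert (Shape.simplex d) i j
  simp only [this]
  simpa using hw i

/-- Barycentric coordinates. -/
theorem simplex_exists_weights (E : Fin nE) (y : Vec d) :
    ∃ c : Fin (d + 1) → ℝ, ∑ i, c i = 1 ∧ ∑ i, c i • M.P E i = y := by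
  have hu : IsUnit (M.DF E 0).det := by
    refine (M.det_ne_zero E 0 ?_).isUnit
    rw [← Shape.simplex_refVert_zero]
    exact Shape.refVert_mem _ _
  set v := (M.DF E 0)⁻¹ *ᵥ (y - M.P E (0 : Fin (d + 1)))
  have hv : M.DF E 0 *ᵥ v = y - M.P E (0 : Fin (d + 1)) := by
    rw [Matrix.mulVec_mulVec, Matrix.mul_nonsing_inv _ hu, Matrix.one_mulVec]
  have h0 := Shape.sum_shapeFn (Shape.simplex d) v
  refine ⟨fun i => (Shape.simplex d).shapeFn i v, h0, ?_⟩
  change ∑ i : Fin (d + 1), _ = _ at h0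
  change ∑ i : Fin (d + 1), (Shape.simplex d).shapeFn i v • M.P E i = _
  rw [Fin.sum_univ_succ] at h0 ⊢
  have h0' : (Shape.simplex d).shapeFn (0 : Fin (d + 1)) v =
    1 - ∑ j : Fin d, (Shape.simplex d).shapeFn (j.succ : Fin (d + 1)) v := by linarith
  rw [h0']
  simp only [Shape.simplex_shapeFn_succ]
  have : y = M.P E (0 : Fin (d + 1)) + M.DF E 0 *ᵥ v := by rw [hv]; abel
  rw [this]
  ext a
  simp only [Matrix.mulVec, dotProduct, Cells.simplex_DF_apply, Pi.add_apply, Pi.smul_apply,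
    Finset.sum_apply, smul_eq_mul, sub_mul, Finset.sum_sub_distrib, mul_comm]
  simp only [mul_one, mul_sub, Finset.mul_sum]
  ring

/-- Up to a permutation of rows, the bordered matrix of `E'` is that of `E` with row `f` replaced by
the combination of all rows with coefficients `c`. This multiplies the determinant by `c f`. -/
theorem simplex_J_neighbour {E E' : Fin nE} {f f' : Fin (d + 1)}
    (h : M.facet E f = M.facet E' f') (c : Fin (d + 1) → ℝ) (hc : ∑ i, c i = 1)
    (hc' : ∑ i, c i • M.P E i = M.P E' f') (x x' : Vec d) :
    M.J E' x' = |c f| * M.J E x := by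
  choose e he he' using fun i : {i : Fin (d + 1) // i ∈ (Shape.simplex d).facetVerts f} =>
    M.exists_vertex_of_facet_eq h i.2
  have hmem : ∀ i, i ≠ f → i ∈ (Shape.simplex d).facetVerts f := fun i hi => by
    simp [Shape.facetVerts, hi]
  have hmem' : ∀ i, i ∈ (Shape.simplex d).facetVerts f' → i ≠ f' := fun i hi => by
    simpa [Shape.facetVerts] using hi
  let σ : Fin (d + 1) → Fin (d + 1) := fun i => if hi : i = f then f' else e ⟨i, hmem i hi⟩
  have hσf : σ f = f' := by simp [σ]
  have hσ : ∀ i (hi : i ≠ f), σ i = e ⟨i, hmem i hi⟩ := fun i hi => by simp [σ, hi]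
  have hinj : Function.Injective σ := by
    intro i j hij
    by_cases hi : i = f <;> by_cases hj : j = f
    · rw [hi, hj]
    · rw [hi, hσf, hσ j hj] at hij
      exact absurd hij.symm (hmem' _ (he _))
    · rw [hj, hσf, hσ i hi] at hij
      exact absurd hij (hmem' _ (he _))
    · rw [hσ i hi, hσ j hj] at hij
      have := congrArg (M.cell E') hij
      rw [he', he'] at this
      exact M.cell_injective E this
  let τ : Equiv.Perm (Fin (d + 1)) := Equiv.ofBijective σ (Finite.injective_iff_bijective.1 hinj)
  have hrow : (Cells.bordered (M.P E')).submatrix τ id =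
      (Cells.bordered (M.P E)).updateRow f (∑ k, c k • Cells.bordered (M.P E) k) := by
    ext i j
    change Cells.bordered (M.P E') (σ i) j = _
    by_cases hi : i = f
    · subst hi
      rw [hσf, Matrix.updateRow_self, Finset.sum_apply]
      refine Fin.cases ?_ (fun j => ?_) j
      · simpa [Cells.bordered_zero] using hc.symm
      · simpa [Cells.bordered_succ] using (congrFun hc' j).symm
    · rw [Matrix.updateRow_ne hi, hσ i hi]
      have : M.P E' (e ⟨i, hmem i hi⟩) = M.P E i := by simp only [Cells.P, he']
      simp [Cells.bordered, this]
  have hdet := congrArg Matrix.det hrow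
  rw [Matrix.det_permute, Matrix.det_updateRow_sum] at hdet
  have habs := congrArg abs hdet
  rw [abs_mul, smul_eq_mul, abs_mul] at habs
  have hs : |((Equiv.Perm.sign τ : ℤ) : ℝ)| = 1 := by
    rcases Int.units_eq_one_or (Equiv.Perm.sign τ) with h | h <;> simp [h]
  rw [hs, one_mul] at habs
  rw [Cells.simplex_J_eq, Cells.simplex_J_eq, habs]

end Simplex

end Mesh
end Biot

/-! ### Corners of quadrilaterals -/

namespace Biot

/-- The cross product of two plane vectors. -/
def cross (v w : Vec 2) : ℝ := v 0 * w 1 - v 1 * w 0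

theorem cross_mulVec (A : Mat 2) (v w : Vec 2) :
    cross (A *ᵥ v) (A *ᵥ w) = A.det * cross v w := by
  simp [cross, Matrix.mulVec, dotProduct, Fin.sum_univ_two, Matrix.det_fin_two]
  ring

theorem exists_dotProduct_eq_cross {n T : Vec 2} (hT : T ≠ 0) (h : n ⬝ᵥ T = 0) :
    ∃ c, ∀ y, n ⬝ᵥ y = c * cross T y := by
  have h2 : T 0 ^ 2 + T 1 ^ 2 ≠ 0 := by
    intro h0
    apply hT
    ext j
    fin_cases j <;> simp <;> nlinarith [sq_nonneg (T 0), sq_nonneg (T 1)]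
  refine ⟨(n 1 * T 0 - n 0 * T 1) / (T 0 ^ 2 + T 1 ^ 2), fun y => ?_⟩
  simp only [dotProduct, Fin.sum_univ_two, cross] at h ⊢
  field_simp
  linear_combination (T 0 * y 0 + T 1 * y 1) * h

theorem exists_eq_add_of_cross_ne_zero {T y : Vec 2} (h : cross T y ≠ 0) (z : Vec 2) :
    z = (cross z y / cross T y) • T + (cross T z / cross T y) • y := by
  ext j
  simp only [Pi.add_apply, Pi.smul_apply, smul_eq_mul]
  field_simp
  fin_cases j <;> simp [cross] <;> ring

namespace Mesh

section Square

variable {Ω : Set (Vec 2)} {nE nV : ℕ} (M : Mesh Shape.square Ω nE nV)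

/-- The bilinear map in coordinates along the two edges at a vertex; the coefficient of `a b`
measures the deviation from a parallelogram. -/
theorem square_F_corner (E : Fin nE) {f i : Fin 4} (hi : i ∈ Shape.square.facetVerts f)
    (a b : ℝ) :
    M.F E (Shape.square.refVert i +
        (a • (Shape.square.refVert (Shape.along f i) - Shape.square.refVert i) +
         b • (Shape.square.refVert (Shape.square.opp f i) - Shape.square.refVert i))) =
      M.P E i + (a • (M.P E (Shape.along f i) - M.P E i) +
        b • (M.P E (Shape.square.opp f i) - M.P E i) + (a * b) • (M.P E i + M.P E (i + 2 : Fin 4) -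
          M.P E (Shape.along f i) - M.P E (Shape.square.opp f i))) := by
  revert hi
  simp only [Shape.square_facetVerts]
  fin_cases f <;> fin_cases i <;>
    simp [Cells.F, Fin.sum_univ_four, Shape.shapeFn, Shape.refVert, Shape.along, Shape.opp] <;>
    module

theorem square_corner_mem {f i : Fin 4} (hi : i ∈ Shape.square.facetVerts f)
    {a b : ℝ} (ha : 0 < a) (ha' : a < 1) (hb : 0 < b) (hb' : b < 1) :
    Shape.square.refVert i +
        (a • (Shape.square.refVert (Shape.along f i) - Shape.square.refVert i) +
         b • (Shape.square.refVert (Shape.square.opp f i) - Shape.square.refVert i)) ∈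
      interior Shape.square.refElem := by
  apply Shape.mem_interior_refElem
  intro (j : Fin 4)
  have ha1 : 0 < 1 - a := by linarith
  have hb1 : 0 < 1 - b := by linarith
  revert hi
  simp only [Shape.square_facetVerts]
  fin_cases f <;> fin_cases i <;> fin_cases j <;>
    simp [Shape.shapeFn, Shape.refVert, Shape.along, Shape.opp] <;> ring_nf <;> 
    nlinarith [mul_pos ha hb, mul_pos ha hb1, mul_pos ha1 hb, mul_pos ha1 hb1]

/-- A continuous function without zeros keeps its sign on the connected reference square. -/
theorem det_mul_det_pos (E : Fin nE) {x y : Vec 2} (hx : x ∈ Shape.square.refElem)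
    (hy : y ∈ Shape.square.refElem) : 0 < (M.DF E x).det * (M.DF E y).det := by
  have hc : ContinuousOn (fun x => (M.DF E x).det) Shape.square.refElem :=
    (M.continuous_DF E).matrix_det.continuousOn
  have hp := (Shape.convex_refElem Shape.square).isPreconnected
  by_contra hneg
  have hx0 := M.det_ne_zero E x hx
  have hy0 := M.det_ne_zero E y hy
  have hneg' : (M.DF E x).det * (M.DF E y).det < 0 :=
    lt_of_le_of_ne (not_lt.1 hneg) (mul_ne_zero hx0 hy0)
  rcases mul_neg_iff.1 hneg' with ⟨h1, h2⟩ | ⟨h1, h2⟩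
  · obtain ⟨z, hz, hz0⟩ := hp.intermediate_value hy hx hc ⟨h2.le, h1.le⟩
    exact M.det_ne_zero E z hz hz0
  · obtain ⟨z, hz, hz0⟩ := hp.intermediate_value hx hy hc ⟨h1.le, h2.le⟩
    exact M.det_ne_zero E z hz hz0

theorem along_mem (f i : Fin 4) :
    Shape.along f i ∈ Shape.square.facetVerts f := by
  simp only [Shape.square_facetVerts, Shape.along]
  revert f i; decide

/-- Orientation of the corner formed by an edge and the inward direction. -/
theorem cross_refVert {f i : Fin 4} (hi : i ∈ Shape.square.facetVerts f) :
    cross (Shape.square.refVert (Shape.along f i) - Shape.square.refVert i)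
      (Shape.square.refVert (Shape.square.opp f i) - Shape.square.refVert i) =
      if i = f then 1 else -1 := by
  revert hi
  simp only [Shape.square_facetVerts]
  fin_cases f <;> fin_cases i <;> simp [cross, Shape.refVert, Shape.along, Shape.opp]

theorem cross_corner (E : Fin nE) {f i : Fin 4} (hi : i ∈ Shape.square.facetVerts f) :
    cross (M.P E (Shape.along f i) - M.P E i) (M.P E (Shape.square.opp f i) - M.P E i) =
      (M.DF E (Shape.square.refVert i)).det * (if i = f then 1 else -1) := by
  rw [← cross_refVert hi, ← cross_mulVec]
  have h1 := M.DF_facet E (f := f) (j := Shape.along f i) (k := i)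
    (fun j => if j = i then (1 : ℝ) else 0) (by simp [hi]) (along_mem f i) hi
  rw [← Shape.refVert_eq_sum _ hi] at h1
  have h2 := M.DF_opp E hi
  rw [h1, ← neg_sub (Shape.square.refVert i), Matrix.mulVec_neg, h2, neg_sub]

theorem cross_corner_ne_zero (E : Fin nE) {f i : Fin 4} (hi : i ∈ Shape.square.facetVerts f) :
    cross (M.P E (Shape.along f i) - M.P E i) (M.P E (Shape.square.opp f i) - M.P E i) ≠ 0 := by
  rw [M.cross_corner E hi]
  refine mul_ne_zero (M.det_ne_zero E _ (Shape.refVert_mem _ _)) ?_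
  split_ifs <;> norm_num

theorem square_J (E : Fin nE) {f i : Fin 4} (hi : i ∈ Shape.square.facetVerts f) :
    M.J E (Shape.square.refVert i) =
      |cross (M.P E (Shape.along f i) - M.P E i) (M.P E (Shape.square.opp f i) - M.P E i)| := by
  rw [M.cross_corner E hi, abs_mul, Cells.J]
  split_ifs <;> simp

/-- An element contains the points near a vertex in the directions of its corner. -/
theorem square_corner_eventually (E : Fin nE) {f i : Fin 4} (hi : i ∈ Shape.square.facetVerts f)
    {α β : ℝ} (hα : 0 < α) (hβ : 0 < β) :
    ∀ᶠ ε : ℝ in nhdsWithin 0 (Set.Ioi 0), M.P E i + ε • (α • (M.P E (Shape.along f i) - M.P E i) +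
      β • (M.P E (Shape.square.opp f i) - M.P E i)) ∈ interior (M.cellSet E) := by
  set T := M.P E (Shape.along f i) - M.P E i with hT
  set y := M.P E (Shape.square.opp f i) - M.P E i with hy
  have hF := fun a b => M.square_F_corner E hi a b
  simp only [← hT, ← hy] at hF
  set g := M.P E i + M.P E (i + 2 : Fin 4) - M.P E (Shape.along f i) -
    M.P E (Shape.square.opp f i)
  -- In the basis `T, y` the point has reference coordinates `(s, t)` if `s + p s t = ε α` and `t +
  -- q s t = ε β`. The choice of `δ` below keeps `1 + q s ≥ 1/2` on `[0, δ]`, so that the second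
  -- equation gives `t` as a function of `s`.
  obtain ⟨p, q, hg⟩ : ∃ p q : ℝ, g = p • T + q • y :=
    ⟨_, _, exists_eq_add_of_cross_ne_zero (M.cross_corner_ne_zero E hi) g⟩
  set δ : ℝ := 1 / (2 * (1 + |q|)) with hδ
  have hq0 := abs_nonneg q
  have hp0 := abs_nonneg p
  have hδ0 : 0 < δ := by positivity
  have hδ1 : δ ≤ 1 / 2 := by
    rw [hδ, div_le_div_iff₀ (by positivity) (by norm_num)]; linarith
  have hqδ : |q| * δ ≤ 1 / 2 := by
    rw [hδ, mul_one_div, div_le_div_iff₀ (by positivity) (by norm_num)]; linarith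
  have hden : ∀ s ∈ Set.Icc 0 δ, 1 / 2 ≤ 1 + q * s := by
    intro s hs
    have h1 : |q * s| ≤ 1 / 2 := by
      rw [abs_mul, abs_of_nonneg hs.1]
      exact (mul_le_mul_of_nonneg_left hs.2 hq0).trans hqδ
    linarith [neg_abs_le (q * s)]
  have e1 : ∀ᶠ ε : ℝ in nhdsWithin 0 (Set.Ioi 0), 2 * ε * β < 1 ∧
      0 < δ * (1 - |p| * (2 * ε * β)) - ε * α := by
    refine Filter.Eventually.filter_mono nhdsWithin_le_nhds ?_
    refine Filter.Eventually.and ?_ ?_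
    · refine ContinuousAt.eventually_lt (by fun_prop) continuousAt_const (by simp)
    · refine ContinuousAt.eventually_lt continuousAt_const (by fun_prop) (by simpa using hδ0)
  filter_upwards [e1, self_mem_nhdsWithin] with ε hε hε0
  obtain ⟨hε1, hε2⟩ := hε
  have hε0 : 0 < ε := hε0
  set t : ℝ → ℝ := fun s => ε * β / (1 + q * s) with ht
  have ht0 : ∀ s ∈ Set.Icc 0 δ, 0 < t s ∧ t s ≤ 2 * ε * β := by
    intro s hs
    have := hden s hs
    refine ⟨div_pos (by positivity) (by linarith), ?_⟩
    rw [ht]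
    simp only
    rw [div_le_iff₀ (by linarith)]
    nlinarith [mul_pos hε0 hβ]
  have hc : ContinuousOn (fun s => s * (1 + p * t s) - ε * α) (Set.Icc 0 δ) := by
    have : ContinuousOn t (Set.Icc 0 δ) :=
      ContinuousOn.div (by fun_prop) (by fun_prop) fun s hs => by
        have := hden s hs; linarith
    fun_prop
  -- The first equation is negative at `s = 0` and, for small `ε`, positive at `s = δ`.
  obtain ⟨s, hs, hs0⟩ := intermediate_value_Icc hδ0.le hc (show (0 : ℝ) ∈ _ from by
    refine ⟨by simp; positivity, ?_⟩
    have h1 := ht0 δ ⟨hδ0.le, le_rfl⟩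
    have h2 : -(|p| * (2 * ε * β)) ≤ p * t δ := by
      have : |p * t δ| ≤ |p| * (2 * ε * β) := by
        rw [abs_mul, abs_of_pos h1.1]
        exact mul_le_mul_of_nonneg_left h1.2 hp0
      linarith [neg_abs_le (p * t δ)]
    nlinarith)
  simp only at hs0
  have hst := ht0 s hs
  have hspos : 0 < s := by
    rcases hs.1.lt_or_eq with h | h
    · exact h
    · exfalso
      rw [← h] at hs0
      nlinarith [mul_pos hε0 hα]
  have hpt := hF s (t s)
  have hmem := M.F_mem_interior E (square_corner_mem hi hspos (by linarith [hs.2]) hst.1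
    (by linarith))
  rw [hpt, hg] at hmem
  convert hmem using 2
  have hd := hden s hs
  have ht1 : t s * (1 + q * s) = ε * β := by
    rw [ht]; field_simp
  have h1 : ε * α = s + s * t s * p := by linarith
  have h2 : ε * β = t s + s * t s * q := by rw [← ht1]; ring
  rw [smul_add, smul_smul, smul_smul, h1, h2]
  module

end Square

end Mesh
end Biot

/-! ### Neighbours across a facet and their normal fluxes -/

namespace Biot

namespace Mesh

section Simplex

variable {d : ℕ} {Ω : Set (Vec d)} {nE nV : ℕ} {M : Mesh (Shape.simplex d) Ω nE nV}

theorem simplex_mem_facetVerts {f i : Fin (d + 1)} :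
    i ∈ (Shape.simplex d).facetVerts f ↔ i ≠ f := by
  simp [Shape.facetVerts]

theorem simplex_sum_weights_facet {E E' : Fin nE} {f f' i i' : Fin (d + 1)} (hi : i ≠ f)
    (hi' : M.cell E' i' = M.cell E i) {n : Vec d} (hn : M.IsNormal E f n)
    (c : Fin (d + 1) → ℝ) (hc : ∑ i, c i = 1) (hc' : ∑ i, c i • M.P E i = M.P E' f') :
    n ⬝ᵥ (M.P E' f' - M.P E' i') = c f * (n ⬝ᵥ (M.P E f - M.P E i)) := by
  have e1 : M.P E' i' = M.P E i := by simp only [Cells.P, hi']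
  have e2 : M.P E' f' - M.P E' i' = ∑ j, c j • (M.P E j - M.P E i) := by
    simp only [smul_sub, Finset.sum_sub_distrib, ← Finset.sum_smul]
    rw [e1, hc, hc', one_smul]
  rw [e2, dotProduct_sum]
  rw [Finset.sum_eq_single f]
  · rw [dotProduct_smul, smul_eq_mul]
  · intro j _ hj
    rw [dotProduct_smul, hn _ (Finset.mem_image_of_mem _ (simplex_mem_facetVerts.2 hj)) _
      (Finset.mem_image_of_mem _ (simplex_mem_facetVerts.2 hi)), smul_zero]
  · simp

theorem simplex_facet_sum {E E' : Fin nE} {f f' : Fin (d + 1)}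
    (h : M.facet E f = M.facet E' f') {α : Type*} [AddCommMonoid α] (g : Fin nV → α) :
    ∑ i ∈ Finset.univ.erase f, g (M.cell E i) = ∑ i ∈ Finset.univ.erase f', g (M.cell E' i) := by
  have h1 : ∀ (E : Fin nE) (f : Fin (d + 1)), ∑ i ∈ Finset.univ.erase f, g (M.cell E i) =
      ∑ v ∈ M.facet E f, g v := by
    intro E f
    rw [Cells.facet, Finset.sum_image]
    · rfl
    · exact fun i _ j _ hij => M.cell_injective E hij
  rw [h1, h1, h]

/-- Neighbouring simplices lie on different sides of their common facet. -/
theorem simplex_weight_neg (hd : 0 < d) {E E' : Fin nE} (hE : E ≠ E') {f f' : Fin (d + 1)}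
    (h : M.facet E f = M.facet E' f') (c : Fin (d + 1) → ℝ) (hc : ∑ i, c i = 1)
    (hc' : ∑ i, c i • M.P E i = M.P E' f') : c f < 0 := by
  have hJ := simplex_J_neighbour h c hc hc' 0 0
  have h0 : (0 : Vec d) ∈ (Shape.simplex d).refElem := by
    rw [← Shape.simplex_refVert_zero]
    exact Shape.refVert_mem _ _
  have hJ1 := M.J_pos E h0
  have hJ2 := M.J_pos E' h0
  by_contra hneg
  have hpos : 0 < c f := by
    refine lt_of_le_of_ne (not_lt.1 hneg) fun h0 => ?_
    rw [← h0] at hJ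
    simp at hJ
    linarith
  have hcard : ∀ f : Fin (d + 1), ((Finset.univ.erase f).card : ℝ) = d := by simp
  have hd' : (0 : ℝ) < d := by exact_mod_cast hd
  -- If `c f > 0`, the point `(1 - ε)` times the centroid of the facet plus `ε` times the apex of
  -- `E'` is interior to both simplices for small `ε`. The weights `w` and `w'` express it in each
  -- of them.
  obtain ⟨ε, hε0, hε1, hε⟩ : ∃ ε : ℝ, 0 < ε ∧ ε < 1 ∧
      ∀ j, 0 < (1 - ε) / d + ε * c j := by
    have : ∀ᶠ ε : ℝ in nhdsWithin 0 (Set.Ioi 0), ε < 1 ∧ ∀ j, 0 < (1 - ε) / d + ε * c j := by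
      refine Filter.Eventually.filter_mono nhdsWithin_le_nhds ?_
      refine Filter.Eventually.and (eventually_lt_nhds one_pos) ?_
      rw [Filter.eventually_all]
      intro j
      exact ContinuousAt.eventually_lt continuousAt_const (by fun_prop) (by simpa using hd')
    obtain ⟨ε, h1, h2⟩ := (this.and self_mem_nhdsWithin).exists
    exact ⟨ε, h2, h1⟩
  set w : Fin (d + 1) → ℝ := fun j => (if j = f then 0 else (1 - ε) / d) + ε * c j with hw
  set w' : Fin (d + 1) → ℝ := fun j => if j = f' then ε else (1 - ε) / d with hw'
  have s0 : ∀ f : Fin (d + 1), ∑ j, (if j = f then 0 else (1 - ε) / d) = 1 - ε := by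
    intro f
    rw [← Finset.add_sum_erase _ _ (Finset.mem_univ f), if_pos rfl, zero_add,
      Finset.sum_congr rfl fun j hj => if_neg (Finset.ne_of_mem_erase hj), Finset.sum_const,
      nsmul_eq_mul, hcard]
    field_simp
  have e1 : M.P E' f' = M.P E' f' := rfl
  have m1 := simplex_sum_mem_interior (M := M) E w (fun j => by
    simp only [hw]
    by_cases hj : j = f
    · subst hj; simp; positivity
    · simpa [hj] using hε j) (by
    simp only [hw, Finset.sum_add_distrib, s0, ← Finset.mul_sum, hc]
    ring)
  have m2 := simplex_sum_mem_interior (M := M) E' w' (fun j => by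
    simp only [hw']
    split_ifs
    · exact hε0
    · exact div_pos (by linarith) hd') (by
    have : ∀ j, w' j = (if j = f' then 0 else (1 - ε) / d) + if j = f' then ε else 0 := by
      intro j; simp only [hw']; split_ifs <;> simp
    simp only [this, Finset.sum_add_distrib, s0]
    simp)
  have e : ∑ i, w i • M.P E i = ∑ i, w' i • M.P E' i := by
    have a1 : ∑ i, w i • M.P E i = (∑ i ∈ Finset.univ.erase f, ((1 - ε) / d) • M.P E i) +
        ε • M.P E' f' := by
      simp only [hw, add_smul, Finset.sum_add_distrib, mul_smul, ← Finset.smul_sum, hc']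
      congr 1
      rw [Finset.smul_sum, ← Finset.add_sum_erase _ _ (Finset.mem_univ f), if_pos rfl, zero_smul,
        zero_add]
      exact Finset.sum_congr rfl fun j hj => by rw [if_neg (Finset.ne_of_mem_erase hj)]
    have a2 : ∑ i, w' i • M.P E' i = (∑ i ∈ Finset.univ.erase f', ((1 - ε) / d) • M.P E' i) +
        ε • M.P E' f' := by
      rw [← Finset.add_sum_erase _ _ (Finset.mem_univ f'), add_comm]
      simp only [hw', if_true]
      congr 1
      exact Finset.sum_congr rfl fun j hj => by rw [if_neg (Finset.ne_of_mem_erase hj)]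
    rw [a1, a2]
    congr 1
    exact simplex_facet_sum h fun v => ((1 - ε) / d) • M.pt v
  rw [e] at m1
  exact M.notMem_interior hE m1 (interior_subset m2)

end Simplex

section Square

variable {Ω : Set (Vec 2)} {nE nV : ℕ} (M : Mesh Shape.square Ω nE nV)

theorem square_cell_along {E E' : Fin nE} {f f' i i' : Fin 4}
    (h : M.facet E f = M.facet E' f') (hi : i ∈ Shape.square.facetVerts f)
    (hi' : i' ∈ Shape.square.facetVerts f') (hii : M.cell E' i' = M.cell E i) :
    M.cell E' (Shape.along f' i') = M.cell E (Shape.along f i) := by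
  obtain ⟨k, hk, e⟩ := M.exists_vertex_of_facet_eq h (along_mem f i)
  have hne : Shape.along f i ≠ i := by
    revert hi
    simp only [Shape.square_facetVerts, Shape.along]
    clear * -
    revert f i; decide
  have hki : k ≠ i' := by
    rintro rfl
    exact hne (M.cell_injective E (e.symm.trans hii))
  have : k = Shape.along f' i' := by
    revert hk hi' hki
    simp only [Shape.square_facetVerts, Shape.along]
    clear * -
    revert f' i' k; decide
  rw [← this, e]

/-- Neighbouring quadrilaterals lie on different sides of their common edge. -/
theorem square_cross_mul_neg {E E' : Fin nE} (hE : E ≠ E') {f f' i i' : Fin 4}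
    (h : M.facet E f = M.facet E' f') (hi : i ∈ Shape.square.facetVerts f)
    (hi' : i' ∈ Shape.square.facetVerts f') (hii : M.cell E' i' = M.cell E i) :
    cross (M.P E (Shape.along f i) - M.P E i) (M.P E' (Shape.square.opp f' i') - M.P E' i') *
      cross (M.P E (Shape.along f i) - M.P E i) (M.P E (Shape.square.opp f i) - M.P E i) < 0 := by
  have e1 : M.P E' i' = M.P E i := by simp only [Cells.P, hii]
  have e2 : M.P E' (Shape.along f' i') = M.P E (Shape.along f i) := by
    simp only [Cells.P, M.square_cell_along h hi hi' hii]
  have c1 := M.cross_corner_ne_zero E hi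
  have c2 := M.cross_corner_ne_zero E' hi'
  have k1 := fun α β => M.square_corner_eventually E hi (α := α) (β := β)
  have k2 := fun α β => M.square_corner_eventually E' hi' (α := α) (β := β)
  rw [e2] at c2 k2
  rw [e1] at c2 k2 ⊢
  set T := M.P E (Shape.along f i) - M.P E i
  set y := M.P E (Shape.square.opp f i) - M.P E i
  set y' := M.P E' (Shape.square.opp f' i') - M.P E i
  by_contra hneg
  have hpos : 0 < cross T y' * cross T y :=
    lt_of_le_of_ne (not_lt.1 hneg) (mul_ne_zero c2 c1).symm
  have hκ : 0 < cross T y' / cross T y := by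
    rw [← mul_div_mul_right _ _ c1]
    exact div_pos hpos (mul_self_pos.2 c1)
  have hy' := exists_eq_add_of_cross_ne_zero c1 y'
  set κ := cross T y' / cross T y
  set β := cross y' y / cross T y
  have hβ := neg_abs_le β
  have hβ0 := abs_nonneg β
  -- With `y' = β T + κ y` and `κ > 0`, the direction `(|β| + 1) T + y'` has positive coefficients
  -- in both corners, so nearby points in this direction are interior to both elements.
  obtain ⟨ε, h1, h2⟩ := ((k1 (β + (|β| + 1)) κ (by linarith) hκ).and
    (k2 (|β| + 1) 1 (by linarith) one_pos)).exists
  refine M.notMem_interior hE h1 (interior_subset ?_)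
  have e : (β + (|β| + 1)) • T + κ • y = (|β| + 1) • T + (1 : ℝ) • y' := by
    rw [hy']
    module
  rw [e]
  exact h2

end Square

variable {d : ℕ} {s : Shape d} {Ω : Set (Vec d)} {nE nV : ℕ} (M : Mesh s Ω nE nV)

/-- The normal fluxes of the basis fields of two neighbouring elements are opposite. -/
theorem normal_flux_neg (hd : 0 < d) {E E' : Fin nE} (hE : E ≠ E') {f f' i i' : Fin s.nv}
    (h : M.facet E f = M.facet E' f') (hi : i ∈ s.facetVerts f) (hi' : i' ∈ s.facetVerts f')
    (hii : M.cell E' i' = M.cell E i) {n : Vec d} (hn : M.IsNormal E f n) :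
    (M.J E' (s.refVert i'))⁻¹ * (n ⬝ᵥ (M.P E' i' - M.P E' (s.opp f' i'))) =
      -((M.J E (s.refVert i))⁻¹ * (n ⬝ᵥ (M.P E i - M.P E (s.opp f i)))) := by
  have hJ := M.J_pos E (s.refVert_mem i)
  cases s with
  | simplex =>
    obtain ⟨c, hc, hc'⟩ := simplex_exists_weights (M := M) E (M.P E' f')
    have hneg := simplex_weight_neg hd hE h c hc hc'
    have hif : i ≠ f := simplex_mem_facetVerts.1 hi
    have hw := simplex_sum_weights_facet hif hii hn c hc hc'
    -- Passing to `E'` multiplies the height over the facet by `c f` and `J` by `|c f| = -c f`.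
    rw [simplex_J_neighbour h c hc hc' ((Shape.simplex d).refVert i), abs_of_neg hneg]
    change _ * (n ⬝ᵥ (M.P E' i' - M.P E' f')) = -(_ * (n ⬝ᵥ (M.P E i - M.P E f)))
    rw [← neg_sub, dotProduct_neg, hw, ← neg_sub (M.P E f), dotProduct_neg]
    have hcf := hneg.ne
    field_simp
  | square =>
    have hs := M.square_cross_mul_neg hE h hi hi' hii
    have hn0 := hn _ (Finset.mem_image_of_mem _ (along_mem f i)) _ (Finset.mem_image_of_mem _ hi)
    have e1 : M.P E' i' = M.P E i := by simp only [Cells.P, hii]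
    have e2 : M.P E' (Shape.along f' i') = M.P E (Shape.along f i) := by
      simp only [Cells.P, M.square_cell_along h hi hi' hii]
    rw [M.square_J E' hi', M.square_J E hi, e1, e2]
    rw [e1] at hs
    have c1 := M.cross_corner_ne_zero E hi
    -- The product with `n` is a multiple of the cross product with the edge, and `J` at the corner
    -- is the absolute value of the same cross product. Each side is thus the constant `c` times a
    -- sign.
    obtain ⟨c, hc⟩ := exists_dotProduct_eq_cross (T := M.P E (Shape.along f i) - M.P E i) (by
      intro h0
      rw [h0] at c1
      simp [cross] at c1) hn0
    rw [← neg_sub (M.P E' _), dotProduct_neg, hc, ← neg_sub (M.P E (Shape.square.opp f i)),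
      dotProduct_neg, hc]
    set x := cross (M.P E (Shape.along f i) - M.P E i) (M.P E (Shape.square.opp f i) - M.P E i)
    set x' := cross (M.P E (Shape.along f i) - M.P E i)
      (M.P E' (Shape.square.opp f' i') - M.P E i)
    rcases mul_neg_iff.1 hs with ⟨h1, h2⟩ | ⟨h1, h2⟩
    · rw [abs_of_pos h1, abs_of_neg h2]
      field_simp [h1.ne', h2.ne]
    · rw [abs_of_neg h1, abs_of_pos h2]
      field_simp [h1.ne, h2.ne']

/-- There is a normal vector pointing into the element. -/
theorem exists_inner_normal (E : Fin nE) (f : Fin s.nv) :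
    ∃ n, M.IsNormal E f n ∧ ∀ i ∈ s.facetVerts f, 0 < n ⬝ᵥ (M.P E (s.opp f i) - M.P E i) := by
  cases s with
  | simplex =>
    have h0 : (0 : Vec d) ∈ (Shape.simplex d).refElem := by
      rw [← Shape.simplex_refVert_zero]
      exact Shape.refVert_mem _ _
    have hu : IsUnit (M.DF E 0).det := (M.det_ne_zero E 0 h0).isUnit
    change Fin (d + 1) at f
    set L := fderiv ℝ ((Shape.simplex d).shapeFn f) 0 with hL
    set g : Vec d := fun b => L (Pi.single b 1) with hg
    have hLg : ∀ v, L v = g ⬝ᵥ v := by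
      intro v
      conv_lhs => rw [← Finset.univ_sum_single v]
      rw [map_sum]
      refine Finset.sum_congr rfl fun b _ => ?_
      have : (Pi.single b (v b) : Vec d) = v b • Pi.single b 1 := by
        rw [← Pi.single_smul, smul_eq_mul, mul_one]
      rw [this, map_smul, smul_eq_mul, mul_comm]
    have key : ∀ j k : Fin (d + 1), (g ᵥ* (M.DF E 0)⁻¹) ⬝ᵥ (M.P E j - M.P E k) =
        (if f = j then 1 else 0) - (if f = k then 1 else 0) := by
      intro j k
      rw [← Cells.simplex_DF_sub E 0, ← Matrix.dotProduct_mulVec, Matrix.mulVec_mulVec,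
        Matrix.nonsing_inv_mul _ hu, Matrix.one_mulVec, ← hLg, hL, Shape.simplex_fderiv_shapeFn]
    -- The physical gradient of the barycentric coordinate of vertex `f`.
    refine ⟨g ᵥ* (M.DF E 0)⁻¹, ?_, ?_⟩
    · intro v hv v' hv'
      obtain ⟨j, hj, rfl⟩ := Finset.mem_image.1 hv
      obtain ⟨k, hk, rfl⟩ := Finset.mem_image.1 hv'
      have hj : j ≠ f := simplex_mem_facetVerts.1 hj
      have hk : k ≠ f := simplex_mem_facetVerts.1 hk
      have := key j k
      simpa [hj.symm, hk.symm] using this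
    · intro i hi
      have hi : i ≠ f := simplex_mem_facetVerts.1 hi
      change 0 < _ ⬝ᵥ (M.P E f - M.P E i)
      rw [key]
      simp [hi.symm]
  | square =>
    change Fin 4 at f
    have hf : f ∈ Shape.square.facetVerts f := by simp [Shape.square_facetVerts]
    set T := M.P E (f + 1 : Fin 4) - M.P E f with hT
    set σ := (M.DF E (Shape.square.refVert f)).det with hσ
    have key : ∀ y, (σ • ![-T 1, T 0]) ⬝ᵥ y = σ * cross T y := by
      intro y
      simp [cross, dotProduct, Fin.sum_univ_two]; ring
    -- The edge turned by a right angle; the factor `σ` makes it point inwards for either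
    -- orientation.
    refine ⟨σ • ![-T 1, T 0], ?_, ?_⟩
    · intro v hv v' hv'
      obtain ⟨j, hj, rfl⟩ := Finset.mem_image.1 hv
      obtain ⟨k, hk, rfl⟩ := Finset.mem_image.1 hv'
      change (σ • ![-T 1, T 0]) ⬝ᵥ (M.P E j - M.P E k) = 0
      rw [key]
      change j ∈ ({f, f + 1} : Finset (Fin 4)) at hj
      change k ∈ ({f, f + 1} : Finset (Fin 4)) at hk
      simp only [Finset.mem_insert, Finset.mem_singleton] at hj hk
      rcases hj with rfl | rfl <;> rcases hk with rfl | rfl <;> simp [cross, hT] <;> ring_nf <;>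
        simp
    · intro i hi
      rw [key]
      have h1 := M.det_mul_det_pos E (Shape.refVert_mem Shape.square f)
        (Shape.refVert_mem Shape.square i)
      have h2 := M.cross_corner E hi
      change i ∈ ({f, f + 1} : Finset (Fin 4)) at hi
      simp only [Finset.mem_insert, Finset.mem_singleton] at hi
      have hne : f + 1 ≠ f := by clear * -; revert f; decide
      rcases hi with rfl | rfl
      · simp only [Shape.along, if_true, mul_one] at h2
        rw [h2]
        exact h1
      · simp only [Shape.along, hne, if_false] at h2
        have : cross T (M.P E (Shape.square.opp f (f + 1 : Fin 4)) - M.P E (f + 1 : Fin 4)) =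
            (M.DF E (Shape.square.refVert (f + 1 : Fin 4))).det := by
          rw [← neg_neg (Matrix.det _), ← mul_neg_one (Matrix.det _), ← h2]
          simp [cross, hT]; ring
        rw [this]
        exact h1

/-- On a facet the normal component of the Piola transform is independent of the point. -/
theorem facet_flux (E : Fin nE) {f i : Fin s.nv} (hi : i ∈ s.facetVerts f)
    (w : Fin s.nv → ℝ) (hw0 : ∀ j ∈ s.facetVerts f, 0 ≤ w j) (hw : ∑ j ∈ s.facetVerts f, w j = 1)
    {n : Vec d} (hn : M.IsNormal E f n) :
    (M.J E (∑ j ∈ s.facetVerts f, w j • s.refVert j))⁻¹ *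
        (n ⬝ᵥ (M.DF E (∑ j ∈ s.facetVerts f, w j • s.refVert j) *ᵥ
          (s.refVert i - s.refVert (s.opp f i)))) =
      (M.J E (s.refVert i))⁻¹ * (n ⬝ᵥ (M.P E i - M.P E (s.opp f i))) := by
  cases s with
  | simplex =>
    have := Cells.simplex_DF_sub (M := M.toCells) E
      (∑ j ∈ (Shape.simplex d).facetVerts f, w j • (Shape.simplex d).refVert j) i f
    change _ * (n ⬝ᵥ (_ *ᵥ ((Shape.simplex d).refVert i - (Shape.simplex d).refVert f))) = _
    rw [this, Cells.simplex_J_eq, Cells.simplex_J_eq]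
    rfl
  | square =>
    have hx : ∑ j ∈ Shape.square.facetVerts f, w j • Shape.square.refVert j ∈
        Shape.square.refElem :=
      (Shape.convex_refElem _).sum_mem hw0 hw fun j _ => Shape.refVert_mem _ j
    have hxi := Shape.refVert_mem Shape.square i
    have hDF := M.DF_facet E w hw (along_mem f i) hi
    set x := ∑ j ∈ Shape.square.facetVerts f, w j • Shape.square.refVert j
    have hn0 := hn _ (Finset.mem_image_of_mem _ (along_mem f i)) _ (Finset.mem_image_of_mem _ hi)
    have c1 := M.cross_corner_ne_zero E hi
    obtain ⟨c, hc⟩ := exists_dotProduct_eq_cross (T := M.P E (Shape.along f i) - M.P E i) (by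
      intro h0
      rw [h0] at c1
      simp [cross] at c1) hn0
    have e2 := M.cross_corner E hi
    -- The edge is itself the image under `DF` of a reference edge, so the cross product is `det DF`
    -- times a reference constant. Division by `|det DF|` leaves a sign, which is the same at all
    -- points.
    have e1 : cross (M.P E (Shape.along f i) - M.P E i)
        (M.DF E x *ᵥ (Shape.square.refVert (Shape.square.opp f i) - Shape.square.refVert i)) =
        (M.DF E x).det * (if i = f then 1 else -1) := by
      rw [← cross_refVert hi, ← cross_mulVec, hDF]
    rw [← neg_sub, Matrix.mulVec_neg, dotProduct_neg, hc, e1,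
      ← neg_sub (M.P E (Shape.square.opp f i)), dotProduct_neg, hc, e2]
    have hp := M.det_mul_det_pos E hx hxi
    simp only [Cells.J]
    rcases mul_pos_iff.1 hp with ⟨h1, h2⟩ | ⟨h1, h2⟩
    · rw [abs_of_pos h1, abs_of_pos h2]
      field_simp [h1.ne', h2.ne']
    · rw [abs_of_neg h1, abs_of_neg h2]
      field_simp [h1.ne, h2.ne]

end Mesh
end Biot

/-! ### Corner fields and the adjoint equations -/

namespace Biot

theorem Cells.refDiv_add {d : ℕ} {f g : Vec d → Vec d} {x : Vec d} (hf : DifferentiableAt ℝ f x)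
    (hg : DifferentiableAt ℝ g x) :
    Cells.refDiv (f + g) x = Cells.refDiv f x + Cells.refDiv g x := by
  simp only [Cells.refDiv, fderiv_add hf hg, ← Finset.sum_add_distrib]
  rfl

theorem Cells.refDiv_smul {d : ℕ} {f : Vec d → Vec d} {x : Vec d} (hf : DifferentiableAt ℝ f x)
    (r : ℝ) : Cells.refDiv (r • f) x = r * Cells.refDiv f x := by
  simp only [Cells.refDiv, fderiv_const_smul hf, Finset.mul_sum]
  rfl

theorem Cells.refDiv_zero {d : ℕ} (x : Vec d) : Cells.refDiv (0 : Vec d → Vec d) x = 0 := by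
  simp [Cells.refDiv]

theorem Shape.bdm_refDiv_eq {d : ℕ} (s : Shape d) {f : Vec d → Vec d} (hf : f ∈ s.bdm)
    (x : Vec d) : Cells.refDiv f x = Cells.refDiv f 0 := by
  obtain ⟨-, c, hc⟩ := s.bdm_differentiable hf
  rw [hc, hc]

theorem frob_vecMulVec {d : ℕ} (t v : Vec d) (ξ : Mat d) :
    frob (Matrix.vecMulVec t v) ξ = t ⬝ᵥ (ξ *ᵥ v) := by
  simp only [frob, Matrix.vecMulVec_apply, dotProduct, Matrix.mulVec, Finset.mul_sum]
  exact Finset.sum_congr rfl fun a _ => Finset.sum_congr rfl fun b _ => by ring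

namespace Cells

variable {d : ℕ} {s : Shape d} {nE nV : ℕ} (M : Cells s nE nV)

/-- The basis field of the velocity space that belongs to a facet and one of its vertices. -/
def cornerField (E₀ : Fin nE) (f₀ i₀ : Fin s.nv) (E : Fin nE) : Vec d → Vec d :=
  ∑ f, ∑ i, if M.facet E f = M.facet E₀ f₀ ∧ M.cell E i = M.cell E₀ i₀ then
    -- The sign offsets the opposite normal fluxes of the two neighbours.
    (if E = E₀ then (1 : ℝ) else -1) • s.hat f i else 0

/-- The tensor product of a constant vector and a vector field. -/
def tensor (t : Vec d) (ζ : Fin nE → Vec d → Vec d) (E : Fin nE) (x : Vec d) : Mat d :=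
  Matrix.vecMulVec t (ζ E x)

theorem stress_tensor (t : Vec d) (ζ : Fin nE → Vec d → Vec d) (E : Fin nE) (x : Vec d) :
    M.stress (tensor t ζ) E x = Matrix.vecMulVec t (M.velocity ζ E x) := by
  simp [stress, velocity, tensor, Matrix.vecMulVec_mul, Matrix.vecMulVec_smul,
    Matrix.vecMul_transpose]

theorem tensor_mem_Xh {ΓN : Set (Vec d)} {ζ : Fin nE → Vec d → Vec d} (h : ζ ∈ M.Zh ΓN)
    (t : Vec d) : tensor t ζ ∈ M.Xh ΓN := by
  obtain ⟨h1, h2, h3⟩ := h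
  have key : ∀ (E x) (n : Vec d),
      M.stress (tensor t ζ) E x *ᵥ n = (n ⬝ᵥ M.velocity ζ E x) • t := by
    intro E x n
    rw [stress_tensor, Matrix.vecMulVec_mulVec, dotProduct_comm]
    ext; simp [mul_comm]
  refine ⟨fun E a => s.bdm.smul_mem (t a) (h1 E), ?_, ?_⟩
  · intro E E' f f' hf n hn w hw
    rw [key, key, h2 E E' f f' hf n hn w hw]
  · intro E f hf n hn w hw
    rw [key, h3 E f hf n hn w hw, zero_smul]

end Cells

namespace Mesh

variable {d : ℕ} {s : Shape d} {Ω : Set (Vec d)} {nE nV : ℕ} (M : Mesh s Ω nE nV)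

/-- The factor `J⁻¹` of the Piola transformation cancels the `J` of the change of variables. -/
theorem integral_refElem (E : Fin nE) {g : Vec d → ℝ} {c : ℝ} (hg : ∀ x, g x = c) (r : ℝ) :
    ∫ x in s.refElem, (M.J E x)⁻¹ * g x * r * M.J E x = volume.real s.refElem * (c * r) := by
  have h1 : ∫ x in s.refElem, (M.J E x)⁻¹ * g x * r * M.J E x = ∫ x in s.refElem, c * r := by
    refine setIntegral_congr_fun s.isCompact_refElem.measurableSet fun x hx => ?_
    have := (M.J_pos E hx).ne'
    simp only [hg]
    field_simp
  rw [h1, setIntegral_const, smul_eq_mul]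

theorem formzp_eq {z : Fin nE → Vec d → Vec d} (hz : ∀ E, z E ∈ s.bdm) (w : Wh nE) :
    M.formzp z w = -(volume.real s.refElem * ∑ E, Cells.refDiv (z E) 0 * w E) := by
  simp only [Cells.formzp, Cells.integral, Cells.divVelocity, Finset.mul_sum]
  congr 1
  exact Finset.sum_congr rfl fun E _ =>
    M.integral_refElem E (fun x => s.bdm_refDiv_eq (hz E) x) (w E)

theorem formσu_eq {σ : Fin nE → Vec d → Mat d} (hσ : ∀ E a, (fun x => σ E x a) ∈ s.bdm)
    (v : Vh d nE) :
    M.formσu σ v =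
      volume.real s.refElem * ∑ E, (fun a => Cells.refDiv (fun x => σ E x a) 0) ⬝ᵥ v E := by
  simp only [Cells.formσu, Cells.integral, Finset.mul_sum]
  refine Finset.sum_congr rfl fun E _ => ?_
  have := M.integral_refElem E (g := fun x => ∑ a, Cells.refDiv (fun x => σ E x a) x * v E a)
    (c := ∑ a, Cells.refDiv (fun x => σ E x a) 0 * v E a)
    (fun x => Finset.sum_congr rfl fun a _ => by rw [s.bdm_refDiv_eq (hσ E a) x]) 1
  simp only [mul_one] at this
  rw [dotProduct, ← this]
  congr 1
  funext x
  simp only [dotProduct, Cells.divStress, Finset.mul_sum, mul_assoc]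

theorem cornerField_of_eq {E₀ E : Fin nE} {f₀ i₀ f i : Fin s.nv}
    (hf : M.facet E f = M.facet E₀ f₀) (hi : M.cell E i = M.cell E₀ i₀) :
    M.cornerField E₀ f₀ i₀ E = (if E = E₀ then (1 : ℝ) else -1) • s.hat f i := by
  unfold Cells.cornerField
  rw [Finset.sum_eq_single f, Finset.sum_eq_single i, if_pos ⟨hf, hi⟩]
  · intro j _ hj
    exact if_neg fun h => hj (M.cell_injective E (h.2.trans hi.symm))
  · simp
  · intro g _ hg
    exact Finset.sum_eq_zero fun j _ => if_neg fun h =>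
      hg (M.facet_injective E (h.1.trans hf.symm))
  · simp

theorem cornerField_of_ne {E₀ E : Fin nE} {f₀ i₀ : Fin s.nv}
    (hf : ∀ f, M.facet E f ≠ M.facet E₀ f₀) : M.cornerField E₀ f₀ i₀ E = 0 :=
  Finset.sum_eq_zero fun f _ => Finset.sum_eq_zero fun _ _ => if_neg fun h => hf f h.1

/-- Every element either has the given facet, with a matching vertex, or not. -/
theorem facet_cases (E₀ E : Fin nE) {f₀ i₀ : Fin s.nv} (hi₀ : i₀ ∈ s.facetVerts f₀) :
    (∀ f, M.facet E f ≠ M.facet E₀ f₀) ∨ ∃ f, ∃ i ∈ s.facetVerts f,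
      M.facet E f = M.facet E₀ f₀ ∧ M.cell E i = M.cell E₀ i₀ := by
  by_cases h : ∀ f, M.facet E f ≠ M.facet E₀ f₀
  · exact Or.inl h
  · push Not at h
    obtain ⟨f, hf⟩ := h
    obtain ⟨i, hi, e⟩ := M.exists_vertex_of_facet_eq hf.symm hi₀
    exact Or.inr ⟨f, i, hi, hf, e⟩

theorem cornerField_mem_bdm (E₀ E : Fin nE) {f₀ i₀ : Fin s.nv} (hi₀ : i₀ ∈ s.facetVerts f₀) :
    M.cornerField E₀ f₀ i₀ E ∈ s.bdm := by
  rcases M.facet_cases E₀ E hi₀ with h | ⟨f, i, hi, hf, e⟩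
  · rw [M.cornerField_of_ne h]; exact s.bdm.zero_mem
  · rw [M.cornerField_of_eq hf e]
    exact s.bdm.smul_mem _ (s.hat_mem_bdm hi)

theorem sum_weight {E : Fin nE} {f : Fin s.nv} {w : Fin nV → ℝ}
    (hw : Cells.IsWeight (M.facet E f) w) :
    (∀ j ∈ s.facetVerts f, 0 ≤ w (M.cell E j)) ∧ ∑ j ∈ s.facetVerts f, w (M.cell E j) = 1 := by
  refine ⟨fun j hj => hw.1 _ (Finset.mem_image_of_mem _ hj), ?_⟩
  rw [← hw.2, Cells.facet, Finset.sum_image fun i _ j _ h => M.cell_injective E h]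

theorem cornerField_normal_of_ne {E₀ E : Fin nE} {f₀ i₀ g : Fin s.nv}
    (hi₀ : i₀ ∈ s.facetVerts f₀) (hg : M.facet E g ≠ M.facet E₀ f₀) {n : Vec d}
    (hn : M.IsNormal E g n) {w : Fin nV → ℝ} (hw : Cells.IsWeight (M.facet E g) w) :
    n ⬝ᵥ M.velocity (M.cornerField E₀ f₀ i₀) E (M.refPoint E g w) = 0 := by
  rcases M.facet_cases E₀ E hi₀ with h | ⟨f, i, hi, hf, e⟩
  · simp [Cells.velocity, M.cornerField_of_ne h]
  · have hfg : f ≠ g := by rintro rfl; exact hg hf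
    obtain ⟨c, j, hj, k, hk, hc⟩ := s.hat_facet_ne hi hfg (fun j => w (M.cell E j))
      (M.sum_weight hw).2
    have hDF := M.DF_facet E (fun j => w (M.cell E j)) (M.sum_weight hw).2 hj hk
    have hn' := hn _ (Finset.mem_image_of_mem _ hj) _ (Finset.mem_image_of_mem _ hk)
    simp only [Cells.velocity, Cells.refPoint, M.cornerField_of_eq hf e, Pi.smul_apply, hc,
      Matrix.mulVec_smul, hDF, dotProduct_smul, Cells.P, hn', smul_zero]

theorem cornerField_normal_of_eq (hd : 0 < d) {E₀ E : Fin nE} {f₀ i₀ g : Fin s.nv}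
    (hi₀ : i₀ ∈ s.facetVerts f₀) (hg : M.facet E g = M.facet E₀ f₀) {n : Vec d}
    (hn : M.IsNormal E g n) {w : Fin nV → ℝ} (hw : Cells.IsWeight (M.facet E g) w) :
    n ⬝ᵥ M.velocity (M.cornerField E₀ f₀ i₀) E (M.refPoint E g w) =
      w (M.cell E₀ i₀) *
        ((M.J E₀ (s.refVert i₀))⁻¹ * (n ⬝ᵥ (M.P E₀ i₀ - M.P E₀ (s.opp f₀ i₀)))) := by
  obtain ⟨i, hi, e⟩ := M.exists_vertex_of_facet_eq hg.symm hi₀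
  have hn₀ : M.IsNormal E₀ f₀ n := by
    unfold Cells.IsNormal at hn ⊢
    rwa [← hg]
  obtain ⟨hw0, hw1⟩ := M.sum_weight hw
  obtain ⟨c, j, hj, k, hk, hc⟩ := s.hat_facet_self hi (fun j => w (M.cell E j)) hw1
  have hDF := M.DF_facet E (fun j => w (M.cell E j)) hw1 hj hk
  have hn' := hn _ (Finset.mem_image_of_mem _ hj) _ (Finset.mem_image_of_mem _ hk)
  have hflux := M.facet_flux E hi (fun j => w (M.cell E j)) hw0 hw1 hn
  have key : n ⬝ᵥ M.velocity (M.cornerField E₀ f₀ i₀) E (M.refPoint E g w) =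
      (if E = E₀ then (1 : ℝ) else -1) * (w (M.cell E i) *
        ((M.J E (s.refVert i))⁻¹ * (n ⬝ᵥ (M.P E i - M.P E (s.opp g i))))) := by
    simp only [Cells.velocity, Cells.refPoint, M.cornerField_of_eq hg e, Pi.smul_apply, hc,
      Matrix.mulVec_smul, Matrix.mulVec_add, hDF, dotProduct_smul, dotProduct_add, Cells.P, hn',
      smul_zero, add_zero]
    rw [← hflux]
    simp only [smul_eq_mul]
    ring
  rw [key, e]
  by_cases hE : E = E₀
  · subst hE
    obtain rfl := M.facet_injective E hg
    obtain rfl := M.cell_injective E e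
    simp
  · rw [M.normal_flux_neg hd (Ne.symm hE) hg.symm hi₀ hi e hn₀, if_neg hE]
    ring

/-- On the given facet all elements yield the same normal component, linear in the weight of the
vertex; on every other facet it vanishes. Only a Neumann condition on the facet itself could exclude
the field. -/
theorem cornerField_mem_Zh (hd : 0 < d) {ΓN : Set (Vec d)} {E₀ : Fin nE} {f₀ i₀ : Fin s.nv}
    (hi₀ : i₀ ∈ s.facetVerts f₀) (hN : ¬M.IsOn ΓN E₀ f₀) :
    M.cornerField E₀ f₀ i₀ ∈ M.Zh ΓN := by
  refine ⟨fun E => M.cornerField_mem_bdm E₀ E hi₀, ?_, ?_⟩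
  · intro E E' f f' hf n hn w hw
    have hn' : M.IsNormal E' f' n := by
      unfold Cells.IsNormal at hn ⊢
      rwa [← hf]
    have hw' : Cells.IsWeight (M.facet E' f') w := by rwa [← hf]
    by_cases h : M.facet E f = M.facet E₀ f₀
    · rw [M.cornerField_normal_of_eq hd hi₀ h hn hw,
        M.cornerField_normal_of_eq hd hi₀ (hf.symm.trans h) hn' hw']
    · rw [M.cornerField_normal_of_ne hi₀ h hn hw,
        M.cornerField_normal_of_ne hi₀ (fun h' => h (hf.trans h')) hn' hw']
  · intro E f hf n hn w hw
    refine M.cornerField_normal_of_ne hi₀ (fun h => hN ?_) hn hw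
    obtain rfl : E₀ = E := hf.1 E₀ f₀ h.symm
    obtain rfl := M.facet_injective _ h
    exact hf

/-- Three elements on one facet would have pairwise opposite, hence zero, normal fluxes. So a facet
has at most two elements. -/
theorem eq_of_facet_eq (hd : 0 < d) {E₀ E₁ E₂ : Fin nE} {f₀ f₁ f₂ : Fin s.nv} (h1 : E₁ ≠ E₀)
    (h2 : E₂ ≠ E₀) (hf1 : M.facet E₁ f₁ = M.facet E₀ f₀) (hf2 : M.facet E₂ f₂ = M.facet E₀ f₀)
    {i₀ : Fin s.nv} (hi₀ : i₀ ∈ s.facetVerts f₀) : E₁ = E₂ := by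
  by_contra h
  obtain ⟨i₁, hi₁, e₁⟩ := M.exists_vertex_of_facet_eq hf1.symm hi₀
  obtain ⟨i₂, hi₂, e₂⟩ := M.exists_vertex_of_facet_eq hf2.symm hi₀
  obtain ⟨n, hn, hpos⟩ := M.exists_inner_normal E₀ f₀
  have hn₁ : M.IsNormal E₁ f₁ n := by
    unfold Cells.IsNormal at hn ⊢
    rwa [hf1]
  have a1 := M.normal_flux_neg hd h1.symm hf1.symm hi₀ hi₁ e₁ hn
  have a2 := M.normal_flux_neg hd h2.symm hf2.symm hi₀ hi₂ e₂ hn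
  have a3 := M.normal_flux_neg hd h (hf1.trans hf2.symm) hi₁ hi₂ (e₂.trans e₁.symm) hn₁
  have hJ := inv_pos.2 (M.J_pos E₀ (s.refVert_mem i₀))
  have h4 := mul_pos hJ (hpos i₀ hi₀)
  rw [← neg_sub, dotProduct_neg] at h4
  linarith

/-- A sum over elements that only sees the elements sharing a given facet. -/
theorem sum_facet (hd : 0 < d) {E₀ E₁ : Fin nE} {f₀ f₁ i₀ : Fin s.nv}
    (hi₀ : i₀ ∈ s.facetVerts f₀) (h1 : E₁ ≠ E₀) (hf1 : M.facet E₁ f₁ = M.facet E₀ f₀)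
    (g : Fin nE → ℝ) (hg : ∀ E, (∀ f, M.facet E f ≠ M.facet E₀ f₀) → g E = 0) :
    ∑ E, g E = g E₀ + g E₁ := by
  refine Finset.sum_eq_add E₀ E₁ h1.symm ?_ (by simp) (by simp)
  rintro E - ⟨hE0, hE1⟩
  refine hg E fun f hf => hE1 ?_
  exact M.eq_of_facet_eq hd hE0 h1 hf hf1 hi₀

theorem sum_facet_boundary {E₀ : Fin nE} {f₀ : Fin s.nv} (hb : M.IsBoundary E₀ f₀)
    (g : Fin nE → ℝ) (hg : ∀ E, (∀ f, M.facet E f ≠ M.facet E₀ f₀) → g E = 0) :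
    ∑ E, g E = g E₀ := by
  refine Finset.sum_eq_single E₀ (fun E _ hE => hg E fun f hf => hE (hb E f hf)) (by simp)

theorem refDiv_cornerField {E₀ E : Fin nE} {f₀ i₀ f i : Fin s.nv} (hi : i ∈ s.facetVerts f)
    (hf : M.facet E f = M.facet E₀ f₀) (e : M.cell E i = M.cell E₀ i₀) (x : Vec d) :
    Cells.refDiv (M.cornerField E₀ f₀ i₀ E) x = (if E = E₀ then 1 else -1) * s.hatDiv := by
  rw [M.cornerField_of_eq hf e, Cells.refDiv_smul
    ((s.bdm_differentiable (s.hat_mem_bdm hi)).1 x), s.refDiv_hat hi]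
  intro h
  exact s.opp_notMem hi (h ▸ hi)

theorem hatDiv_pos : 0 < s.hatDiv := by
  cases s <;> simp [Shape.hatDiv]

section Flow

variable {ΓN : Set (Vec d)} {p : Wh nE}

/-- The corner field has opposite reference divergences on the two elements, so testing with it
isolates the pressure jump. -/
theorem flow_interior (hd : 0 < d) (hp : ∀ z ∈ M.Zh ΓN, M.formzp z p = 0) {E₀ E₁ : Fin nE}
    {f₀ f₁ i₀ : Fin s.nv} (hi₀ : i₀ ∈ s.facetVerts f₀) (h1 : E₁ ≠ E₀)
    (hf1 : M.facet E₁ f₁ = M.facet E₀ f₀) : p E₁ = p E₀ := by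
  have hN : ¬M.IsOn ΓN E₀ f₀ := fun h => h1 (h.1 E₁ f₁ hf1)
  have h := hp _ (M.cornerField_mem_Zh hd hi₀ hN)
  rw [M.formzp_eq fun E => M.cornerField_mem_bdm E₀ E hi₀, neg_eq_zero, mul_eq_zero,
    or_iff_right s.volume_real_refElem_pos.ne', M.sum_facet hd hi₀ h1 hf1] at h
  · obtain ⟨i₁, hi₁, e₁⟩ := M.exists_vertex_of_facet_eq hf1.symm hi₀
    rw [M.refDiv_cornerField hi₀ rfl rfl, M.refDiv_cornerField hi₁ hf1 e₁, if_pos rfl,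
      if_neg h1] at h
    have := hatDiv_pos (s := s)
    have h' : s.hatDiv * (p E₁ - p E₀) = 0 := by linarith
    rw [mul_eq_zero, or_iff_right this.ne', sub_eq_zero] at h'
    exact h'
  · intro E hE
    rw [M.cornerField_of_ne hE, Cells.refDiv_zero, zero_mul]

theorem flow_boundary (hd : 0 < d) (hp : ∀ z ∈ M.Zh ΓN, M.formzp z p = 0) {E₀ : Fin nE}
    {f₀ i₀ : Fin s.nv} (hi₀ : i₀ ∈ s.facetVerts f₀) (hb : M.IsBoundary E₀ f₀)
    (hN : ¬M.IsOn ΓN E₀ f₀) : p E₀ = 0 := by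
  have h := hp _ (M.cornerField_mem_Zh hd hi₀ hN)
  rw [M.formzp_eq fun E => M.cornerField_mem_bdm E₀ E hi₀, neg_eq_zero, mul_eq_zero,
    or_iff_right s.volume_real_refElem_pos.ne', M.sum_facet_boundary hb] at h
  · rw [M.refDiv_cornerField hi₀ rfl rfl, if_pos rfl] at h
    have := hatDiv_pos (s := s)
    rw [one_mul, mul_eq_zero, or_iff_right this.ne'] at h
    exact h
  · intro E hE
    rw [M.cornerField_of_ne hE, Cells.refDiv_zero, zero_mul]

end Flow

section Elasticity

variable {ΓN : Set (Vec d)} {v : Vh d nE} {ξ : Fin nE → Vec d → Mat d}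

/-- The residual of the adjoint equation at a corner of an element. -/
def residual (v : Vh d nE) (ξ : Fin nE → Vec d → Mat d) (E : Fin nE) (f i : Fin s.nv) : Vec d :=
  s.hatDiv • v E + (s.nv : ℝ)⁻¹ • (ξ E (s.refVert i) *ᵥ (M.P E i - M.P E (s.opp f i)))

theorem velocity_cornerField {E₀ E : Fin nE} {f₀ i₀ f i : Fin s.nv} (hi : i ∈ s.facetVerts f)
    (hf : M.facet E f = M.facet E₀ f₀) (e : M.cell E i = M.cell E₀ i₀) (j : Fin s.nv) :
    M.velocity (M.cornerField E₀ f₀ i₀) E (s.refVert j) = if i = j then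
      ((if E = E₀ then 1 else -1) * (M.J E (s.refVert i))⁻¹) • (M.P E i - M.P E (s.opp f i))
      else 0 := by
  simp only [Cells.velocity, M.cornerField_of_eq hf e, Pi.smul_apply, s.hat_refVert hi]
  by_cases hij : i = j
  · subst hij
    rw [if_pos rfl, if_pos rfl, Matrix.mulVec_smul, M.DF_opp E hi, smul_smul, mul_comm]
  · simp [hij]

/-- The contribution of an element to the adjoint equation. -/
def adjointTerm (v : Vh d nE) (ξ : Fin nE → Vec d → Mat d) (τ : Fin nE → Vec d → Mat d)
    (E : Fin nE) : ℝ :=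
  volume.real s.refElem * ((fun a => Cells.refDiv (fun x => τ E x a) 0) ⬝ᵥ v E) +
    volume.real s.refElem / s.nv *
      ∑ i, frob (M.sVert τ E i) (ξ E (s.refVert i)) * M.J E (s.refVert i)

theorem formσu_add_formσγ {τ : Fin nE → Vec d → Mat d} (hτ : ∀ E a, (fun x => τ E x a) ∈ s.bdm) :
    M.formσu τ v + M.formσγ τ ξ = ∑ E, M.adjointTerm v ξ τ E := by
  rw [M.formσu_eq hτ, Cells.formσγ, Cells.quad, Finset.mul_sum, ← Finset.sum_add_distrib]
  rfl

/-- The field is nonzero at one vertex only, so the quadrature sees a single value of `ξ`; the `J⁻¹`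
of the Piola transformation cancels the `J` in the weight. -/
theorem adjointTerm_cornerField {E₀ E : Fin nE} {f₀ i₀ f i : Fin s.nv} (hi : i ∈ s.facetVerts f)
    (hf : M.facet E f = M.facet E₀ f₀) (e : M.cell E i = M.cell E₀ i₀) (t : Vec d) :
    M.adjointTerm v ξ (Cells.tensor t (M.cornerField E₀ f₀ i₀)) E =
      volume.real s.refElem * ((if E = E₀ then 1 else -1) * (t ⬝ᵥ M.residual v ξ E f i)) := by
  have hJ := (M.J_pos E (s.refVert_mem i)).ne'
  have hdiff : Differentiable ℝ (M.cornerField E₀ f₀ i₀ E) := by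
    rw [M.cornerField_of_eq hf e]
    exact (s.bdm_differentiable (s.bdm.smul_mem _ (s.hat_mem_bdm hi))).1
  have h1 : (fun a => Cells.refDiv
      (fun x => Cells.tensor t (M.cornerField E₀ f₀ i₀) E x a) 0) =
      ((if E = E₀ then 1 else -1) * s.hatDiv) • t := by
    ext a
    have : (fun x => Cells.tensor t (M.cornerField E₀ f₀ i₀) E x a) =
        t a • M.cornerField E₀ f₀ i₀ E := rfl
    rw [this, Cells.refDiv_smul (hdiff 0), M.refDiv_cornerField hi hf e, Pi.smul_apply, smul_eq_mul,
      mul_comm]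
  have h2 : ∑ j, frob (M.sVert (Cells.tensor t (M.cornerField E₀ f₀ i₀)) E j) (ξ E (s.refVert j)) *
      M.J E (s.refVert j) = (if E = E₀ then 1 else -1) *
        (t ⬝ᵥ (ξ E (s.refVert i) *ᵥ (M.P E i - M.P E (s.opp f i)))) := by
    rw [Finset.sum_eq_single i]
    · rw [Cells.sVert, Cells.stress_tensor, frob_vecMulVec, M.velocity_cornerField hi hf e,
        if_pos rfl, Matrix.mulVec_smul, dotProduct_smul, smul_eq_mul]
      field_simp
    · intro j _ hj
      rw [Cells.sVert, Cells.stress_tensor, frob_vecMulVec, M.velocity_cornerField hi hf e,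
        if_neg hj.symm]
      simp
    · simp
  rw [adjointTerm, h1, h2, residual, smul_dotProduct, dotProduct_add, dotProduct_smul,
    dotProduct_smul]
  simp only [smul_eq_mul, div_eq_mul_inv]
  ring

theorem adjointTerm_of_ne {E₀ E : Fin nE} {f₀ i₀ : Fin s.nv}
    (hE : ∀ f, M.facet E f ≠ M.facet E₀ f₀) (t : Vec d) :
    M.adjointTerm v ξ (Cells.tensor t (M.cornerField E₀ f₀ i₀)) E = 0 := by
  have h1 : (fun a => Cells.refDiv
      (fun x => Cells.tensor t (M.cornerField E₀ f₀ i₀) E x a) 0) = 0 := by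
    ext a
    have : (fun x => Cells.tensor t (M.cornerField E₀ f₀ i₀) E x a) = 0 := by
      funext x
      ext b
      simp [Cells.tensor, M.cornerField_of_ne hE, Matrix.vecMulVec_apply]
    rw [this, Cells.refDiv_zero, Pi.zero_apply]
  rw [adjointTerm, h1]
  simp [Cells.sVert, Cells.stress_tensor, frob, Cells.velocity, M.cornerField_of_ne hE]

/-- Tested with a corner field times a constant vector `t`; the signs of the field turn the sum over
the two elements into a difference of residuals. -/
theorem residual_interior (hd : 0 < d)
    (hv : ∀ τ ∈ M.Xh ΓN, M.formσu τ v + M.formσγ τ ξ = 0) {E₀ E₁ : Fin nE}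
    {f₀ f₁ i₀ i₁ : Fin s.nv} (hi₀ : i₀ ∈ s.facetVerts f₀) (h1 : E₁ ≠ E₀)
    (hf1 : M.facet E₁ f₁ = M.facet E₀ f₀) (hi₁ : i₁ ∈ s.facetVerts f₁)
    (e₁ : M.cell E₁ i₁ = M.cell E₀ i₀) : M.residual v ξ E₁ f₁ i₁ = M.residual v ξ E₀ f₀ i₀ := by
  have hN : ¬M.IsOn ΓN E₀ f₀ := fun h => h1 (h.1 E₁ f₁ hf1)
  refine dotProduct_eq _ _ fun t => ?_
  have hm := M.tensor_mem_Xh (M.cornerField_mem_Zh hd hi₀ hN) t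
  have h := hv _ hm
  rw [M.formσu_add_formσγ hm.1, M.sum_facet hd hi₀ h1 hf1, M.adjointTerm_cornerField hi₀ rfl rfl,
    M.adjointTerm_cornerField hi₁ hf1 e₁, if_pos rfl, if_neg h1, ← mul_add, mul_eq_zero,
    or_iff_right s.volume_real_refElem_pos.ne'] at h
  · rw [dotProduct_comm, dotProduct_comm _ t]
    linarith
  · exact fun E hE => M.adjointTerm_of_ne hE t

theorem residual_boundary (hd : 0 < d)
    (hv : ∀ τ ∈ M.Xh ΓN, M.formσu τ v + M.formσγ τ ξ = 0) {E₀ : Fin nE}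
    {f₀ i₀ : Fin s.nv} (hi₀ : i₀ ∈ s.facetVerts f₀) (hb : M.IsBoundary E₀ f₀)
    (hN : ¬M.IsOn ΓN E₀ f₀) : M.residual v ξ E₀ f₀ i₀ = 0 := by
  refine dotProduct_eq_zero _ fun t => ?_
  have hm := M.tensor_mem_Xh (M.cornerField_mem_Zh hd hi₀ hN) t
  have h := hv _ hm
  rw [M.formσu_add_formσγ hm.1, M.sum_facet_boundary hb, M.adjointTerm_cornerField hi₀ rfl rfl,
    if_pos rfl, one_mul, mul_eq_zero, or_iff_right s.volume_real_refElem_pos.ne'] at h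
  · rw [dotProduct_comm]
    exact h
  · exact fun E hE => M.adjointTerm_of_ne hE t

end Elasticity

end Mesh
end Biot

/-! ### Connectedness of the mesh through facets -/

namespace Biot

namespace Mesh

section Square

variable {Ω : Set (Vec 2)} {nE nV : ℕ} (M : Mesh Shape.square Ω nE nV)

/-- By strict convexity the opposite vertex lies in the open cone spanned by the edges at `i`: by
Cramer's rule its coefficients are ratios of Jacobian determinants at vertices, which have the same
sign. -/
theorem square_diagonal_eventually (E : Fin nE) (i : Fin 4) :
    ∀ᶠ ε : ℝ in nhdsWithin 0 (Set.Ioi 0),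
      M.P E i + ε • (M.P E (i + 2 : Fin 4) - M.P E i) ∈ interior (M.cellSet E) := by
  have hi : i ∈ Shape.square.facetVerts i := by simp [Shape.square_facetVerts]
  have hi1 : (i + 1 : Fin 4) ∈ Shape.square.facetVerts i := by simp [Shape.square_facetVerts]
  have hi3 : (i + 3 : Fin 4) ∈ Shape.square.facetVerts (i + 3 : Fin 4) := by
    simp [Shape.square_facetVerts]
  have a0 : Shape.along i i = i + 1 := by simp [Shape.along]
  have o0 : Shape.square.opp i i = (i + 3 : Fin 4) := by simp [Shape.opp]
  have a1 : Shape.along i (i + 1) = i := by simp only [Shape.along]; revert i; decide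
  have o1 : Shape.square.opp i (i + 1 : Fin 4) = (i + 2 : Fin 4) := by
    simp only [Shape.opp]; revert i; decide
  have a3 : Shape.along (i + 3) (i + 3) = i := by simp only [Shape.along]; revert i; decide
  have o3 : Shape.square.opp (i + 3 : Fin 4) (i + 3 : Fin 4) = (i + 2 : Fin 4) := by
    simp only [Shape.opp]; revert i; decide
  have h1i : i + 1 ≠ i := by clear * -; revert i; decide
  have c0 := M.cross_corner E hi
  have c1 := M.cross_corner E hi1
  have c3 := M.cross_corner E hi3
  have hne := M.cross_corner_ne_zero E hi
  rw [a0, o0, if_pos rfl, mul_one] at c0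
  rw [a1, o1, if_neg h1i] at c1
  rw [a3, o3, if_pos rfl, mul_one] at c3
  rw [a0, o0] at hne
  have d1 := M.det_mul_det_pos E (Shape.refVert_mem Shape.square i)
    (Shape.refVert_mem Shape.square (i + 1 : Fin 4))
  have d3 := M.det_mul_det_pos E (Shape.refVert_mem Shape.square i)
    (Shape.refVert_mem Shape.square (i + 3 : Fin 4))
  rw [← c0] at d1 d3
  rw [← c3] at d3
  have e1 : (M.DF E (Shape.square.refVert (i + 1 : Fin 4))).det =
      cross (M.P E (i + 1 : Fin 4) - M.P E i) (M.P E (i + 2 : Fin 4) - M.P E i) := by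
    rw [← neg_neg (Matrix.det _), ← mul_neg_one (Matrix.det _), ← c1]
    simp [cross]; ring
  have e3 : cross (M.P E i - M.P E (i + 3 : Fin 4)) (M.P E (i + 2 : Fin 4) - M.P E (i + 3 : Fin 4))
      = cross (M.P E (i + 2 : Fin 4) - M.P E i) (M.P E (i + 3 : Fin 4) - M.P E i) := by
    simp [cross]; ring
  rw [e1] at d1
  rw [e3] at d3
  have key := M.square_corner_eventually E hi (α := cross (M.P E (i + 2 : Fin 4) - M.P E i)
    (M.P E (i + 3 : Fin 4) - M.P E i) / cross (M.P E (i + 1 : Fin 4) - M.P E i)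
    (M.P E (i + 3 : Fin 4) - M.P E i)) (β := cross (M.P E (i + 1 : Fin 4) - M.P E i)
    (M.P E (i + 2 : Fin 4) - M.P E i) / cross (M.P E (i + 1 : Fin 4) - M.P E i)
    (M.P E (i + 3 : Fin 4) - M.P E i))
    (by rw [← mul_div_mul_left _ _ hne]; exact div_pos d3 (mul_self_pos.2 hne))
    (by rw [← mul_div_mul_left _ _ hne]; exact div_pos d1 (mul_self_pos.2 hne))
  rw [a0, o0, ← exists_eq_add_of_cross_ne_zero hne] at key
  exact key

/-- By conformity `E'` would contain the whole diagonal, and so interior points of `E`. -/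
theorem square_notMem_diagonal {E E' : Fin nE} (h : E ≠ E') {i : Fin 4}
    (h0 : M.cell E i ∈ M.verts E') (h2 : M.cell E (i + 2 : Fin 4) ∈ M.verts E') : False := by
  have hlt : ∀ᶠ ε : ℝ in nhdsWithin 0 (Set.Ioi 0), ε < 1 :=
    (eventually_lt_nhds one_pos).filter_mono nhdsWithin_le_nhds
  obtain ⟨ε, ⟨hε, hε1⟩, hε0⟩ :=
    (((M.square_diagonal_eventually E i).and hlt).and self_mem_nhdsWithin).exists
  have hε0 : 0 < ε := hε0
  refine M.notMem_interior h hε ?_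
  have hc := M.conforming E E' h
  suffices hmem : M.P E i + ε • (M.P E (i + 2 : Fin 4) - M.P E i) ∈
      convexHull ℝ (M.pt '' ((M.verts E ∩ M.verts E' : Finset (Fin nV)) : Set (Fin nV))) by
    rw [← hc] at hmem
    exact hmem.2
  have hv : ∀ j, M.cell E j ∈ M.verts E := fun j => Finset.mem_image_of_mem _ (Finset.mem_univ j)
  have hm : ∀ j, M.cell E j ∈ M.verts E' → M.P E j ∈
      convexHull ℝ (M.pt '' ((M.verts E ∩ M.verts E' : Finset (Fin nV)) : Set (Fin nV))) :=
    fun j hj => subset_convexHull ℝ _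
      (Set.mem_image_of_mem M.pt (Finset.mem_coe.2 (Finset.mem_inter.2 ⟨hv j, hj⟩)))
  exact (convex_convexHull ℝ _).add_smul_sub_mem (hm i h0) (hm _ h2) ⟨hε0.le, hε1.le⟩

theorem square_exists_facet {E E' : Fin nE} (h : E ≠ E') {u v : Fin nV} (huv : u ≠ v)
    (hu : u ∈ M.verts E) (hv : v ∈ M.verts E) (hu' : u ∈ M.verts E') (hv' : v ∈ M.verts E') :
    ∃ f, M.facet E f = {u, v} := by
  obtain ⟨i, -, rfl⟩ := Finset.mem_image.1 hu
  obtain ⟨j, -, rfl⟩ := Finset.mem_image.1 hv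
  change Fin 4 at i j
  have hij : i ≠ j := fun h => huv (h ▸ rfl)
  have : j = i + 1 ∨ i = j + 1 ∨ j = i + 2 := by clear * - hij; revert i j; decide
  rcases this with rfl | rfl | rfl
  · exact ⟨i, by simp [Cells.facet, Shape.square_facetVerts]⟩
  · exact ⟨j, by simp [Cells.facet, Shape.square_facetVerts, Finset.pair_comm]⟩
  · exact (M.square_notMem_diagonal h hu' hv').elim

end Square

variable {d : ℕ} {s : Shape d} {Ω : Set (Vec d)} {nE nV : ℕ} (M : Mesh s Ω nE nV)

theorem card_verts (E : Fin nE) : (M.verts E).card = s.nv := by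
  rw [Cells.verts, Finset.card_image_of_injective _ (M.cell_injective E)]
  simp

theorem simplex_exists_facet {M : Mesh (Shape.simplex d) Ω nE nV} (E : Fin nE)
    {C : Finset (Fin nV)} (hC : C ⊆ M.verts E) (hcard : C.card = d) : ∃ f, M.facet E f = C := by
  have h1 : (M.verts E \ C).card = 1 := by
    rw [Finset.card_sdiff_of_subset hC, M.card_verts, hcard]
    simp [Shape.nv]
  obtain ⟨v, hv⟩ := Finset.card_eq_one.1 h1
  have hvE : v ∈ M.verts E \ C := by rw [hv]; simp
  obtain ⟨f, -, rfl⟩ := Finset.mem_image.1 (Finset.mem_sdiff.1 hvE).1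
  refine ⟨f, ?_⟩
  have h2 : M.facet E f = (M.verts E).erase (M.cell E f) := by
    rw [Cells.verts, ← Finset.image_erase (M.cell_injective E)]
    rfl
  rw [h2, ← Finset.sdiff_singleton_eq_erase, ← hv, Finset.sdiff_sdiff_eq_self hC]

/-- Any `d` common vertices form a facet of both elements; for quadrilaterals, the diagonal has just
been excluded. -/
theorem card_common_lt (hd : 2 ≤ d) {E E' : Fin nE} (h : E ≠ E')
    (hf : ∀ f f', M.facet E f ≠ M.facet E' f') : (M.verts E ∩ M.verts E').card < d := by
  by_contra hcard
  rw [not_lt] at hcard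
  cases s with
  | simplex =>
    obtain ⟨C, hC, hCd⟩ := Finset.exists_subset_card_eq hcard
    obtain ⟨f, hf1⟩ := simplex_exists_facet E (hC.trans Finset.inter_subset_left) hCd
    obtain ⟨f', hf2⟩ := simplex_exists_facet E' (hC.trans Finset.inter_subset_right) hCd
    exact hf f f' (hf1.trans hf2.symm)
  | square =>
    obtain ⟨u, hu, v, hv, huv⟩ := Finset.one_lt_card.1 (lt_of_lt_of_le one_lt_two hcard)
    rw [Finset.mem_inter] at hu hv
    obtain ⟨f, hf1⟩ := M.square_exists_facet h huv hu.1 hv.1 hu.2 hv.2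
    obtain ⟨f', hf2⟩ := M.square_exists_facet h.symm huv hu.2 hv.2 hu.1 hv.1
    exact hf f f' (hf1.trans hf2.symm)

theorem volume_affineSpan_eq_zero {S : Finset (Vec d)} (hS : S.card ≤ d)
    (hne : S.Nonempty) : volume (affineSpan ℝ (S : Set (Vec d)) : Set (Vec d)) = 0 := by
  refine Measure.addHaar_affineSubspace volume _ fun htop => ?_
  obtain ⟨n, hn⟩ := Nat.exists_eq_succ_of_ne_zero (Finset.card_pos.2 hne).ne'
  have h1 := finrank_vectorSpan_image_finset_le ℝ (id : Vec d → Vec d) S hn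
  rw [Finset.image_id, ← direction_affineSpan, htop, AffineSubspace.direction_top, finrank_top,
    Module.finrank_fin_fun] at h1
  omega

/-- The mesh is connected through facets. -/
theorem facet_induction (hd : 2 ≤ d) (hΩo : IsOpen Ω) (hΩc : IsConnected Ω) (p : Fin nE → Prop)
    {E₀ : Fin nE} (h₀ : p E₀)
    (hstep : ∀ E E' f f', E ≠ E' → M.facet E f = M.facet E' f' → p E → p E') (E : Fin nE) :
    p E := by
  classical
  by_contra hE
  set U : Set (Vec d) := ⋃ E ∈ {E | p E}, M.cellSet E with hU
  set U' : Set (Vec d) := ⋃ E ∈ {E | ¬p E}, M.cellSet E with hU'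
  have hUc : IsClosed U := (Set.toFinite _).isClosed_biUnion fun E _ =>
    (M.isCompact_cellSet E).isClosed
  have hUc' : IsClosed U' := (Set.toFinite _).isClosed_biUnion fun E _ =>
    (M.isCompact_cellSet E).isClosed
  have hcov : Ω ⊆ U ∪ U' := by
    intro x hx
    have := subset_closure hx
    rw [← M.cover] at this
    obtain ⟨E, hE⟩ := Set.mem_iUnion.1 this
    by_cases hp : p E
    · exact Or.inl (Set.mem_biUnion (show E ∈ {E | p E} from hp) hE)
    · exact Or.inr (Set.mem_biUnion (show E ∈ {E | ¬p E} from hp) hE)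
  have hmeet : ∀ E, (Ω ∩ M.cellSet E).Nonempty := by
    intro E
    obtain ⟨x, hx⟩ := M.interior_cellSet_nonempty E
    have hxc : x ∈ closure Ω := by
      rw [← M.cover]
      exact Set.mem_iUnion.2 ⟨E, interior_subset hx⟩
    obtain ⟨y, hy, hy'⟩ := mem_closure_iff.1 hxc _ isOpen_interior hx
    exact ⟨y, hy', interior_subset hy⟩
  -- The closed unions of the elements with and without `p` cover the connected `Ω`, so they meet at
  -- some `x` in `Ω`. Near `x` they are joined below by a segment that avoids all intersections of
  -- small dimension.
  obtain ⟨x, hxΩ, hxU, hxU'⟩ := isPreconnected_closed_iff.1 hΩc.isPreconnected U U' hUc hUc' hcov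
    ((hmeet E₀).mono (Set.inter_subset_inter_right _
      (Set.subset_biUnion_of_mem (u := M.cellSet) (show E₀ ∈ {E | p E} from h₀))))
    ((hmeet E).mono (Set.inter_subset_inter_right _
      (Set.subset_biUnion_of_mem (u := M.cellSet) (show E ∈ {E | ¬p E} from hE))))
  obtain ⟨E₁, hp₁, hx₁⟩ := Set.mem_iUnion₂.1 hxU
  obtain ⟨E₂, hp₂, hx₂⟩ := Set.mem_iUnion₂.1 hxU'
  obtain ⟨r, hr, hball⟩ := Metric.isOpen_iff.1 hΩo x hxΩ
  obtain ⟨z, hz, hzE₂⟩ := mem_closure_iff.1 (M.cellSet_subset E₂ hx₂) _ Metric.isOpen_ball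
    (Metric.mem_ball_self hr)
  have hopen : IsOpen (Metric.ball x r ∩ interior (M.cellSet E₁)) :=
    Metric.isOpen_ball.inter isOpen_interior
  have hne : (Metric.ball x r ∩ interior (M.cellSet E₁)).Nonempty :=
    mem_closure_iff.1 (M.cellSet_subset E₁ hx₁) _ Metric.isOpen_ball (Metric.mem_ball_self hr)
  -- If `p` holds on `A` but not on `B`, they share no facet, hence fewer than `d` vertices.
  -- Together with `z` these are at most `d` points, and their affine span is a null set.
  let S : Fin nE → Fin nE → Finset (Vec d) := fun A B =>
    insert z ((M.verts A ∩ M.verts B).image M.pt)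
  have hnull : ∀ A B, p A → ¬p B → volume (affineSpan ℝ (S A B : Set (Vec d)) : Set (Vec d)) = 0 := by
    intro A B hA hB
    have hAB : A ≠ B := by rintro rfl; exact hB hA
    refine volume_affineSpan_eq_zero ?_ (Finset.insert_nonempty _ _)
    have h1 := M.card_common_lt hd hAB fun f f' hf => hB (hstep A B f f' hAB hf hA)
    have h2 := Finset.card_image_le (s := M.verts A ∩ M.verts B) (f := M.pt)
    have h3 := Finset.card_insert_le z ((M.verts A ∩ M.verts B).image M.pt)
    change (insert z ((M.verts A ∩ M.verts B).image M.pt)).card ≤ d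
    omega
  have hnull' : volume (⋃ A, ⋃ B, ⋃ _ : p A ∧ ¬p B,
      (affineSpan ℝ (S A B : Set (Vec d)) : Set (Vec d))) = 0 := by
    simp only [measure_iUnion_null_iff]
    exact fun A B h => hnull A B h.1 h.2
  obtain ⟨y, hy, hyS⟩ : ∃ y ∈ Metric.ball x r ∩ interior (M.cellSet E₁), y ∉ ⋃ A, ⋃ B,
      ⋃ _ : p A ∧ ¬p B, (affineSpan ℝ (S A B : Set (Vec d)) : Set (Vec d)) := by
    by_contra hcon
    push Not at hcon
    exact (hopen.measure_pos volume hne).ne' (measure_mono_null hcon hnull')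
  have hseg : segment ℝ y z ⊆ Metric.ball x r := (convex_ball x r).segment_subset hy.1 hz
  obtain ⟨q, hqs, hqU, hqU'⟩ := isPreconnected_closed_iff.1 (convex_segment y z).isPreconnected
    U U' hUc hUc' ((hseg.trans hball).trans hcov)
    ⟨y, left_mem_segment ℝ y z, Set.mem_biUnion (show E₁ ∈ {E | p E} from hp₁)
      (interior_subset hy.2)⟩
    ⟨z, right_mem_segment ℝ y z, Set.mem_biUnion (show E₂ ∈ {E | ¬p E} from hp₂)
      (interior_subset hzE₂)⟩
  obtain ⟨A, hA, hqA⟩ := Set.mem_iUnion₂.1 hqU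
  obtain ⟨B, hB, hqB⟩ := Set.mem_iUnion₂.1 hqU'
  have hA : p A := hA
  have hB : ¬p B := hB
  have hAB : A ≠ B := by rintro rfl; exact hB hA
  have hqz : q ≠ z := by
    rintro rfl
    exact M.notMem_interior (by rintro rfl; exact hp₂ hA) hzE₂ hqA
  apply hyS
  simp only [Set.mem_iUnion]
  refine ⟨A, B, ⟨hA, hB⟩, ?_⟩
  have hz' : z ∈ affineSpan ℝ (S A B : Set (Vec d)) :=
    subset_affineSpan ℝ _ (by simp [S])
  have hq' : q ∈ affineSpan ℝ (S A B : Set (Vec d)) := by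
    have h1 : q ∈ M.cellSet A ∩ M.cellSet B := ⟨hqA, hqB⟩
    rw [M.conforming A B hAB] at h1
    have h2 := convexHull_subset_affineSpan _ h1
    refine affineSpan_mono ℝ ?_ h2
    intro a ha
    simp only [S, Finset.coe_insert, Finset.coe_image]
    exact Or.inr ha
  obtain ⟨t, ht, rfl⟩ := (segment_eq_image_lineMap ℝ y z ▸ hqs : q ∈ _ '' _)
  have ht1 : t ≠ 1 := by rintro rfl; exact hqz (by simp)
  have h1t : 1 - t ≠ 0 := sub_ne_zero.2 ht1.symm
  -- The segment changes sides at a point `q ≠ z` of `A ∩ B`, the hull of the common vertices. So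
  -- `y`, on the line through `z` and `q`, lies in the span it was chosen to avoid.
  have hy' : y = AffineMap.lineMap z (AffineMap.lineMap y z t) (1 - t)⁻¹ := by
    simp only [AffineMap.lineMap_apply_module]
    ext j
    simp only [Pi.add_apply, Pi.smul_apply, smul_eq_mul]
    field_simp
    ring
  rw [hy']
  exact AffineMap.lineMap_mem _ hz' hq'

end Mesh

/-! ### The Dirichlet part and the kernel of the flow -/

namespace Mesh

variable {d : ℕ} {s : Shape d} {Ω : Set (Vec d)} {nE nV : ℕ} (M : Mesh s Ω nE nV)

/-- The facets contained in `N` form a closed set; if it were all of `∂Ω`, then `D` would lie in the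
null set `D ∩ N`. The ball condition on `D` mentions no mesh, so it can be used for all meshes at
once. -/
theorem exists_ball_subset_dirichlet {Γ : BoundarySplit Ω} (hM : M.Resolves Γ) :
    ∃ x ∈ frontier Ω, ∃ ε > 0, (∀ y ∈ frontier Ω, dist y x < ε → y ∈ Γ.D) ∧
      ∀ E f, M.IsBoundary E f → M.facetSet E f ⊆ Γ.N → x ∉ M.facetSet E f := by
  obtain ⟨K, hK⟩ : ∃ K : Set (Vec d), K = ⋃ E, ⋃ f, ⋃ _ : M.IsBoundary E f ∧
    M.facetSet E f ⊆ Γ.N, M.facetSet E f := ⟨_, rfl⟩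
  have hKc : IsClosed K := by
    rw [hK]
    exact isClosed_iUnion_of_finite fun E => isClosed_iUnion_of_finite fun f =>
      isClosed_iUnion_of_finite fun _ => ((Finset.finite_toSet _).image _).isClosed_convexHull ℝ
  have hKN : K ⊆ Γ.N := by
    rw [hK]
    exact Set.iUnion_subset fun E => Set.iUnion_subset fun f => Set.iUnion_subset fun h => h.2
  obtain ⟨x, hx, hxK⟩ : ∃ x ∈ frontier Ω, x ∉ K := by
    by_contra hcon
    push Not at hcon
    have h1 : Γ.D ⊆ Γ.D ∩ Γ.N := fun y hy => ⟨hy, hKN (hcon y (Γ.union ▸ Or.inl hy))⟩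
    exact Γ.D_pos.ne' (measure_mono_null h1 Γ.overlap)
  obtain ⟨ε, hε, hball⟩ := Metric.isOpen_iff.1 hKc.isOpen_compl x hxK
  have hmem : ∀ E f, M.IsBoundary E f → M.facetSet E f ⊆ Γ.N → M.facetSet E f ⊆ K :=
    fun E f hb hN y hy => by
      rw [hK]
      simp only [Set.mem_iUnion]
      exact ⟨E, f, ⟨hb, hN⟩, hy⟩
  refine ⟨x, hx, ε, hε, fun y hy hyx => ?_, fun E f hb hN hxf => hxK (hmem E f hb hN hxf)⟩
  have hyK : y ∉ K := hball hyx
  rw [← M.boundary] at hy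
  simp only [Set.mem_iUnion] at hy
  obtain ⟨E, f, hb, hyf⟩ := hy
  rcases hM E f hb with h | h
  · exact h hyf
  · exact absurd (hmem E f hb h hyf) hyK

theorem exists_mem_facetSet {x : Vec d} (hx : x ∈ frontier Ω) :
    ∃ E f, M.IsBoundary E f ∧ x ∈ M.facetSet E f := by
  rw [← M.boundary] at hx
  simpa only [Set.mem_iUnion, exists_prop] using hx

theorem exists_not_isOn {Γ : BoundarySplit Ω} (hM : M.Resolves Γ) :
    ∃ E f, M.IsBoundary E f ∧ ¬M.IsOn Γ.N E f := by
  obtain ⟨x, hx, -, -, -, h⟩ := M.exists_ball_subset_dirichlet hM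
  obtain ⟨E, f, hb, hxf⟩ := M.exists_mem_facetSet hx
  exact ⟨E, f, hb, fun hN => h E f hb hN.2 hxf⟩

theorem facetVerts_nonempty (hd : 2 ≤ d) (f : Fin s.nv) : ∃ i, i ∈ s.facetVerts f := by
  cases s with
  | simplex =>
    obtain ⟨i, hi⟩ : ∃ i : Fin (d + 1), i ≠ f := by
      have : Nontrivial (Fin (d + 1)) := Fin.nontrivial_iff_two_le.2 (by omega)
      exact exists_ne f
    exact ⟨i, simplex_mem_facetVerts.2 hi⟩
  | square =>
    change Fin 4 at f
    exact ⟨f, by simp [Shape.square_facetVerts]⟩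

/-- The zero pressure next to a facet off `Γ.N` spreads across interior facets to the whole
connected mesh. -/
theorem flow_kernel (hd : 2 ≤ d) (hΩo : IsOpen Ω) (hΩc : IsConnected Ω) {Γ : BoundarySplit Ω}
    (hM : M.Resolves Γ) {p : Wh nE} (hp : ∀ z ∈ M.Zh Γ.N, M.formzp z p = 0) : p = 0 := by
  obtain ⟨E₀, f₀, hb, hN⟩ := M.exists_not_isOn hM
  obtain ⟨i₀, hi₀⟩ := facetVerts_nonempty (s := s) hd f₀
  have h0 := M.flow_boundary (by omega) hp hi₀ hb hN
  refine funext fun E => M.facet_induction hd hΩo hΩc (fun E => p E = 0) h0 ?_ E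
  intro E E' f f' hne hf hE
  obtain ⟨i, hi⟩ := facetVerts_nonempty (s := s) hd f
  rw [M.flow_interior (by omega) hp hi hne.symm hf.symm]
  exact hE

end Mesh
end Biot

/-! ### Skew-symmetric matrices and the elasticity kernel -/

namespace Biot

theorem skew_dotProduct_mulVec {d : ℕ} {X : Mat d} (hX : Xᵀ = -X) (y : Vec d) :
    y ⬝ᵥ (X *ᵥ y) = 0 := by
  have h : y ⬝ᵥ (X *ᵥ y) = -(y ⬝ᵥ (X *ᵥ y)) := by
    conv_lhs => rw [Matrix.dotProduct_mulVec, ← Matrix.mulVec_transpose, hX, Matrix.neg_mulVec,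
      neg_dotProduct, dotProduct_comm]
  linarith

/-- A plane skew matrix is a multiple of the rotation by a right angle. -/
theorem skew_two_eq_zero {X : Mat 2} (hX : Xᵀ = -X) {y : Vec 2} (hy : y ≠ 0)
    (h : X *ᵥ y = 0) : X = 0 := by
  have h00 := congrFun (congrFun hX 0) 0
  have h11 := congrFun (congrFun hX 1) 1
  have h01 := congrFun (congrFun hX 0) 1
  simp only [Matrix.transpose_apply, Matrix.neg_apply] at h00 h11 h01
  have e0 : X 0 0 = 0 := by linarith
  have e1 : X 1 1 = 0 := by linarith
  have k0 := congrFun h 0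
  have k1 := congrFun h 1
  simp only [Matrix.mulVec, dotProduct, Fin.sum_univ_two, Pi.zero_apply, e0, e1, h01, zero_mul,
    zero_add, add_zero] at k0 k1
  have e2 : X 0 1 = 0 := by
    by_contra hne
    refine hy (funext fun a => ?_)
    fin_cases a
    · simpa [hne] using k1
    · simpa [hne] using k0
  ext a b
  fin_cases a <;> fin_cases b <;> simp [e0, e1, e2, h01]

/-- The axial vector of a skew-symmetric matrix. -/
def axial (X : Mat 3) : Vec 3 := ![X 2 1, X 0 2, X 1 0]

theorem axial_sub (X Y : Mat 3) : axial (X - Y) = axial X - axial Y := by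
  ext a; fin_cases a <;> simp [axial]

theorem axial_eq_zero {X : Mat 3} (hX : Xᵀ = -X) (h : axial X = 0) : X = 0 := by
  have h0 := congrFun h 0
  have h1 := congrFun h 1
  have h2 := congrFun h 2
  simp [axial] at h0 h1 h2
  have hs : ∀ a b, X b a = -X a b := fun a b => congrFun (congrFun hX a) b
  have e0 := hs 0 0
  have e1 := hs 1 1
  have e2 := hs 2 2
  have k0 := hs 2 1
  have k1 := hs 0 2
  have k2 := hs 1 0
  ext a b
  fin_cases a <;> fin_cases b <;> simp <;> linarith

/-- `X y` is the cross product of the axial vector with `y`, which vanishes only for parallel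
vectors. -/
theorem axial_eq_smul {X : Mat 3} (hX : Xᵀ = -X) {y : Vec 3} (hy : y ≠ 0) (h : X *ᵥ y = 0) :
    ∃ r : ℝ, axial X = r • y := by
  have hs : ∀ a b, X b a = -X a b := fun a b => congrFun (congrFun hX a) b
  have e0 : X 0 0 = 0 := by linarith [hs 0 0]
  have e1 : X 1 1 = 0 := by linarith [hs 1 1]
  have e2 : X 2 2 = 0 := by linarith [hs 2 2]
  have k0 := congrFun h 0
  have k1 := congrFun h 1
  have k2 := congrFun h 2
  simp only [Matrix.mulVec, dotProduct, Fin.sum_univ_three, Pi.zero_apply, e0, e1, e2, hs 2 1,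
    hs 0 2, hs 1 0, zero_mul, zero_add, add_zero] at k0 k1 k2
  obtain ⟨a, ha⟩ := Function.ne_iff.1 hy
  fin_cases a <;> simp only [Pi.zero_apply] at ha
  · refine ⟨X 2 1 / y 0, funext fun b => ?_⟩
    change y 0 ≠ 0 at ha
    fin_cases b <;> simp [axial] <;> field_simp <;> linarith
  · refine ⟨X 0 2 / y 1, funext fun b => ?_⟩
    change y 1 ≠ 0 at ha
    fin_cases b <;> simp [axial] <;> field_simp <;> linarith
  · refine ⟨X 1 0 / y 2, funext fun b => ?_⟩
    change y 2 ≠ 0 at ha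
    fin_cases b <;> simp [axial] <;> field_simp <;> linarith

namespace Mesh

section General

variable {d : ℕ} {s : Shape d} {Ω : Set (Vec d)} {nE nV : ℕ} (M : Mesh s Ω nE nV)

/-- The displacement-rotation pair `(v, ξ)` is orthogonal to all stresses. -/
structure IsElasticityKernel (ΓN : Set (Vec d)) (v : Vh d nE) (ξ : Fin nE → Vec d → Mat d) :
    Prop where
  mem : ξ ∈ M.Qh
  eq : ∀ τ ∈ M.Xh ΓN, M.formσu τ v + M.formσγ τ ξ = 0

variable {M} {ΓN : Set (Vec d)} {v : Vh d nE} {ξ : Fin nE → Vec d → Mat d}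

theorem neighbour_normal_neg (hd : 0 < d) {E E' : Fin nE} (hE : E ≠ E') {f f' i i' : Fin s.nv}
    (h : M.facet E f = M.facet E' f') (hi : i ∈ s.facetVerts f) (hi' : i' ∈ s.facetVerts f')
    (hii : M.cell E' i' = M.cell E i) {n : Vec d} (hn : M.IsNormal E f n)
    (hpos : 0 < n ⬝ᵥ (M.P E (s.opp f i) - M.P E i)) :
    n ⬝ᵥ (M.P E' (s.opp f' i') - M.P E (s.opp f i)) < 0 := by
  have h1 := M.normal_flux_neg hd hE h hi hi' hii hn
  have hJ := M.J_pos E (s.refVert_mem i)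
  have hJ' := M.J_pos E' (s.refVert_mem i')
  have e : M.P E' i' = M.P E i := congrArg M.pt hii
  rw [e] at h1
  have h2 : 0 < (M.J E' (s.refVert i'))⁻¹ * (n ⬝ᵥ (M.P E i - M.P E' (s.opp f' i'))) := by
    rw [h1, ← mul_neg, ← dotProduct_neg, neg_sub]
    exact mul_pos (inv_pos.2 hJ) hpos
  have h3 := (mul_pos_iff_of_pos_left (inv_pos.2 hJ')).1 h2
  simp only [dotProduct_sub] at *
  linarith

theorem neighbour_ne (hd : 0 < d) {E E' : Fin nE} (hE : E ≠ E') {f f' i i' : Fin s.nv}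
    (h : M.facet E f = M.facet E' f') (hi : i ∈ s.facetVerts f) (hi' : i' ∈ s.facetVerts f')
    (hii : M.cell E' i' = M.cell E i) : M.P E' (s.opp f' i') - M.P E (s.opp f i) ≠ 0 := by
  obtain ⟨n, hn, hpos⟩ := M.exists_inner_normal E f
  intro h0
  have := neighbour_normal_neg hd hE h hi hi' hii hn (hpos i hi)
  simp [h0] at this

theorem facet_trichotomy (E : Fin nE) (f : Fin s.nv) :
    (∃ E' f', E ≠ E' ∧ M.facet E f = M.facet E' f') ∨ M.IsOn ΓN E f ∨
      (M.IsBoundary E f ∧ ¬M.IsOn ΓN E f) := by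
  by_cases hb : M.IsBoundary E f
  · by_cases hN : M.IsOn ΓN E f
    · exact Or.inr (Or.inl hN)
    · exact Or.inr (Or.inr ⟨hb, hN⟩)
  · simp only [Cells.IsBoundary, not_forall] at hb
    obtain ⟨E', f', h, hne⟩ := hb
    exact Or.inl ⟨E', f', Ne.symm hne, h.symm⟩

namespace IsElasticityKernel

variable (hk : M.IsElasticityKernel ΓN v ξ)
include hk

theorem skew (E : Fin nE) (i : Fin s.nv) : (ξ E (s.refVert i))ᵀ = -ξ E (s.refVert i) :=
  hk.mem.1 E _

theorem skew_sub (E : Fin nE) (i j : Fin s.nv) :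
    (ξ E (s.refVert i) - ξ E (s.refVert j))ᵀ = -(ξ E (s.refVert i) - ξ E (s.refVert j)) := by
  rw [Matrix.transpose_sub, hk.skew, hk.skew]
  abel

/-- Continuity across the facet, at the point with all its weight on the shared vertex. -/
theorem rotation_eq {E E' : Fin nE} {f f' i i' : Fin s.nv} (h : M.facet E f = M.facet E' f')
    (hi : i ∈ s.facetVerts f) (hi' : i' ∈ s.facetVerts f') (hii : M.cell E' i' = M.cell E i) :
    ξ E' (s.refVert i') = ξ E (s.refVert i) := by
  classical
  have key : ∀ E : Fin nE, ∀ f i : Fin s.nv, i ∈ s.facetVerts f →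
      M.refPoint E f (Pi.single (M.cell E i) 1) = s.refVert i := by
    intro E f i hi
    rw [Cells.refPoint, s.refVert_eq_sum hi]
    refine Finset.sum_congr rfl fun j _ => ?_
    rw [Pi.single_apply]
    simp only [(M.cell_injective E).eq_iff]
  have hw : Cells.IsWeight (M.facet E f) (Pi.single (M.cell E i) (1 : ℝ)) := by
    refine ⟨fun w _ => ?_, ?_⟩
    · rw [Pi.single_apply]
      split_ifs <;> simp
    · rw [Finset.sum_pi_single', if_pos (show _ ∈ M.facet E f from Finset.mem_image_of_mem _ hi)]
  have h3 := hk.mem.2.2 E E' f f' h _ hw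
  rw [key E f i hi, ← hii, key E' f' i' hi'] at h3
  exact h3.symm

/-- Without rotations the residual is a multiple of `v`, which then vanishes by the argument used
for the pressure. -/
theorem eq_zero_of_rotation (hd : 2 ≤ d) (hΩo : IsOpen Ω) (hΩc : IsConnected Ω)
    {Γ : BoundarySplit Ω} (hΓ : Γ.N = ΓN) (hM : M.Resolves Γ)
    (hr : ∀ E i, ξ E (s.refVert i) = 0) : v = 0 ∧ ξ = 0 := by
  constructor
  · obtain ⟨E₀, f₀, hb, hN⟩ := M.exists_not_isOn hM
    rw [hΓ] at hN
    obtain ⟨i₀, hi₀⟩ := facetVerts_nonempty (s := s) hd f₀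
    have h0 := M.residual_boundary (by omega) hk.eq hi₀ hb hN
    simp only [residual, hr, Matrix.zero_mulVec, smul_zero, add_zero] at h0
    have hne := hatDiv_pos (s := s)
    have h0 := (smul_eq_zero.1 h0).resolve_left hne.ne'
    refine funext fun E => M.facet_induction hd hΩo hΩc (fun E => v E = 0) h0 ?_ E
    intro E E' f f' hEE hf hE
    obtain ⟨i, hi⟩ := facetVerts_nonempty (s := s) hd f
    obtain ⟨i', hi', hii⟩ := M.exists_vertex_of_facet_eq hf hi
    have h1 := M.residual_interior (by omega) hk.eq hi hEE.symm hf.symm hi' hii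
    simp only [residual, hr, Matrix.zero_mulVec, smul_zero, add_zero, hE] at h1
    exact (smul_eq_zero.1 h1).resolve_left hne.ne'
  · funext E x
    ext a b
    have := s.nodal_eq_zero (hk.mem.2.1 E a b) fun i => by rw [hr]; rfl
    exact congrFun this x

end IsElasticityKernel

end General

/-! ### Simplicial meshes -/

section Simplex

variable {d : ℕ} {Ω : Set (Vec d)} {nE nV : ℕ} {M : Mesh (Shape.simplex d) Ω nE nV}
  {ΓN : Set (Vec d)} {v : Vh d nE} {ξ : Fin nE → Vec d → Mat d}

theorem simplex_normal {E : Fin nE} {f i j : Fin (d + 1)} {n : Vec d} (hn : M.IsNormal E f n)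
    (hi : i ≠ f) (hj : j ≠ f) : n ⬝ᵥ (M.P E i - M.P E j) = 0 :=
  hn _ (Finset.mem_image_of_mem _ (simplex_mem_facetVerts.2 hi)) _
    (Finset.mem_image_of_mem _ (simplex_mem_facetVerts.2 hj))

theorem simplex_inner_normal (E : Fin nE) (f : Fin (d + 1)) :
    ∃ n, M.IsNormal E f n ∧ ∀ i ≠ f, 0 < n ⬝ᵥ (M.P E f - M.P E i) := by
  obtain ⟨n, hn, h⟩ := M.exists_inner_normal E f
  exact ⟨n, hn, fun i hi => h i (simplex_mem_facetVerts.2 hi)⟩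

theorem simplex_neighbour_normal (hd : 0 < d) {E E' : Fin nE} (hE : E ≠ E') {f f' : Fin (d + 1)}
    (h : M.facet E f = M.facet E' f') :
    ∃ n, M.IsNormal E f n ∧ n ⬝ᵥ (M.P E' f' - M.P E f) ≠ 0 := by
  obtain ⟨n, hn, hpos⟩ := M.exists_inner_normal E f
  have : Nontrivial (Fin (d + 1)) := Fin.nontrivial_iff_two_le.2 (by omega)
  obtain ⟨i, hi⟩ := exists_ne f
  obtain ⟨i', hi', hii⟩ := M.exists_vertex_of_facet_eq h (simplex_mem_facetVerts.2 hi)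
  exact ⟨n, hn, (neighbour_normal_neg hd hE h (simplex_mem_facetVerts.2 hi) hi' hii hn
    (hpos i (simplex_mem_facetVerts.2 hi))).ne⟩

theorem simplex_neighbour_ne (hd : 0 < d) {E E' : Fin nE} (hE : E ≠ E') {f f' : Fin (d + 1)}
    (h : M.facet E f = M.facet E' f') : M.P E' f' - M.P E f ≠ 0 := by
  obtain ⟨n, -, hn⟩ := simplex_neighbour_normal hd hE h
  rintro h0
  simp [h0] at hn

/-- The point is the combination of the vertices of `E'` in which the shared vertices keep their
weights and the new apex takes the weight of the old one. -/
theorem simplex_neighbour_mem_interior {E E' : Fin nE} {f f' : Fin (d + 1)}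
    (h : M.facet E f = M.facet E' f') (w : Fin (d + 1) → ℝ) (hw : ∀ i, 0 < w i)
    (h1 : ∑ i, w i = 1) :
    ∑ i, w i • M.P E i + w f • (M.P E' f' - M.P E f) ∈ interior (M.cellSet E') := by
  classical
  set W : Fin nV → ℝ := Function.extend (M.cell E) w 0 with hW
  have hWi : ∀ i, W (M.cell E i) = w i := fun i => (M.cell_injective E).extend_apply w 0 i
  have hpos : ∀ j, 0 < if j = f' then w f else W (M.cell E' j) := by
    intro j
    split_ifs with hj
    · exact hw f
    · obtain ⟨i, -, hi⟩ := M.exists_vertex_of_facet_eq h.symm (simplex_mem_facetVerts.2 hj)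
      rw [← hi, hWi]
      exact hw i
  have e1 : ∀ {α : Type} [AddCommGroup α] (g : Fin nV → α) (a : α),
      ∑ j, (if j = f' then a else g (M.cell E' j)) =
        ∑ i, g (M.cell E i) + (a - g (M.cell E f)) := by
    intro α _ g a
    rw [← Finset.add_sum_erase _ _ (Finset.mem_univ f'), if_pos rfl,
      ← Finset.add_sum_erase _ (fun i => g (M.cell E i)) (Finset.mem_univ f),
      simplex_facet_sum h g, Finset.sum_congr rfl fun j hj => if_neg (Finset.ne_of_mem_erase hj)]
    abel
  have hsum := e1 W (w f)
  simp only [hWi, h1, sub_self, add_zero] at hsum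
  have key := M.simplex_sum_mem_interior E' _ hpos hsum
  convert key using 1
  have := e1 (fun a => W a • M.pt a) (w f • M.P E' f')
  simp only [hWi] at this
  rw [smul_sub, ← this]
  refine Finset.sum_congr rfl fun j _ => ?_
  split_ifs with hj
  · rw [hj]
  · rfl

/-- The neighbours across two facets cannot be displaced in the same direction. -/
theorem simplex_neighbours_opposite (hd : 0 < d) {E E₁ E₂ : Fin nE} {f g f₁ g₂ : Fin (d + 1)}
    (hfg : f ≠ g) (h1 : E ≠ E₁) (hf : M.facet E f = M.facet E₁ f₁)
    (hg : M.facet E g = M.facet E₂ g₂) {δ : Vec d} {r t : ℝ}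
    (hr : M.P E₁ f₁ - M.P E f = r • δ) (ht : M.P E₂ g₂ - M.P E g = t • δ) (hr0 : r < 0)
    (ht0 : t < 0) : False := by
  -- Positive weights with `a f * r = a g * t`: moving either apex then shifts the weighted mean to
  -- the same point, which is interior to both `E₁` and `E₂`.
  set a : Fin (d + 1) → ℝ := fun i => if i = f then -t else if i = g then -r else 1 with ha
  have hapos : ∀ i, 0 < a i := by
    intro i
    simp only [ha]
    split_ifs <;> linarith
  have hS : 0 < ∑ i, a i := Finset.sum_pos (fun i _ => hapos i) Finset.univ_nonempty
  have hw : ∀ i, 0 < a i / ∑ i, a i := fun i => div_pos (hapos i) hS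
  have hw1 : ∑ i, a i / ∑ i, a i = 1 := by rw [← Finset.sum_div, div_self hS.ne']
  have m1 := simplex_neighbour_mem_interior hf _ hw hw1
  have m2 := simplex_neighbour_mem_interior hg _ hw hw1
  have haf : a f = -t := by simp [ha]
  have hag : a g = -r := by simp [ha, hfg.symm]
  have e : (a f / ∑ i, a i) • (M.P E₁ f₁ - M.P E f) =
      (a g / ∑ i, a i) • (M.P E₂ g₂ - M.P E g) := by
    rw [hr, ht, haf, hag, smul_smul, smul_smul]
    congr 1
    ring
  rw [e] at m1
  have hEE : E₁ = E₂ := by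
    by_contra hne
    exact M.notMem_interior hne m1 (interior_subset m2)
  subst hEE
  -- A single neighbour across both facets has all vertices of `E`, so its apex over `f` could only
  -- be vertex `f` itself.
  have hsub : M.verts E ⊆ M.verts E₁ := by
    intro a ha
    obtain ⟨i, -, rfl⟩ := Finset.mem_image.1 ha
    by_cases hi : i = f
    · obtain ⟨j, -, hj⟩ := M.exists_vertex_of_facet_eq hg
        (simplex_mem_facetVerts.2 (hi ▸ hfg : i ≠ g))
      exact hj ▸ Finset.mem_image_of_mem _ (Finset.mem_univ _)
    · obtain ⟨j, -, hj⟩ := M.exists_vertex_of_facet_eq hf (simplex_mem_facetVerts.2 hi)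
      exact hj ▸ Finset.mem_image_of_mem _ (Finset.mem_univ _)
  have heq := Finset.eq_of_subset_of_card_le hsub (by rw [M.card_verts, M.card_verts])
  have hmem : M.cell E₁ f₁ ∈ M.verts E := by
    rw [heq]
    exact Finset.mem_image_of_mem _ (Finset.mem_univ _)
  obtain ⟨i, -, hi⟩ := Finset.mem_image.1 hmem
  have hif : i = f := by
    by_contra hne
    obtain ⟨j, hj, hj'⟩ := M.exists_vertex_of_facet_eq hf (simplex_mem_facetVerts.2 hne)
    exact simplex_mem_facetVerts.1 hj (M.cell_injective E₁ (hj'.trans hi))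
  refine simplex_neighbour_ne hd h1 hf ?_
  rw [sub_eq_zero]
  exact congrArg M.pt (by rw [← hi, hif])

theorem simplex_sum_neighbour {E E' : Fin nE} {f f' : Fin (d + 1)}
    (h : M.facet E f = M.facet E' f') :
    ∑ i, M.P E' i = ∑ i, M.P E i + (M.P E' f' - M.P E f) := by
  rw [← Finset.add_sum_erase _ _ (Finset.mem_univ f'),
    ← Finset.add_sum_erase _ (M.P E) (Finset.mem_univ f), simplex_facet_sum h M.pt]
  abel

namespace IsElasticityKernel

variable (hk : M.IsElasticityKernel ΓN v ξ)
include hk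

/-- On simplices the opposite vertex is the apex for every vertex of the facet, so each vertex
yields the same value `v E' - v E`, and `v` drops out of the difference. -/
theorem simplex_interior (hd : 0 < d) {E E' : Fin nE} (hE : E ≠ E') {f f' i j : Fin (d + 1)}
    (h : M.facet E f = M.facet E' f') (hi : i ≠ f) (hj : j ≠ f) :
    (ξ E ((Shape.simplex d).refVert i) - ξ E ((Shape.simplex d).refVert j)) *ᵥ
      (M.P E' f' - M.P E f) = 0 := by
  have key : ∀ i : Fin (d + 1), i ≠ f →
      ((d + 1 : ℕ) : ℝ)⁻¹ • (ξ E ((Shape.simplex d).refVert i) *ᵥ (M.P E' f' - M.P E f)) =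
        v E' - v E := by
    intro i hi
    have hi := simplex_mem_facetVerts.2 hi
    obtain ⟨i', hi', hii⟩ := M.exists_vertex_of_facet_eq h hi
    have h1 := M.residual_interior hd hk.eq hi hE.symm h.symm hi' hii
    have e : M.P E' i' = M.P E i := congrArg M.pt hii
    simp only [residual, hk.rotation_eq h hi hi' hii, e, Shape.hatDiv, one_smul, Shape.opp,
      Shape.nv, Matrix.mulVec_sub, smul_sub] at h1 ⊢
    linear_combination (exp := 1) -h1
  have hne : ((d + 1 : ℕ) : ℝ)⁻¹ ≠ 0 := by positivity
  have h2 := (key i hi).trans (key j hj).symm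
  rw [Matrix.sub_mulVec, sub_eq_zero]
  exact smul_right_injective _ hne h2

/-- Multiplying the boundary equation by `P_i - P_f` removes the skew term. So `v E` is orthogonal
to all edges at the apex, hence zero. -/
theorem simplex_boundary (hd : 0 < d) {E : Fin nE} {f i : Fin (d + 1)}
    (hb : M.IsBoundary E f) (hN : ¬M.IsOn ΓN E f) (hi : i ≠ f) :
    ξ E ((Shape.simplex d).refVert i) *ᵥ (M.P E i - M.P E f) = 0 := by
  have key : ∀ i : Fin (d + 1), i ≠ f → v E + ((d + 1 : ℕ) : ℝ)⁻¹ •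
      (ξ E ((Shape.simplex d).refVert i) *ᵥ (M.P E i - M.P E f)) = 0 := by
    intro i hi
    have h1 := M.residual_boundary hd hk.eq (simplex_mem_facetVerts.2 hi) hb hN
    simpa only [residual, Shape.hatDiv, one_smul, Shape.opp, Shape.nv] using h1
  have hv : v E = 0 := by
    have horth : ∀ i : Fin (d + 1), (M.P E i - M.P E f) ⬝ᵥ v E = 0 := by
      intro i
      by_cases hi : i = f
      · simp [hi]
      · have := congrArg ((M.P E i - M.P E f) ⬝ᵥ ·) (key i hi)
        simpa [dotProduct_add, dotProduct_smul, skew_dotProduct_mulVec (hk.skew E i)] using this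
    obtain ⟨c, hc, hc'⟩ := M.simplex_exists_weights E (M.P E f + v E)
    have e : v E = ∑ i, c i • (M.P E i - M.P E f) := by
      simp only [smul_sub, Finset.sum_sub_distrib, ← Finset.sum_smul, hc, hc', one_smul,
        add_sub_cancel_left]
    refine dotProduct_self_eq_zero.1 ?_
    conv_lhs => enter [1]; rw [e]
    rw [sum_dotProduct]
    exact Finset.sum_eq_zero fun i _ => by rw [smul_dotProduct, horth, smul_zero]
  have hne : ((d + 1 : ℕ) : ℝ)⁻¹ ≠ 0 := by positivity
  have := key i hi
  rw [hv, zero_add] at this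
  exact (smul_eq_zero.1 this).resolve_left hne

theorem simplex_rotation_eq_zero (hd : 2 ≤ d) (hΩo : IsOpen Ω) (hΩc : IsConnected Ω)
    {Γ : BoundarySplit Ω} (hΓ : Γ.N = ΓN) (hM : M.Resolves Γ)
    (hconst : ∀ E (i j : Fin (d + 1)), ξ E ((Shape.simplex d).refVert i) =
      ξ E ((Shape.simplex d).refVert j))
    (hzero : ∀ E (f i : Fin (d + 1)), M.IsBoundary E f → ¬M.IsOn ΓN E f → i ≠ f →
      ξ E ((Shape.simplex d).refVert i) = 0) (E : Fin nE) (i : Fin (d + 1)) :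
    ξ E ((Shape.simplex d).refVert i) = 0 := by
  obtain ⟨E₀, f₀, hb, hN⟩ := M.exists_not_isOn hM
  rw [hΓ] at hN
  obtain ⟨i₀, hi₀⟩ := facetVerts_nonempty (s := Shape.simplex d) hd f₀
  have h0 := hzero E₀ f₀ i₀ hb hN (simplex_mem_facetVerts.1 hi₀)
  refine M.facet_induction hd hΩo hΩc
    (fun E => ∀ i : Fin (d + 1), ξ E ((Shape.simplex d).refVert i) = 0)
    (fun i => (hconst E₀ i i₀).trans h0) ?_ E i
  intro E E' f f' hEE hf hE k
  obtain ⟨j, hj⟩ := facetVerts_nonempty (s := Shape.simplex d) hd f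
  obtain ⟨j', hj', hjj⟩ := M.exists_vertex_of_facet_eq hf hj
  rw [hconst E' k j', hk.rotation_eq hf hj hj' hjj]
  exact hE j

end IsElasticityKernel

end Simplex

/-! ### Triangles -/

section Triangle

variable {Ω : Set (Vec 2)} {nE nV : ℕ} {M : Mesh (Shape.simplex 2) Ω nE nV}
  {v : Vh 2 nE} {ξ : Fin nE → Vec 2 → Mat 2} {Γ : BoundarySplit Ω}

theorem IsElasticityKernel.triangle (hk : M.IsElasticityKernel Γ.N v ξ) (hΩo : IsOpen Ω)
    (hΩc : IsConnected Ω) (hM : M.Resolves Γ) (hone : M.AtMostOneNeumann Γ) : v = 0 ∧ ξ = 0 := by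
  have hzero : ∀ E (f i : Fin 3), M.IsBoundary E f → ¬M.IsOn Γ.N E f → i ≠ f →
      ξ E ((Shape.simplex 2).refVert i) = 0 := fun E f i hb hN hi =>
    skew_two_eq_zero (hk.skew E i) (sub_ne_zero.2 ((M.P_injective E).ne hi))
      (hk.simplex_boundary two_pos hb hN hi)
  have hedge : ∀ E (f i j : Fin 3), ¬M.IsOn Γ.N E f → i ≠ f → j ≠ f →
      ξ E ((Shape.simplex 2).refVert i) = ξ E ((Shape.simplex 2).refVert j) := by
    intro E f i j hN hi hj
    rcases facet_trichotomy (M := M) (ΓN := Γ.N) E f with ⟨E', f', hE, hf⟩ | h | ⟨hb, -⟩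
    · exact sub_eq_zero.1 (skew_two_eq_zero (hk.skew_sub E i j)
        (simplex_neighbour_ne two_pos hE hf) (hk.simplex_interior two_pos hE hf hi hj))
    · exact absurd h hN
    · rw [hzero E f i hb hN hi, hzero E f j hb hN hj]
  refine hk.eq_zero_of_rotation le_rfl hΩo hΩc rfl hM
    (hk.simplex_rotation_eq_zero le_rfl hΩo hΩc rfl hM (fun E i j => ?_) hzero)
  by_cases hij : i = j
  · rw [hij]
  obtain ⟨k, hki, hkj⟩ : ∃ k : Fin 3, k ≠ i ∧ k ≠ j := by
    clear * -; revert i j; decide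
  -- If the edge joining `i` and `j` is on `Γ.N`, the other two edges are not, and the path through
  -- `k` replaces it.
  by_cases hN : M.IsOn Γ.N E k
  · rw [hedge E j i k (fun h => hkj (hone E k j hN h)) hij hkj,
      hedge E i k j (fun h => hki (hone E k i hN h)) hki (Ne.symm hij)]
  · exact hedge E k i j hN hki.symm hkj.symm

end Triangle

/-! ### Tetrahedra -/

section Tetrahedron

variable {Ω : Set (Vec 3)} {nE nV : ℕ} {M : Mesh (Shape.simplex 3) Ω nE nV}
  {v : Vh 3 nE} {ξ : Fin nE → Vec 3 → Mat 3} {Γ : BoundarySplit Ω}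

/-- The axial vector of the rotation at a vertex. -/
def omega (ξ : Fin nE → Vec 3 → Mat 3) (E : Fin nE) (i : Fin 4) : Vec 3 :=
  axial (ξ E ((Shape.simplex 3).refVert i))

namespace IsElasticityKernel

variable (hk : M.IsElasticityKernel Γ.N v ξ)
include hk

theorem omega_boundary {E : Fin nE} {f i : Fin 4} (hb : M.IsBoundary E f)
    (hN : ¬M.IsOn Γ.N E f) (hi : i ≠ f) : ∃ r : ℝ, omega ξ E i = r • (M.P E i - M.P E f) :=
  axial_eq_smul (hk.skew E i) (sub_ne_zero.2 ((M.P_injective E).ne hi))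
    (hk.simplex_boundary three_pos hb hN hi)

theorem omega_interior {E E' : Fin nE} (hE : E ≠ E') {f f' i j : Fin 4}
    (h : M.facet E f = M.facet E' f') (hi : i ≠ f) (hj : j ≠ f) :
    ∃ r : ℝ, omega ξ E i - omega ξ E j = r • (M.P E' f' - M.P E f) := by
  rw [omega, omega, ← axial_sub]
  exact axial_eq_smul (hk.skew_sub E i j) (simplex_neighbour_ne three_pos hE h)
    (hk.simplex_interior three_pos hE h hi hj)

/-- Use a second face `g` containing `i`, `j` and the apex of `f`. If `g` is interior, the jump lies
in the plane of `g` but is parallel to an apex displacement transversal to it, so it is zero; then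
`P_i - P_f` and `P_j - P_f` are independent. If `g` is a boundary face, the vector is parallel to
two independent edges. -/
theorem omega_eq_zero_of_ne {E : Fin nE} {f g i j : Fin 4} (hb : M.IsBoundary E f)
    (hN : ¬M.IsOn Γ.N E f) (hg : ¬M.IsOn Γ.N E g) (hgf : g ≠ f) (hif : i ≠ f) (hig : i ≠ g)
    (hjf : j ≠ f) (hjg : j ≠ g) (hij : i ≠ j) : omega ξ E i = 0 := by
  obtain ⟨β, hβ⟩ := hk.omega_boundary hb hN hif
  suffices β = 0 by rw [hβ, this, zero_smul]
  rcases facet_trichotomy (M := M) (ΓN := Γ.N) E g with ⟨E', g', hE, h⟩ | h | ⟨hb', -⟩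
  · obtain ⟨γ, hγ⟩ := hk.omega_boundary hb hN hjf
    obtain ⟨r, hr⟩ := hk.omega_interior hE h hig hjg
    obtain ⟨n, hn, hne⟩ := simplex_neighbour_normal three_pos hE h
    have h1 := congrArg (n ⬝ᵥ ·) hr
    simp only [hβ, hγ, dotProduct_sub, dotProduct_smul] at h1
    rw [← dotProduct_sub, ← dotProduct_sub, ← dotProduct_sub, simplex_normal hn hig hgf.symm,
      simplex_normal hn hjg hgf.symm, smul_zero, smul_zero, sub_zero, smul_eq_mul, eq_comm,
      mul_eq_zero, or_iff_left hne] at h1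
    rw [h1, zero_smul, hβ, hγ] at hr
    obtain ⟨m, hm, hpos⟩ := simplex_inner_normal (M := M) E i
    have h2 := congrArg (m ⬝ᵥ ·) hr
    simp only [dotProduct_sub m (β • _), dotProduct_smul, dotProduct_zero] at h2
    rw [simplex_normal hm hij.symm hif.symm, smul_zero, sub_zero, smul_eq_mul, mul_eq_zero,
      or_iff_left (hpos f hif.symm).ne'] at h2
    exact h2
  · exact absurd h hg
  · obtain ⟨r, hr⟩ := hk.omega_boundary hb' hg hig
    obtain ⟨m, hm, hpos⟩ := simplex_inner_normal (M := M) E f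
    have h2 := congrArg (m ⬝ᵥ ·) (hβ.symm.trans hr)
    simp only [dotProduct_smul] at h2
    rw [simplex_normal hm hif hgf, smul_zero, smul_eq_mul, mul_eq_zero] at h2
    refine h2.resolve_right fun h0 => (hpos i hif).ne' ?_
    rw [← neg_sub, dotProduct_neg, h0, neg_zero]

theorem omega_eq_zero (hone : M.AtMostOneNeumann Γ) {E : Fin nE} {f i : Fin 4}
    (hb : M.IsBoundary E f) (hN : ¬M.IsOn Γ.N E f) (hi : i ≠ f) : omega ξ E i = 0 := by
  obtain ⟨g, j, hgf, hgi, hjf, hji, hgj⟩ : ∃ g j : Fin 4, g ≠ f ∧ g ≠ i ∧ j ≠ f ∧ j ≠ i ∧ g ≠ j := by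
    clear * - hi; revert i f; decide
  by_cases hg : M.IsOn Γ.N E g
  · exact hk.omega_eq_zero_of_ne hb hN (fun h => hgj (hone E g j hg h)) hjf hi hji.symm hgf hgj
      hgi.symm
  · exact hk.omega_eq_zero_of_ne hb hN hg hgf hi hgi.symm hjf hgj.symm hji.symm

/-- Two facets of `E` across which the mesh is displaced in the direction of the jump. -/
theorem exists_neighbours (hone : M.AtMostOneNeumann Γ) {E : Fin nE} {i j : Fin 4}
    {δ : Vec 3} {c : ℝ} (hδ : δ ≠ 0) (hc : c ≠ 0) (hij : omega ξ E i - omega ξ E j = c • δ) :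
    ∃ f g : Fin 4, f ≠ g ∧ ∀ h, h = f ∨ h = g → ∃ E' h', E ≠ E' ∧
      M.facet E h = M.facet E' h' ∧ (∃ r : ℝ, M.P E' h' - M.P E h = r • δ) ∧
      ∃ i' j' : Fin 4, ∃ c' : ℝ, c' ≠ 0 ∧ omega ξ E' i' - omega ξ E' j' = c' • δ := by
  -- A jump parallel to `δ` between two vertices of a face off `Γ.N` rules out a boundary face,
  -- fixes the direction of the apex displacement, and passes to the neighbour at the shared
  -- vertices.
  have step : ∀ {i j h : Fin 4} {c : ℝ}, c ≠ 0 → omega ξ E i - omega ξ E j = c • δ → i ≠ h → j ≠ h →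
      ¬M.IsOn Γ.N E h → ∃ E' h', E ≠ E' ∧
      M.facet E h = M.facet E' h' ∧ (∃ r : ℝ, M.P E' h' - M.P E h = r • δ) ∧
      ∃ i' j' : Fin 4, ∃ c' : ℝ, c' ≠ 0 ∧ omega ξ E' i' - omega ξ E' j' = c' • δ := by
    intro i j h c hc hij hi hj hN
    rcases facet_trichotomy (M := M) (ΓN := Γ.N) E h with ⟨E', h', hE, hf⟩ | h | ⟨hb, -⟩
    · refine ⟨E', h', hE, hf, ?_, ?_⟩
      · obtain ⟨r, hr⟩ := hk.omega_interior hE hf hi hj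
        have hr0 : r ≠ 0 := by
          rintro rfl
          rw [zero_smul, hij] at hr
          exact (smul_ne_zero hc hδ) hr
        refine ⟨r⁻¹ * c, ?_⟩
        rw [mul_smul, ← hij, hr, smul_smul, inv_mul_cancel₀ hr0, one_smul]
      · obtain ⟨i', hi', hii⟩ := M.exists_vertex_of_facet_eq hf (simplex_mem_facetVerts.2 hi)
        obtain ⟨j', hj', hjj⟩ := M.exists_vertex_of_facet_eq hf (simplex_mem_facetVerts.2 hj)
        refine ⟨i', j', c, hc, ?_⟩
        rw [← hij, omega, omega, hk.rotation_eq hf (simplex_mem_facetVerts.2 hi) hi' hii,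
          hk.rotation_eq hf (simplex_mem_facetVerts.2 hj) hj' hjj]
        rfl
    · exact absurd h hN
    · rw [hk.omega_eq_zero hone hb hN hi, hk.omega_eq_zero hone hb hN hj, sub_self] at hij
      exact absurd hij.symm (smul_ne_zero hc hδ)
  have hne : i ≠ j := by
    rintro rfl
    rw [sub_self] at hij
    exact smul_ne_zero hc hδ hij.symm
  have main : ∀ k l : Fin 4, i ≠ k → j ≠ k → i ≠ l → j ≠ l → k ≠ l → M.IsOn Γ.N E k →
      ∃ f g : Fin 4, f ≠ g ∧ ∀ h, h = f ∨ h = g → ∃ E' h', E ≠ E' ∧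
      M.facet E h = M.facet E' h' ∧ (∃ r : ℝ, M.P E' h' - M.P E h = r • δ) ∧
      ∃ i' j' : Fin 4, ∃ c' : ℝ, c' ≠ 0 ∧ omega ξ E' i' - omega ξ E' j' = c' • δ := by
    intro k l hik hjk hil hjl hkl hN
    have hnot : ∀ h, k ≠ h → ¬M.IsOn Γ.N E h := fun h hkh hh => hkh (hone E k h hN hh)
    have hl := step hc hij hil hjl (hnot l hkl)
    obtain ⟨E', l', hE, hf, ⟨r, hr⟩, -⟩ := hl
    obtain ⟨t, ht⟩ := hk.omega_interior hE hf hkl hjl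
    rw [hr, smul_smul] at ht
    -- Face `k` is on `Γ.N`, and face `l` provides one neighbour. Either `k` and `j` have equal
    -- rotations, so the jump also occurs between `i` and `k` on face `j`, or they jump parallel to
    -- `δ` on face `i`.
    by_cases h0 : t * r = 0
    · have hik' : omega ξ E i - omega ξ E k = c • δ := by
        rw [h0, zero_smul, sub_eq_zero] at ht
        rw [ht, hij]
      refine ⟨l, j, hjl.symm, ?_⟩
      rintro h (rfl | rfl)
      · exact step hc hij hil hjl (hnot _ hkl)
      · exact step hc hik' hne hjk.symm (hnot _ hjk.symm)
    · refine ⟨l, i, hil.symm, ?_⟩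
      rintro h (rfl | rfl)
      · exact step hc hij hil hjl (hnot _ hkl)
      · exact step h0 ht hik.symm hne.symm (hnot _ hik.symm)
  obtain ⟨k, l, hik, hjk, hil, hjl, hkl⟩ : ∃ k l : Fin 4, i ≠ k ∧ j ≠ k ∧ i ≠ l ∧ j ≠ l ∧ k ≠ l := by
    clear * - hne; revert i j; decide
  by_cases hNk : M.IsOn Γ.N E k
  · exact main k l hik hjk hil hjl hkl hNk
  by_cases hNl : M.IsOn Γ.N E l
  · exact main l k hil hjl hik hjk hkl.symm hNl
  refine ⟨k, l, hkl, ?_⟩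
  rintro h (rfl | rfl)
  · exact step hc hij hik hjk hNk
  · exact step hc hij hil hjl hNl

/-- Extremal argument over the elements with a jump parallel to `δ`: an element maximizing the
barycentre in direction `δ` has two neighbours of this kind, both necessarily displaced along `-δ`,
which would overlap. -/
theorem omega_const (hone : M.AtMostOneNeumann Γ) (E : Fin nE) (i j : Fin 4) :
    omega ξ E i = omega ξ E j := by
  classical
  by_contra hne
  set δ := omega ξ E i - omega ξ E j with hδ
  have hδ0 : δ ≠ 0 := sub_ne_zero.2 hne
  set C : Finset (Fin nE) := Finset.univ.filter fun E => ∃ i j : Fin 4, ∃ c : ℝ, c ≠ 0 ∧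
    omega ξ E i - omega ξ E j = c • δ with hC
  have hCne : C.Nonempty := ⟨E, by
    rw [hC, Finset.mem_filter]
    exact ⟨Finset.mem_univ _, i, j, 1, one_ne_zero, by rw [one_smul]⟩⟩
  obtain ⟨E₀, hE₀, hmax⟩ := C.exists_max_image (fun E => δ ⬝ᵥ ∑ i, M.P E i) hCne
  obtain ⟨i₀, j₀, c, hc, hij⟩ := (Finset.mem_filter.1 hE₀).2
  obtain ⟨f, g, hfg, hnb⟩ := hk.exists_neighbours hone hδ0 hc hij
  obtain ⟨E₁, f₁, h1, hf1, ⟨r, hr⟩, hb1⟩ := hnb f (Or.inl rfl)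
  obtain ⟨E₂, g₂, h2, hg2, ⟨t, ht⟩, hb2⟩ := hnb g (Or.inr rfl)
  have hneg : ∀ E₁ (f f₁ : Fin 4) (r : ℝ), E₀ ≠ E₁ → M.facet E₀ f = M.facet E₁ f₁ →
      M.P E₁ f₁ - M.P E₀ f = r • δ → E₁ ∈ C → r < 0 := by
    intro E₁ f f₁ r h1 hf1 hr hmem
    have hle := hmax E₁ hmem
    rw [simplex_sum_neighbour hf1, dotProduct_add, hr, dotProduct_smul, smul_eq_mul] at hle
    have hpos : 0 < δ ⬝ᵥ δ := by
      have h0 : 0 ≤ δ ⬝ᵥ δ := Finset.sum_nonneg fun a _ => mul_self_nonneg _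
      exact lt_of_le_of_ne h0 fun h => hδ0 (dotProduct_self_eq_zero.1 h.symm)
    have hr0 : r ≠ 0 := by
      rintro rfl
      rw [zero_smul] at hr
      exact simplex_neighbour_ne three_pos h1 hf1 hr
    refine lt_of_le_of_ne ?_ hr0
    by_contra hcon
    rw [not_le] at hcon
    have := mul_pos hcon hpos
    linarith
  exact simplex_neighbours_opposite three_pos hfg h1 hf1 hg2 hr ht
    (hneg E₁ f f₁ r h1 hf1 hr (Finset.mem_filter.2 ⟨Finset.mem_univ _, hb1⟩))
    (hneg E₂ g g₂ t h2 hg2 ht (Finset.mem_filter.2 ⟨Finset.mem_univ _, hb2⟩))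

theorem tetrahedron (hΩo : IsOpen Ω) (hΩc : IsConnected Ω) (hM : M.Resolves Γ)
    (hone : M.AtMostOneNeumann Γ) : v = 0 ∧ ξ = 0 := by
  refine hk.eq_zero_of_rotation (by norm_num) hΩo hΩc rfl hM
    (hk.simplex_rotation_eq_zero (by norm_num) hΩo hΩc rfl hM (fun E i j => ?_)
      fun E f i hb hN hi => axial_eq_zero (hk.skew E i) (hk.omega_eq_zero hone hb hN hi))
  refine sub_eq_zero.1 (axial_eq_zero (hk.skew_sub E i j) ?_)
  rw [axial_sub, sub_eq_zero]
  exact hk.omega_const hone E i j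

end IsElasticityKernel

end Tetrahedron

end Mesh
end Biot

/-! ### Quadrilateral meshes -/

namespace Biot

namespace Mesh

section Square

variable {Ω : Set (Vec 2)} {nE nV : ℕ} {M : Mesh Shape.square Ω nE nV}
  {v : Vh 2 nE} {ξ : Fin nE → Vec 2 → Mat 2} {Γ : BoundarySplit Ω}

theorem square_left_mem (f : Fin 4) : f ∈ Shape.square.facetVerts f := by
  simp [Shape.square_facetVerts]

theorem square_right_mem (f : Fin 4) : (f + 1 : Fin 4) ∈ Shape.square.facetVerts f := by
  simp [Shape.square_facetVerts]

theorem square_facetSet (E : Fin nE) (f : Fin 4) :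
    M.facetSet E f = segment ℝ (M.P E f) (M.P E (f + 1 : Fin 4)) := by
  rw [← convexHull_pair, Cells.facetSet, Cells.facet, Shape.square_facetVerts]
  congr 1
  ext x
  simp [eq_comm]

theorem square_facetSet_subset (E : Fin nE) (f : Fin 4) : M.facetSet E f ⊆ M.cellSet E := by
  rw [square_facetSet, segment_eq_image']
  rintro _ ⟨t, ht, rfl⟩
  have hf := square_left_mem f
  have h1 : Shape.along f f = f + 1 := by simp [Shape.along]
  have h := M.square_F_corner E hf t 0
  simp only [h1, zero_smul, mul_zero, add_zero] at h
  change M.P E f + t • (M.P E (f + 1 : Fin 4) - M.P E f) ∈ _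
  rw [← h]
  exact Set.mem_image_of_mem _ (Shape.square.convex_refElem.add_smul_sub_mem
    (Shape.square.refVert_mem f) (Shape.square.refVert_mem (f + 1 : Fin 4)) ht)

theorem square_facetSet_subset_frontier {E : Fin nE} {f : Fin 4} (hb : M.IsBoundary E f) :
    M.facetSet E f ⊆ frontier Ω := by
  rw [← M.boundary]
  exact fun x hx => Set.mem_iUnion.2 ⟨E, Set.mem_iUnion.2 ⟨f, Set.mem_iUnion.2 ⟨hb, hx⟩⟩⟩

/-- An edge has positive length, so it cannot lie in the null set `D ∩ N`. -/
theorem square_not_isOn {E : Fin nE} {f : Fin 4} (h : M.facetSet E f ⊆ Γ.D) :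
    ¬M.IsOn Γ.N E f := by
  intro hN
  have h0 := measure_mono_null (Set.subset_inter h hN.2) Γ.overlap
  have e : ((2 : ℕ) : ℝ) - 1 = 1 := by norm_num
  rw [e, square_facetSet, hausdorffMeasure_segment, edist_eq_zero] at h0
  have := M.P_injective E h0
  revert this
  clear * -
  revert f
  decide

theorem square_exists_opp {f k : Fin 4} (h : k ∉ Shape.square.facetVerts f) :
    ∃ i ∈ Shape.square.facetVerts f, k = Shape.square.opp f i := by
  simp only [Shape.square_facetVerts, Shape.opp] at *
  revert f k
  decide

/-- The midpoint of an edge lies in the convex hull of some vertices only if these contain both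
ends of the edge. -/
theorem square_mem_of_midpoint {E : Fin nE} {f i j : Fin 4} (hi : i ∈ Shape.square.facetVerts f)
    (hj : j ∈ Shape.square.facetVerts f) (hij : i ≠ j) {C : Finset (Fin nV)}
    (hC : C ⊆ M.verts E)
    (hm : (2⁻¹ : ℝ) • (M.P E i + M.P E j) ∈ convexHull ℝ (M.pt '' (C : Set (Fin nV)))) :
    M.cell E i ∈ C := by
  classical
  by_contra hiC
  obtain ⟨n, hn, hpos⟩ := M.exists_inner_normal E f
  have hij0 : ∀ k ∈ Shape.square.facetVerts f, n ⬝ᵥ (M.P E k - M.P E j) = 0 := fun k hk =>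
    hn _ (Finset.mem_image_of_mem _ hk) _ (Finset.mem_image_of_mem _ hj)
  -- Vertices off the edge lie strictly inside its supporting line, so without `i` the convex
  -- combination has all its weight on `j`, which is not the midpoint.
  have hout : ∀ a ∈ C, a ≠ M.cell E j → 0 < n ⬝ᵥ (M.pt a - M.P E j) := by
    intro a ha haj
    obtain ⟨k, -, rfl⟩ := Finset.mem_image.1 (hC ha)
    change Fin 4 at k
    have hk : k ∉ Shape.square.facetVerts f := by
      intro hk
      have hki : k ≠ i := by rintro rfl; exact hiC ha
      have hkj : k ≠ j := by rintro rfl; exact haj rfl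
      simp only [Shape.square_facetVerts] at hi hj hk
      clear * - hi hj hk hki hkj hij
      revert f i j k
      decide
    obtain ⟨l, hl, rfl⟩ := square_exists_opp hk
    have h1 := hpos l hl
    have h2 := hij0 l hl
    simp only [dotProduct_sub] at *
    linarith
  rw [← Finset.coe_image, Finset.mem_convexHull'] at hm
  obtain ⟨w, hw0, hw1, hw⟩ := hm
  have hz : ∑ y ∈ C.image M.pt, w y * (n ⬝ᵥ (y - M.P E j)) = 0 := by
    have h1 : ∑ y ∈ C.image M.pt, w y * (n ⬝ᵥ (y - M.P E j)) =
        n ⬝ᵥ (∑ y ∈ C.image M.pt, w y • y) - (∑ y ∈ C.image M.pt, w y) * (n ⬝ᵥ M.P E j) := by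
      rw [dotProduct_sum, Finset.sum_mul, ← Finset.sum_sub_distrib]
      exact Finset.sum_congr rfl fun y _ => by
        rw [dotProduct_smul, dotProduct_sub, smul_eq_mul]
        ring
    have h2 := hij0 i hi
    rw [h1, hw, hw1, dotProduct_smul, dotProduct_add, smul_eq_mul]
    rw [dotProduct_sub] at h2
    linarith
  have hzero : ∀ y ∈ C.image M.pt, y ≠ M.P E j → w y = 0 := by
    intro y hy hyj
    have hnn : ∀ y ∈ C.image M.pt, 0 ≤ w y * (n ⬝ᵥ (y - M.P E j)) := by
      intro y hy
      refine mul_nonneg (hw0 y hy) ?_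
      obtain ⟨a, ha, rfl⟩ := Finset.mem_image.1 hy
      by_cases haj : a = M.cell E j
      · rw [haj, sub_self, dotProduct_zero]
      · exact (hout a ha haj).le
    have h1 := (Finset.sum_eq_zero_iff_of_nonneg hnn).1 hz y hy
    obtain ⟨a, ha, rfl⟩ := Finset.mem_image.1 hy
    have haj : a ≠ M.cell E j := by rintro rfl; exact hyj rfl
    exact (mul_eq_zero.1 h1).resolve_right (hout a ha haj).ne'
  have h3 : ∑ y ∈ C.image M.pt, w y • y = (∑ y ∈ C.image M.pt, w y) • M.P E j := by
    rw [Finset.sum_smul]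
    refine Finset.sum_congr rfl fun y hy => ?_
    by_cases hyj : y = M.P E j
    · rw [hyj]
    · rw [hzero y hy hyj, zero_smul, zero_smul]
  rw [hw, hw1, one_smul] at h3
  refine hij (M.P_injective E ?_)
  have h4 : M.P E i + M.P E j = (2 : ℝ) • M.P E j := by
    conv_rhs => rw [← h3]
    rw [smul_smul]
    norm_num
  rw [two_smul] at h4
  exact add_right_cancel h4

theorem square_midpoint_ne {E E' : Fin nE} {f f' : Fin 4} (hb : M.IsBoundary E f)
    (hne : (E, f) ≠ (E', f')) :
    M.P E f + M.P E (f + 1 : Fin 4) ≠ M.P E' f' + M.P E' (f' + 1 : Fin 4) := by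
  classical
  intro heq
  have hff : f ≠ (f + 1 : Fin 4) := by clear * -; revert f; decide
  have key : ∀ C : Finset (Fin nV), C ⊆ M.verts E →
      (2⁻¹ : ℝ) • (M.P E f + M.P E (f + 1 : Fin 4)) ∈ convexHull ℝ (M.pt '' (C : Set (Fin nV))) →
      M.cell E f ∈ C ∧ M.cell E (f + 1 : Fin 4) ∈ C := fun C hC hm =>
    ⟨square_mem_of_midpoint (square_left_mem f) (square_right_mem f) hff hC hm,
      square_mem_of_midpoint (square_right_mem f) (square_left_mem f) hff.symm hC
        (add_comm (M.P E f) _ ▸ hm)⟩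
  have hmid : ∀ E (f : Fin 4), (2⁻¹ : ℝ) • (M.P E f + M.P E (f + 1 : Fin 4)) ∈ M.facetSet E f := by
    intro E f
    rw [square_facetSet, smul_add]
    exact ⟨2⁻¹, 2⁻¹, by norm_num, by norm_num, by norm_num, rfl⟩
  by_cases hE : E = E'
  · subst hE
    have h1 := hmid E f'
    rw [← heq] at h1
    obtain ⟨h2, h3⟩ := key _ (Finset.image_subset_image (Finset.subset_univ _)) h1
    have h2 := M.mem_facetVerts_of_mem_facet h2
    have h3 := M.mem_facetVerts_of_mem_facet h3
    refine hne (Prod.ext rfl ?_)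
    simp only [Shape.square_facetVerts] at h2 h3 ⊢
    clear * - h2 h3
    revert f f'
    decide
  · have h1 : (2⁻¹ : ℝ) • (M.P E f + M.P E (f + 1 : Fin 4)) ∈ M.cellSet E ∩ M.cellSet E' :=
      ⟨square_facetSet_subset E f (hmid E f), heq ▸ square_facetSet_subset E' f' (hmid E' f')⟩
    rw [M.conforming E E' hE] at h1
    obtain ⟨h2, h3⟩ := key _ Finset.inter_subset_left h1
    rw [Finset.mem_inter] at h2 h3
    obtain ⟨g, hg⟩ := M.square_exists_facet (Ne.symm hE) ((M.cell_injective E).ne hff)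
      h2.2 h3.2 h2.1 h3.1
    refine hE (hb E' g ?_).symm
    rw [hg, Cells.facet, Shape.square_facetVerts, Finset.image_insert, Finset.image_singleton]

namespace IsElasticityKernel

variable (hk : M.IsElasticityKernel Γ.N v ξ)
include hk

/-- The factor 2 is the number 4 of vertices times `hatDiv = 1/2`. The opposite vertices depend on
`i`, so `v` does not drop out as on simplices. -/
theorem square_interior {E E' : Fin nE} (hE : E ≠ E') {f f' i i' : Fin 4}
    (h : M.facet E f = M.facet E' f') (hi : i ∈ Shape.square.facetVerts f)
    (hi' : i' ∈ Shape.square.facetVerts f') (hii : M.cell E' i' = M.cell E i) :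
    ξ E (Shape.square.refVert i) *ᵥ
      (M.P E' (Shape.square.opp f' i') - M.P E (Shape.square.opp f i)) =
        (2 : ℝ) • (v E' - v E) := by
  have h1 := M.residual_interior two_pos hk.eq hi hE.symm h.symm hi' hii
  have e : M.P E' i' = M.P E i := congrArg M.pt hii
  simp only [residual, hk.rotation_eq h hi hi' hii, e, Shape.hatDiv, Shape.nv, Matrix.mulVec_sub,
    Nat.cast_ofNat] at h1 ⊢
  linear_combination (norm := module) (-4 : ℝ) • h1

theorem square_boundary {E : Fin nE} {f i : Fin 4} (hb : M.IsBoundary E f)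
    (hN : ¬M.IsOn Γ.N E f) (hi : i ∈ Shape.square.facetVerts f) :
    ξ E (Shape.square.refVert i) *ᵥ (M.P E i - M.P E (Shape.square.opp f i)) =
      (-2 : ℝ) • v E := by
  have h1 := M.residual_boundary two_pos hk.eq hi hb hN
  simp only [residual, Shape.hatDiv, Shape.nv, Nat.cast_ofNat] at h1
  linear_combination (norm := module) (4 : ℝ) • h1

/-- A zero at `i` removes the displacement term from the equation at `j`, where `ξ` then annihilates
a nonzero vector. -/
theorem square_zero {E : Fin nE} {f i j : Fin 4} (hN : ¬M.IsOn Γ.N E f)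
    (hi : i ∈ Shape.square.facetVerts f) (hj : j ∈ Shape.square.facetVerts f)
    (h0 : ξ E (Shape.square.refVert i) = 0) : ξ E (Shape.square.refVert j) = 0 := by
  rcases facet_trichotomy (M := M) (ΓN := Γ.N) E f with ⟨E', f', hE, h⟩ | h | ⟨hb, -⟩
  · obtain ⟨i', hi', hii⟩ := M.exists_vertex_of_facet_eq h hi
    obtain ⟨j', hj', hjj⟩ := M.exists_vertex_of_facet_eq h hj
    have h1 := hk.square_interior hE h hi hi' hii
    rw [h0, Matrix.zero_mulVec] at h1
    exact skew_two_eq_zero (hk.skew E j) (neighbour_ne two_pos hE h hj hj' hjj)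
      ((hk.square_interior hE h hj hj' hjj).trans h1.symm)
  · exact absurd h hN
  · have h1 := hk.square_boundary hb hN hi
    rw [h0, Matrix.zero_mulVec] at h1
    refine skew_two_eq_zero (hk.skew E j) (sub_ne_zero.2 ((M.P_injective E).ne fun h => ?_))
      ((hk.square_boundary hb hN hj).trans h1.symm)
    exact Shape.square.opp_notMem hj (h ▸ hj)

end IsElasticityKernel

/-- A four-cycle stays connected without one edge, here the one that may be on the Neumann part. -/
theorem cyclic_path {p : Fin 4 → Prop} {k : Fin 4} (h : ∀ e, e ≠ k → (p e ↔ p (e + 1)))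
    {i : Fin 4} (hi : p i) (j : Fin 4) : p j := by
  have h1 := h (k + 1) (by clear * -; revert k; decide)
  have h2 := h (k + 2) (by clear * -; revert k; decide)
  have h3 := h (k + 3) (by clear * -; revert k; decide)
  have e1 : k + 1 + 1 = k + 2 := by clear * -; revert k; decide
  have e2 : k + 2 + 1 = k + 3 := by clear * -; revert k; decide
  have e3 : k + 3 + 1 = k := by clear * -; revert k; decide
  rw [e1] at h1
  rw [e2] at h2
  rw [e3] at h3
  have hall : ∀ i : Fin 4, i = k ∨ i = k + 1 ∨ i = k + 2 ∨ i = k + 3 := by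
    clear * -; revert k; decide
  rcases hall i with rfl | rfl | rfl | rfl <;> rcases hall j with rfl | rfl | rfl | rfl <;> tauto

theorem exists_forall_not_isOn (hone : M.AtMostOneNeumann Γ) (E : Fin nE) :
    ∃ k : Fin 4, ∀ e, e ≠ k → ¬M.IsOn Γ.N E e := by
  by_cases h : ∃ k : Fin 4, M.IsOn Γ.N E k
  · obtain ⟨k, hk⟩ := h
    exact ⟨k, fun e he hN => he (hone E e k hN hk)⟩
  · exact ⟨0, fun e _ hN => h ⟨e, hN⟩⟩

theorem square_affine_opp {E : Fin nE} (hA : M.IsAffine E) {f i j : Fin 4}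
    (hi : i ∈ Shape.square.facetVerts f) (hj : j ∈ Shape.square.facetVerts f) :
    M.P E i - M.P E (Shape.square.opp f i) = M.P E j - M.P E (Shape.square.opp f j) := by
  rw [← M.DF_opp E hi, ← M.DF_opp E hj, hA (Shape.square.refVert i) (Shape.square.refVert j)]
  congr 1
  simp only [Shape.square_facetVerts, Finset.mem_insert, Finset.mem_singleton] at hi hj
  have key : Shape.square.refVert f - Shape.square.refVert (Shape.square.opp f f) =
      Shape.square.refVert (f + 1 : Fin 4) -
        Shape.square.refVert (Shape.square.opp f (f + 1 : Fin 4)) := by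
    fin_cases f <;> ext a <;> fin_cases a <;> simp [Shape.opp, Shape.refVert]
  rcases hi with rfl | rfl <;> rcases hj with rfl | rfl <;> simp [key]

theorem square_affine_center {E : Fin nE} (hA : M.IsAffine E) {f i : Fin 4}
    (hi : i ∈ Shape.square.facetVerts f) :
    M.P E (Shape.along f i) + M.P E (Shape.square.opp f i) =
      M.P E (0 : Fin 4) + M.P E (2 : Fin 4) := by
  have h := square_affine_opp hA (square_left_mem 0) (square_right_mem 0)
  have h02 : M.P E (0 : Fin 4) + M.P E (2 : Fin 4) = M.P E (1 : Fin 4) + M.P E (3 : Fin 4) := by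
    simp only [Shape.opp] at h
    have h' : M.P E (0 : Fin 4) - M.P E (3 : Fin 4) = M.P E (1 : Fin 4) - M.P E (2 : Fin 4) := h
    linear_combination (norm := module) h'
  simp only [Shape.square_facetVerts, Finset.mem_insert, Finset.mem_singleton] at hi
  rcases hi with rfl | rfl
  · simp only [Shape.along, Shape.opp, if_true]
    fin_cases i
    · exact h02.symm
    · exact add_comm _ _
    · exact (add_comm _ _).trans h02.symm
    · rfl
  · simp only [Shape.along, Shape.opp]
    fin_cases f
    · rfl
    · exact h02.symm
    · exact add_comm _ _
    · exact (add_comm _ _).trans h02.symm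

/-- The displacement at a corner, corrected by the rotation. -/
def cornerValue (M : Mesh Shape.square Ω nE nV) (v : Vh 2 nE) (ξ : Fin nE → Vec 2 → Mat 2)
    (E : Fin nE) (i : Fin 4) : Vec 2 :=
  (2 : ℝ) • v E + ξ E (Shape.square.refVert i) *ᵥ
    ((M.P E i - M.P E (i + 1 : Fin 4)) + (M.P E i - M.P E (i + 3 : Fin 4)))

theorem cornerValue_eq {E : Fin nE} {f i : Fin 4} (hi : i ∈ Shape.square.facetVerts f) :
    cornerValue M v ξ E i = (2 : ℝ) • v E + ξ E (Shape.square.refVert i) *ᵥ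
      ((M.P E i - M.P E (Shape.along f i)) + (M.P E i - M.P E (Shape.square.opp f i))) := by
  simp only [Shape.square_facetVerts, Finset.mem_insert, Finset.mem_singleton] at hi
  rcases hi with rfl | rfl
  · simp [cornerValue, Shape.along, Shape.opp]
  · have h1 : Shape.along f (f + 1) = f + 1 + 3 := by clear * -; revert f; decide
    have h2 : Shape.square.opp f (f + 1 : Fin 4) = (f + 1 + 1 : Fin 4) := by
      simp only [Shape.opp]; clear * -; revert f; decide
    rw [cornerValue, h1, h2, add_comm (M.P E (f + 1 : Fin 4) - M.P E (f + 1 + 1 : Fin 4))]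

namespace IsElasticityKernel

variable (hk : M.IsElasticityKernel Γ.N v ξ)
include hk

theorem square_eq_zero (hΩo : IsOpen Ω) (hΩc : IsConnected Ω) (hM : M.Resolves Γ)
    (hone : M.AtMostOneNeumann Γ) {E₀ : Fin nE} {i₀ : Fin 4}
    (h₀ : ξ E₀ (Shape.square.refVert i₀) = 0) : v = 0 ∧ ξ = 0 := by
  have hcell : ∀ E (i : Fin 4), ξ E (Shape.square.refVert i) = 0 →
      ∀ j : Fin 4, ξ E (Shape.square.refVert j) = 0 := by
    intro E i hi j
    obtain ⟨k, hN⟩ := exists_forall_not_isOn hone E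
    exact cyclic_path (p := fun i => ξ E (Shape.square.refVert i) = 0) (k := k)
      (fun e he => ⟨hk.square_zero (hN e he) (square_left_mem e) (square_right_mem e),
        hk.square_zero (hN e he) (square_right_mem e) (square_left_mem e)⟩) hi j
  refine hk.eq_zero_of_rotation le_rfl hΩo hΩc rfl hM ?_
  refine M.facet_induction le_rfl hΩo hΩc
    (fun E => ∀ i : Fin 4, ξ E (Shape.square.refVert i) = 0) (hcell E₀ i₀ h₀) ?_
  intro E E' f f' hEE hf hE
  obtain ⟨j', hj', hjj⟩ := M.exists_vertex_of_facet_eq hf (square_left_mem f)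
  refine hcell E' j' ?_
  rw [hk.rotation_eq hf (square_left_mem f) hj' hjj]
  exact hE f

/-- In parallelograms the transversal edges at the two ends agree, so both rotations have the same
value on the same nonzero vector. -/
theorem square_affine_eq (hA : ∀ E, M.IsAffine E) {E : Fin nE} {f i j : Fin 4}
    (hN : ¬M.IsOn Γ.N E f) (hi : i ∈ Shape.square.facetVerts f)
    (hj : j ∈ Shape.square.facetVerts f) :
    ξ E (Shape.square.refVert i) = ξ E (Shape.square.refVert j) := by
  suffices ∃ q, q ≠ 0 ∧ ξ E (Shape.square.refVert i) *ᵥ q = ξ E (Shape.square.refVert j) *ᵥ q by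
    obtain ⟨q, hq, h⟩ := this
    refine sub_eq_zero.1 (skew_two_eq_zero (hk.skew_sub E i j) hq ?_)
    rw [Matrix.sub_mulVec, h, sub_self]
  rcases facet_trichotomy (M := M) (ΓN := Γ.N) E f with ⟨E', f', hE, h⟩ | h | ⟨hb, -⟩
  · obtain ⟨i', hi', hii⟩ := M.exists_vertex_of_facet_eq h hi
    obtain ⟨j', hj', hjj⟩ := M.exists_vertex_of_facet_eq h hj
    refine ⟨_, neighbour_ne two_pos hE h hi hi' hii, ?_⟩
    rw [hk.square_interior hE h hi hi' hii, ← hk.square_interior hE h hj hj' hjj]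
    have e1 := square_affine_opp (hA E) hi hj
    have e2 := square_affine_opp (hA E') hi' hj'
    have e3 : M.P E' i' = M.P E i := congrArg M.pt hii
    have e4 : M.P E' j' = M.P E j := congrArg M.pt hjj
    rw [e3, e4] at e2
    congr 1
    linear_combination (norm := module) e2 - e1
  · exact absurd h hN
  · refine ⟨M.P E i - M.P E (Shape.square.opp f i),
      sub_ne_zero.2 ((M.P_injective E).ne fun h => Shape.square.opp_notMem hi (h ▸ hi)), ?_⟩
    rw [hk.square_boundary hb hN hi, square_affine_opp (hA E) hi hj, hk.square_boundary hb hN hj]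

theorem parallelogram (hΩo : IsOpen Ω) (hΩc : IsConnected Ω) (hM : M.Resolves Γ)
    (hone : M.AtMostOneNeumann Γ) (hA : ∀ E, M.IsAffine E) {E₁ E₂ : Fin nE} {f₁ f₂ : Fin 4}
    (h1 : M.IsOn Γ.D E₁ f₁) (h2 : M.IsOn Γ.D E₂ f₂) (hne : (E₁, f₁) ≠ (E₂, f₂)) :
    v = 0 ∧ ξ = 0 := by
  obtain ⟨X, hX⟩ : ∃ X, X = ξ E₁ (Shape.square.refVert f₁) := ⟨_, rfl⟩
  have hcell : ∀ E (i : Fin 4), ξ E (Shape.square.refVert i) = X →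
      ∀ j : Fin 4, ξ E (Shape.square.refVert j) = X := by
    intro E i hi j
    obtain ⟨k, hN⟩ := exists_forall_not_isOn hone E
    exact cyclic_path (p := fun i => ξ E (Shape.square.refVert i) = X) (k := k)
      (fun e he => by
        simp only [hk.square_affine_eq hA (hN e he) (square_left_mem e) (square_right_mem e)])
      hi j
  have hXall : ∀ E (i : Fin 4), ξ E (Shape.square.refVert i) = X := by
    refine M.facet_induction le_rfl hΩo hΩc
      (fun E => ∀ i : Fin 4, ξ E (Shape.square.refVert i) = X) (hcell E₁ f₁ hX.symm) ?_
    intro E E' f f' hEE hf hE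
    obtain ⟨j', hj', hjj⟩ := M.exists_vertex_of_facet_eq hf (square_left_mem f)
    refine hcell E' j' ?_
    rw [hk.rotation_eq hf (square_left_mem f) hj' hjj]
    exact hE f
  let c : Fin nE → Vec 2 := fun E => M.P E (0 : Fin 4) + M.P E (2 : Fin 4)
  -- With constant rotation `X` the displacement is a rigid motion sampled at the centres. At a
  -- Dirichlet edge the constant equals minus `X` applied to the sum of the end points, and distinct
  -- edges have distinct midpoints.
  have hconst : ∀ E, (2 : ℝ) • v E - X *ᵥ c E = (2 : ℝ) • v E₁ - X *ᵥ c E₁ := by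
    refine M.facet_induction le_rfl hΩo hΩc
      (fun E => (2 : ℝ) • v E - X *ᵥ c E = (2 : ℝ) • v E₁ - X *ᵥ c E₁) rfl ?_
    intro E E' f f' hEE hf hE
    have hi := square_left_mem f
    obtain ⟨i', hi', hii⟩ := M.exists_vertex_of_facet_eq hf hi
    have h3 := hk.square_interior hEE hf hi hi' hii
    have e : M.P E' (Shape.along f' i') = M.P E (Shape.along f f) :=
      congrArg M.pt (M.square_cell_along hf hi hi' hii)
    rw [hXall] at h3
    rw [← hE]
    simp only [c]
    rw [← square_affine_center (hA E) hi, ← square_affine_center (hA E') hi', e]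
    rw [Matrix.mulVec_sub] at h3
    rw [Matrix.mulVec_add, Matrix.mulVec_add]
    linear_combination (norm := module) -h3
  have hedge : ∀ E (f : Fin 4), M.IsOn Γ.D E f →
      X *ᵥ (M.P E f + M.P E (f + 1 : Fin 4)) = -((2 : ℝ) • v E₁ - X *ᵥ c E₁) := by
    intro E f hD
    have hi := square_left_mem f
    have h3 := hk.square_boundary hD.1 (square_not_isOn hD.2) hi
    have h4 := square_affine_center (hA E) hi
    have ha : Shape.along f f = f + 1 := by simp [Shape.along]
    rw [← hconst E]
    simp only [c]
    rw [← h4, ha]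
    rw [hXall, Matrix.mulVec_sub] at h3
    rw [Matrix.mulVec_add, Matrix.mulVec_add]
    linear_combination (norm := module) h3
  refine hk.square_eq_zero hΩo hΩc hM hone (E₀ := E₁) (i₀ := f₁) ?_
  refine skew_two_eq_zero (hk.skew E₁ f₁) (sub_ne_zero.2 (square_midpoint_ne h1.1 hne)) ?_
  rw [hXall, Matrix.mulVec_sub, hedge E₁ f₁ h1, hedge E₂ f₂ h2, sub_self]

/-- The shared edge contributes equally on both sides, and the change of the other edge is exactly
compensated by `2 (v E' - v E)`. -/
theorem cornerValue_interior {E E' : Fin nE} (hE : E ≠ E') {f f' i i' : Fin 4}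
    (h : M.facet E f = M.facet E' f') (hi : i ∈ Shape.square.facetVerts f)
    (hi' : i' ∈ Shape.square.facetVerts f') (hii : M.cell E' i' = M.cell E i) :
    cornerValue M v ξ E' i' = cornerValue M v ξ E i := by
  have h1 := hk.square_interior hE h hi hi' hii
  have e1 : M.P E' i' = M.P E i := congrArg M.pt hii
  have e2 : M.P E' (Shape.along f' i') = M.P E (Shape.along f i) :=
    congrArg M.pt (M.square_cell_along h hi hi' hii)
  rw [cornerValue_eq hi, cornerValue_eq hi', hk.rotation_eq h hi hi' hii, e1, e2]
  simp only [Matrix.mulVec_add, Matrix.mulVec_sub] at h1 ⊢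
  linear_combination (norm := module) -h1

theorem cornerValue_boundary {E : Fin nE} {f i : Fin 4} (hb : M.IsBoundary E f)
    (hN : ¬M.IsOn Γ.N E f) (hi : i ∈ Shape.square.facetVerts f) :
    cornerValue M v ξ E i =
      ξ E (Shape.square.refVert i) *ᵥ (M.P E i - M.P E (Shape.along f i)) := by
  have h1 := hk.square_boundary hb hN hi
  rw [cornerValue_eq hi]
  simp only [Matrix.mulVec_add, Matrix.mulVec_sub] at h1 ⊢
  linear_combination (norm := module) h1

/-- Around a vertex, the boundary edges come in pairs joined by corners with the same rotation. -/
theorem exists_second_boundary {E₀ : Fin nE} {f₀ : Fin 4} (hb : M.IsBoundary E₀ f₀) :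
    ∃ E, ∃ f i : Fin 4, (E, f) ≠ (E₀, f₀) ∧ M.IsBoundary E f ∧ i ∈ Shape.square.facetVerts f ∧
      M.cell E i = M.cell E₀ f₀ ∧
      ξ E (Shape.square.refVert i) = ξ E₀ (Shape.square.refVert f₀) ∧
      cornerValue M v ξ E i = cornerValue M v ξ E₀ f₀ := by
  classical
  -- Parity replaces walking around the vertex. Exchanging the two edges of a corner shows that `T`
  -- is even, and crossing to the neighbour shows that its non-boundary members are even in number.
  -- So the boundary members, among them the given one, are even in number.
  let T : Finset (Fin nE × Fin 4 × Fin 4) := Finset.univ.filter fun t =>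
    t.2.2 ∈ Shape.square.facetVerts t.2.1 ∧ M.cell t.1 t.2.2 = M.cell E₀ f₀ ∧
    ξ t.1 (Shape.square.refVert t.2.2) = ξ E₀ (Shape.square.refVert f₀) ∧
    cornerValue M v ξ t.1 t.2.2 = cornerValue M v ξ E₀ f₀
  have hT : ∀ t, t ∈ T ↔ t.2.2 ∈ Shape.square.facetVerts t.2.1 ∧
      M.cell t.1 t.2.2 = M.cell E₀ f₀ ∧
      ξ t.1 (Shape.square.refVert t.2.2) = ξ E₀ (Shape.square.refVert f₀) ∧
      cornerValue M v ξ t.1 t.2.2 = cornerValue M v ξ E₀ f₀ := fun t => by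
    simp only [T, Finset.mem_filter, Finset.mem_univ, true_and]
  have h11 : (1 : ZMod 2) + 1 = 0 := by decide
  have hflip : ∑ _t ∈ T, (1 : ZMod 2) = 0 := by
    -- The other edge at `i`: modulo 4 this is `f + 3` for `i = f` and `f + 1` for `i = f + 1`.
    refine Finset.sum_involution (fun t _ => (t.1, t.2.1 + 2 * (t.2.2 - t.2.1) + 3, t.2.2))
      (fun _ _ => h11) (fun t ht _ h => ?_) (fun t ht => ?_) fun t ht => ?_
    · have h1 := congrArg (fun t => t.2.1) h
      have h2 := ((hT t).1 ht).1
      obtain ⟨E, f, i⟩ := t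
      simp only [Shape.square_facetVerts] at h1 h2
      clear * - h1 h2
      revert f i
      decide
    · rw [hT] at ht ⊢
      refine ⟨?_, ht.2⟩
      have h2 := ht.1
      obtain ⟨E, f, i⟩ := t
      simp only [Shape.square_facetVerts] at h2 ⊢
      clear * - h2
      revert f i
      decide
    · obtain ⟨E, f, i⟩ := t
      have h2 := ((hT _).1 ht).1
      simp only [Shape.square_facetVerts] at h2
      refine Prod.ext rfl (Prod.ext ?_ rfl)
      simp only
      clear * - h2
      revert f i
      decide
  have hnb : ∀ t ∈ T.filter (fun t => ¬M.IsBoundary t.1 t.2.1), ∃ t' ∈ T, t.1 ≠ t'.1 ∧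
      M.facet t.1 t.2.1 = M.facet t'.1 t'.2.1 := by
    intro t ht
    obtain ⟨ht, hnb⟩ := Finset.mem_filter.1 ht
    obtain ⟨hi, hr, hx, hu⟩ := (hT t).1 ht
    simp only [Cells.IsBoundary, not_forall] at hnb
    obtain ⟨E', f', h, hne⟩ := hnb
    obtain ⟨i', hi', hii⟩ := M.exists_vertex_of_facet_eq h.symm hi
    exact ⟨(E', f', i'), (hT _).2 ⟨hi', hii.trans hr, (hk.rotation_eq h.symm hi hi' hii).trans hx,
      (hk.cornerValue_interior (Ne.symm hne) h.symm hi hi' hii).trans hu⟩, Ne.symm hne, h.symm⟩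
  choose g hgT hgne hgf using hnb
  have hgmem : ∀ t ht, g t ht ∈ T.filter (fun t => ¬M.IsBoundary t.1 t.2.1) := fun t ht =>
    Finset.mem_filter.2 ⟨hgT t ht, fun hb => hgne t ht (hb _ _ (hgf t ht))⟩
  have hcross : ∑ _t ∈ T.filter (fun t => ¬M.IsBoundary t.1 t.2.1), (1 : ZMod 2) = 0 := by
    refine Finset.sum_involution g (fun _ _ => h11)
      (fun t ht _ h => hgne t ht (congrArg Prod.fst h).symm) hgmem fun t ht => ?_
    have h1 := hgne t ht
    have h2 := hgne _ (hgmem t ht)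
    have f1 := hgf t ht
    have f2 := hgf _ (hgmem t ht)
    have hi := ((hT _).1 (hgT t ht)).1
    have hE : (g _ (hgmem t ht)).1 = t.1 :=
      M.eq_of_facet_eq two_pos h2.symm h1 f2.symm f1 hi
    have hti := (hT t).1 (Finset.mem_filter.1 ht).1
    have hgi := (hT _).1 (hgT _ (hgmem t ht))
    generalize g _ (hgmem t ht) = t'' at *
    obtain ⟨E, f, i⟩ := t
    obtain ⟨E'', f'', i''⟩ := t''
    simp only at hE f1 f2 hti hgi
    subst hE
    have hf : f'' = f := M.facet_injective E'' (f2.symm.trans f1.symm)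
    have hi : i'' = i := M.cell_injective E'' (hgi.2.1.trans hti.2.1.symm)
    rw [hf, hi]
  have hsum : ∑ _t ∈ T.filter (fun t => M.IsBoundary t.1 t.2.1), (1 : ZMod 2) = 0 := by
    rw [← Finset.sum_filter_add_sum_filter_not T (fun t => M.IsBoundary t.1 t.2.1), hcross,
      add_zero] at hflip
    exact hflip
  have ht₀ : (E₀, f₀, f₀) ∈ T.filter (fun t => M.IsBoundary t.1 t.2.1) :=
    Finset.mem_filter.2 ⟨(hT _).2 ⟨square_left_mem f₀, rfl, rfl, rfl⟩, hb⟩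
  have hnt : (T.filter (fun t => M.IsBoundary t.1 t.2.1)).Nontrivial := by
    rw [← Finset.one_lt_card_iff_nontrivial]
    by_contra hcard
    have hcard1 : (T.filter (fun t => M.IsBoundary t.1 t.2.1)).card = 1 :=
      le_antisymm (not_lt.1 hcard) (Finset.card_pos.2 ⟨_, ht₀⟩)
    rw [Finset.sum_const, hcard1] at hsum
    exact absurd hsum (by decide)
  obtain ⟨⟨E, f, i⟩, ht, hne⟩ := hnt.exists_ne (E₀, f₀, f₀)
  obtain ⟨ht, hbt⟩ := Finset.mem_filter.1 ht
  obtain ⟨hi, hr, hx, hu⟩ := (hT _).1 ht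
  refine ⟨E, f, i, fun h => hne ?_, hbt, hi, hr, hx, hu⟩
  obtain ⟨rfl, rfl⟩ := Prod.mk.inj h
  have hif := M.cell_injective E hr
  simp only at hif
  rw [hif]

/-- A vertex of a boundary edge through `x` is within `ε / 2` of `x`, so all boundary edges at this
vertex lie in `D`. Two of them share rotation and corner value, and there the corner value is `ξ`
applied to the edge. So `ξ` annihilates the difference of their other end points. -/
theorem fine (hΩo : IsOpen Ω) (hΩc : IsConnected Ω) (hM : M.Resolves Γ)
    (hone : M.AtMostOneNeumann Γ) {x : Vec 2} (hx : x ∈ frontier Ω) {ε : ℝ}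
    (hD : ∀ y ∈ frontier Ω, dist y x < ε → y ∈ Γ.D)
    (hdiam : ∀ E, Metric.diam (M.cellSet E) < ε / 2) : v = 0 ∧ ξ = 0 := by
  obtain ⟨E₀, f₀, hb, hx₀⟩ := M.exists_mem_facetSet hx
  change Fin 4 at f₀
  have hnear : ∀ E, ∀ y ∈ M.cellSet E, ∀ z ∈ M.cellSet E, dist y z < ε / 2 := fun E y hy z hz =>
    (Metric.dist_le_diam_of_mem (M.isCompact_cellSet E).isBounded hy hz).trans_lt (hdiam E)
  have hnot : ∀ E (f i : Fin 4), M.IsBoundary E f → M.cell E i = M.cell E₀ f₀ →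
      ¬M.IsOn Γ.N E f := by
    intro E f i hbE hr
    refine square_not_isOn fun y hy => hD y (square_facetSet_subset_frontier hbE hy) ?_
    have e : M.P E i = M.P E₀ f₀ := congrArg M.pt hr
    have h1 := hnear E y (square_facetSet_subset E f hy) _ (M.P_mem E i)
    have h2 := hnear E₀ _ (M.P_mem E₀ f₀) x (square_facetSet_subset E₀ f₀ hx₀)
    rw [e] at h1
    have := dist_triangle y (M.P E₀ f₀) x
    linarith
  obtain ⟨E, f, i, hne, hbE, hi, hr, hX, hu⟩ := hk.exists_second_boundary hb
  have h0 := hk.cornerValue_boundary hb (hnot E₀ f₀ f₀ hb rfl) (square_left_mem f₀)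
  have h1 := hk.cornerValue_boundary hbE (hnot E f i hbE hr) hi
  have e : M.P E i = M.P E₀ f₀ := congrArg M.pt hr
  rw [hu, h0, hX, e] at h1
  refine hk.square_eq_zero hΩo hΩc hM hone (E₀ := E₀) (i₀ := f₀)
    (skew_two_eq_zero (hk.skew E₀ f₀) (y := (M.P E₀ f₀ - M.P E₀ (Shape.along f₀ f₀)) -
      (M.P E₀ f₀ - M.P E (Shape.along f i))) ?_ (by rw [Matrix.mulVec_sub, h1, sub_self]))
  rw [sub_sub_sub_cancel_left, sub_ne_zero]
  intro heq
  have hcell := M.pt_injective heq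
  have hfac : ∀ E (f i : Fin 4), i ∈ Shape.square.facetVerts f →
      M.facet E f = {M.cell E i, M.cell E (Shape.along f i)} := by
    intro E f i hi
    simp only [Shape.square_facetVerts, Finset.mem_insert, Finset.mem_singleton] at hi
    rw [Cells.facet, Shape.square_facetVerts, Finset.image_insert, Finset.image_singleton]
    rcases hi with rfl | rfl
    · simp [Shape.along]
    · have : Shape.along f (f + 1) = f := by clear * -; revert f; decide
      rw [this, Finset.pair_comm]
  have hF : M.facet E f = M.facet E₀ f₀ := by
    rw [hfac E f i hi, hfac E₀ f₀ f₀ (square_left_mem f₀), hr, hcell]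
  have hEE : E = E₀ := hb E f hF
  subst hEE
  exact hne (Prod.ext rfl (M.facet_injective E hF))

end IsElasticityKernel

end Square

end Mesh
end Biot

/-! ### Choice of the mesh size; matrices of the bilinear forms -/

namespace Biot

/-- The mesh size below which quadrilateral grids are admissible. -/
theorem exists_fineness {d : ℕ} (hd : d = 2 ∨ d = 3) (s : Shape d) {Ω : Set (Vec d)}
    (hΩo : IsOpen Ω) (hΩc : IsConnected Ω) (Γ : BoundarySplit Ω) :
    ∃ h₀ : ℝ, 0 < h₀ ∧ ∀ (nE nV : ℕ) (M : Mesh s Ω nE nV), M.Resolves Γ →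
      M.AtMostOneNeumann Γ → (s.IsSquare → M.FineEnough Γ h₀) →
      ∀ v ξ, M.IsElasticityKernel Γ.N v ξ → v = 0 ∧ ξ = 0 := by
  cases s with
  | simplex =>
    refine ⟨1, one_pos, fun nE nV M hM hone _ v ξ hk => ?_⟩
    rcases hd with rfl | rfl
    · exact hk.triangle hΩo hΩc hM hone
    · exact hk.tetrahedron hΩo hΩc hM hone
  | square =>
    -- One arbitrary mesh resolving the splitting produces `x` and `ε`, which then serve every mesh.
    -- If there is none, the claim is vacuous.
    by_cases hex : ∃ nE nV, ∃ M : Mesh Shape.square Ω nE nV, M.Resolves Γ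
    · obtain ⟨nE, nV, M, hM⟩ := hex
      obtain ⟨x, hx, ε, hε, hD, -⟩ := M.exists_ball_subset_dirichlet hM
      refine ⟨ε / 2, half_pos hε, fun nE nV M hM hone hfine v ξ hk => ?_⟩
      rcases hfine trivial with h | ⟨hA, E, f, E', f', h1, h2, hne⟩
      · exact hk.fine hΩo hΩc hM hone hx hD h
      · exact hk.parallelogram hΩo hΩc hM hone hA h1 h2 hne
    · exact ⟨1, one_pos, fun nE nV M hM => (hex ⟨nE, nV, M, hM⟩).elim⟩

section Frobenius

variable {d : ℕ} (ρ σ τ : Mat d) (r : ℝ)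

theorem frob_add_left : frob (ρ + σ) τ = frob ρ τ + frob σ τ := by
  simp [frob, add_mul, Finset.sum_add_distrib]

theorem frob_smul_left : frob (r • σ) τ = r * frob σ τ := by
  simp [frob, Finset.mul_sum, mul_assoc]

theorem frob_comm : frob σ τ = frob τ σ := by
  simp [frob, mul_comm]

theorem frob_add_right : frob τ (ρ + σ) = frob τ ρ + frob τ σ := by
  rw [frob_comm, frob_add_left, frob_comm ρ, frob_comm σ]

theorem frob_smul_right : frob τ (r • σ) = r * frob τ σ := by
  rw [frob_comm, frob_smul_left, frob_comm]

end Frobenius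

section BilinearMatrix

variable {U V X Y : Type*} [AddCommGroup U] [Module ℝ U] [AddCommGroup V] [Module ℝ V]
  [Fintype X] [Fintype Y] (Φ : U →ₗ[ℝ] V →ₗ[ℝ] ℝ) (bU : Module.Basis X ℝ U)
  (bV : Module.Basis Y ℝ V)

theorem of_mulVec (x : X → ℝ) :
    (Matrix.of fun i j => Φ (bU j) (bV i)) *ᵥ x = fun i => Φ (bU.equivFun.symm x) (bV i) := by
  ext i
  simp [Matrix.mulVec, dotProduct, Module.Basis.equivFun_symm_apply, mul_comm]

theorem of_transpose_mulVec (y : Y → ℝ) :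
    (Matrix.of fun i j => Φ (bU j) (bV i))ᵀ *ᵥ y = fun j => Φ (bU j) (bV.equivFun.symm y) := by
  ext j
  simp [Matrix.mulVec, dotProduct, Module.Basis.equivFun_symm_apply, mul_comm]

theorem dotProduct_of_mulVec (x : X → ℝ) (y : Y → ℝ) :
    y ⬝ᵥ ((Matrix.of fun i j => Φ (bU j) (bV i)) *ᵥ x) =
      Φ (bU.equivFun.symm x) (bV.equivFun.symm y) := by
  rw [of_mulVec, Module.Basis.equivFun_symm_apply bV]
  simp [dotProduct]

theorem posDef_of_bilinear {Φ : U →ₗ[ℝ] U →ₗ[ℝ] ℝ} (hsymm : ∀ x y, Φ x y = Φ y x)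
    (hpos : ∀ x, x ≠ 0 → 0 < Φ x x) :
    (Matrix.of fun i j => Φ (bU j) (bU i)).PosDef := by
  refine Matrix.PosDef.of_dotProduct_mulVec_pos ?_ fun {x} hx => ?_
  · ext i j
    simp [hsymm (bU i)]
  · rw [star_trivial, dotProduct_of_mulVec]
    exact hpos _ fun h => hx ((LinearEquiv.map_eq_zero_iff _).1 h)

theorem basis_induction {Ψ : U →ₗ[ℝ] ℝ} (h : ∀ j, Ψ (bU j) = 0) (x : U) : Ψ x = 0 := by
  have : Ψ = 0 := bU.ext fun j => by rw [h, LinearMap.zero_apply]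
  rw [this, LinearMap.zero_apply]

end BilinearMatrix

namespace Cells

variable {d : ℕ} {s : Shape d} {nE nV : ℕ} (M : Cells s nE nV)

theorem quad_add (φ ψ : Fin nE → Fin s.nv → ℝ) :
    M.quad (fun E i => φ E i + ψ E i) = M.quad φ + M.quad ψ := by
  simp only [quad, add_mul, Finset.sum_add_distrib, mul_add]

theorem quad_smul (r : ℝ) (φ : Fin nE → Fin s.nv → ℝ) :
    M.quad (fun E i => r * φ E i) = r * M.quad φ := by
  simp only [quad, Finset.mul_sum]
  exact Finset.sum_congr rfl fun E _ => Finset.sum_congr rfl fun i _ => by ring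

theorem sVert_add (σ τ : Fin nE → Vec d → Mat d) (E : Fin nE) (i : Fin s.nv) :
    M.sVert (σ + τ) E i = M.sVert σ E i + M.sVert τ E i := by
  simp [sVert, stress, Matrix.add_mul]

theorem sVert_smul (r : ℝ) (τ : Fin nE → Vec d → Mat d) (E : Fin nE) (i : Fin s.nv) :
    M.sVert (r • τ) E i = r • M.sVert τ E i := by
  simp [sVert, stress, smul_comm r]

theorem velocity_add (z ζ : Fin nE → Vec d → Vec d) (E : Fin nE) (x : Vec d) :
    M.velocity (z + ζ) E x = M.velocity z E x + M.velocity ζ E x := by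
  simp [velocity, Matrix.mulVec_add]

theorem velocity_smul (r : ℝ) (ζ : Fin nE → Vec d → Vec d) (E : Fin nE) (x : Vec d) :
    M.velocity (r • ζ) E x = r • M.velocity ζ E x := by
  simp [velocity, Matrix.mulVec_smul, smul_comm r]

variable {M} (c : Coefficients M) (ΓN : Set (Vec d))

/-- The bilinear form `(A σ, τ)_Q` on the stress space. -/
def bilinσσ : M.Xh ΓN →ₗ[ℝ] M.Xh ΓN →ₗ[ℝ] ℝ :=
  LinearMap.mk₂ ℝ (fun σ τ => formσσ c (σ : Fin nE → Vec d → Mat d) τ)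
    (fun σ σ' τ => by
      simp only [formσσ, Submodule.coe_add, sVert_add, map_add, frob_add_left]
      exact M.quad_add _ _)
    (fun r σ τ => by
      simp only [formσσ, Submodule.coe_smul, sVert_smul, map_smul, frob_smul_left]
      exact M.quad_smul _ _)
    (fun σ τ τ' => by
      simp only [formσσ, Submodule.coe_add, sVert_add, frob_add_right]
      exact M.quad_add _ _)
    (fun r σ τ => by
      simp only [formσσ, Submodule.coe_smul, sVert_smul, frob_smul_right]
      exact M.quad_smul _ _)

/-- The bilinear form `(σ, ξ)_Q`. -/
def bilinσγ : M.Xh ΓN →ₗ[ℝ] M.Qh →ₗ[ℝ] ℝ :=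
  LinearMap.mk₂ ℝ (fun σ ξ => M.formσγ σ ξ)
    (fun σ σ' τ => by
      simp only [formσγ, Submodule.coe_add, sVert_add, frob_add_left]
      exact M.quad_add _ _)
    (fun r σ τ => by
      simp only [formσγ, Submodule.coe_smul, sVert_smul, frob_smul_left]
      exact M.quad_smul _ _)
    (fun σ τ τ' => by
      simp only [formσγ, Submodule.coe_add, Pi.add_apply, frob_add_right]
      exact M.quad_add _ _)
    (fun r σ τ => by
      simp only [formσγ, Submodule.coe_smul, Pi.smul_apply, frob_smul_right]
      exact M.quad_smul _ _)

/-- The bilinear form `α (A σ, w I)_Q`. -/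
def bilinσp : M.Xh ΓN →ₗ[ℝ] Wh nE →ₗ[ℝ] ℝ :=
  LinearMap.mk₂ ℝ (fun σ w => formσp c (σ : Fin nE → Vec d → Mat d) w)
    (fun σ σ' τ => by
      simp only [formσp, Submodule.coe_add, sVert_add, map_add, frob_add_left]
      rw [← mul_add]
      exact congrArg _ (M.quad_add _ _))
    (fun r σ τ => by
      simp only [formσp, Submodule.coe_smul, sVert_smul, map_smul, frob_smul_left]
      rw [M.quad_smul, smul_eq_mul, mul_left_comm])
    (fun σ τ τ' => by
      simp only [formσp, Pi.add_apply, add_smul, frob_add_right]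
      rw [← mul_add]
      exact congrArg _ (M.quad_add _ _))
    (fun r σ τ => by
      simp only [formσp, Pi.smul_apply, smul_assoc, frob_smul_right _ _ r]
      rw [M.quad_smul, smul_eq_mul, mul_left_comm])

/-- The bilinear form `(K⁻¹ z, ζ)_Q` on the velocity space. -/
def bilinzz : M.Zh ΓN →ₗ[ℝ] M.Zh ΓN →ₗ[ℝ] ℝ :=
  LinearMap.mk₂ ℝ (fun z ζ => formzz c (z : Fin nE → Vec d → Vec d) ζ)
    (fun σ σ' τ => by
      simp only [formzz, Submodule.coe_add, velocity_add, Matrix.mulVec_add, add_dotProduct]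
      exact M.quad_add _ _)
    (fun r σ τ => by
      simp only [formzz, Submodule.coe_smul, velocity_smul, Matrix.mulVec_smul, smul_dotProduct,
        smul_eq_mul]
      exact M.quad_smul _ _)
    (fun σ τ τ' => by
      simp only [formzz, Submodule.coe_add, velocity_add, dotProduct_add]
      exact M.quad_add _ _)
    (fun r σ τ => by
      simp only [formzz, Submodule.coe_smul, velocity_smul, dotProduct_smul, smul_eq_mul]
      exact M.quad_smul _ _)

theorem formpp_eq (p w : Wh nE) :
    formpp c p w = (∑ E, c.c₀ * p E * w E * ∫ x in s.refElem, M.J E x) +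
      c.α * M.quad fun E i =>
        frob (Avert c E i ((c.α * p E) • (1 : Mat d))) (w E • (1 : Mat d)) := by
  rw [formpp, integral]
  congr 1
  exact Finset.sum_congr rfl fun E _ => integral_const_mul _ _

/-- The bilinear form of the storage term. -/
def bilinpp : Wh nE →ₗ[ℝ] Wh nE →ₗ[ℝ] ℝ :=
  LinearMap.mk₂ ℝ (fun p w => formpp c p w)
    (fun σ σ' τ => by
      simp only [formpp_eq, Pi.add_apply, mul_add, add_mul, add_smul, map_add, frob_add_left,
        Finset.sum_add_distrib]
      rw [M.quad_add]
      ring)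
    (fun r σ τ => by
      simp only [formpp_eq, Pi.smul_apply, smul_eq_mul, mul_left_comm c.α r, mul_smul r, map_smul,
        frob_smul_left _ _ r, mul_left_comm c.c₀ r, mul_assoc r]
      rw [M.quad_smul, ← Finset.mul_sum]
      ring)
    (fun σ τ τ' => by
      simp only [formpp_eq, Pi.add_apply, mul_add, add_mul, add_smul, frob_add_right,
        Finset.sum_add_distrib]
      rw [M.quad_add]
      ring)
    (fun r σ τ => by
      simp only [formpp_eq, Pi.smul_apply, smul_assoc, frob_smul_right _ _ r]
      rw [M.quad_smul, smul_add, smul_eq_mul, smul_eq_mul, Finset.mul_sum]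
      congr 1
      · exact Finset.sum_congr rfl fun E _ => by rw [smul_eq_mul]; ring
      · ring)

end Cells

/-! ### Divergence forms; symmetry and positivity of the quadrature forms -/

namespace Mesh

variable {d : ℕ} {s : Shape d} {Ω : Set (Vec d)} {nE nV : ℕ} (M : Mesh s Ω nE nV)
  (ΓN : Set (Vec d))

/-- The bilinear form `(div σ, v)`. -/
def bilinσu : M.Xh ΓN →ₗ[ℝ] Vh d nE →ₗ[ℝ] ℝ :=
  LinearMap.mk₂ ℝ (fun σ v => M.formσu σ v)
    (fun σ σ' v => by
      rw [M.formσu_eq σ.2.1, M.formσu_eq σ'.2.1, M.formσu_eq (σ + σ').2.1, ← mul_add,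
        ← Finset.sum_add_distrib]
      refine congrArg _ (Finset.sum_congr rfl fun E _ => ?_)
      rw [← add_dotProduct]
      congr 1
      funext a
      exact Cells.refDiv_add ((s.bdm_differentiable (σ.2.1 E a)).1 0)
        ((s.bdm_differentiable (σ'.2.1 E a)).1 0))
    (fun r σ v => by
      have h : ∀ E, (fun a => Cells.refDiv
          (fun x => ((r • σ : M.Xh ΓN) : Fin nE → Vec d → Mat d) E x a) 0) =
          r • fun a => Cells.refDiv (fun x => (σ : Fin nE → Vec d → Mat d) E x a) 0 := fun E =>
        funext fun a => Cells.refDiv_smul ((s.bdm_differentiable (σ.2.1 E a)).1 0) r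
      simp only [M.formσu_eq σ.2.1, M.formσu_eq (r • σ).2.1, h, smul_dotProduct, smul_eq_mul,
        ← Finset.mul_sum]
      ring)
    (fun σ v v' => by
      simp only [M.formσu_eq σ.2.1, Pi.add_apply, dotProduct_add, Finset.sum_add_distrib, mul_add])
    (fun r σ v => by
      simp only [M.formσu_eq σ.2.1, Pi.smul_apply, dotProduct_smul, smul_eq_mul, ← Finset.mul_sum]
      ring)

/-- The bilinear form `-(div z, w)`. -/
def bilinzp : M.Zh ΓN →ₗ[ℝ] Wh nE →ₗ[ℝ] ℝ :=
  LinearMap.mk₂ ℝ (fun z w => M.formzp z w)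
    (fun σ σ' v => by
      rw [M.formzp_eq σ.2.1, M.formzp_eq σ'.2.1, M.formzp_eq (σ + σ').2.1, ← neg_add, ← mul_add,
        ← Finset.sum_add_distrib]
      refine congrArg _ (congrArg _ (Finset.sum_congr rfl fun E _ => ?_))
      rw [← add_mul]
      congr 1
      exact Cells.refDiv_add ((s.bdm_differentiable (σ.2.1 E)).1 0)
        ((s.bdm_differentiable (σ'.2.1 E)).1 0))
    (fun r σ v => by
      have h : ∀ E, Cells.refDiv (((r • σ : M.Zh ΓN) : Fin nE → Vec d → Vec d) E) 0 =
          r * Cells.refDiv ((σ : Fin nE → Vec d → Vec d) E) 0 := fun E =>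
        Cells.refDiv_smul ((s.bdm_differentiable (σ.2.1 E)).1 0) r
      simp only [M.formzp_eq σ.2.1, M.formzp_eq (r • σ).2.1, h, smul_eq_mul, mul_assoc r,
        ← Finset.mul_sum]
      ring)
    (fun σ v v' => by
      simp only [M.formzp_eq σ.2.1, Pi.add_apply, mul_add, Finset.sum_add_distrib, neg_add])
    (fun r σ v => by
      simp only [M.formzp_eq σ.2.1, Pi.smul_apply, smul_eq_mul, mul_left_comm _ r,
        ← Finset.mul_sum]
      ring)

variable {M ΓN}

theorem quad_nonneg {φ : Fin nE → Fin s.nv → ℝ} (h : ∀ E i, 0 ≤ φ E i) : 0 ≤ M.quad φ :=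
  Finset.sum_nonneg fun E _ => mul_nonneg (by positivity) (Finset.sum_nonneg fun i _ =>
    mul_nonneg (h E i) (abs_nonneg _))

theorem quad_pos {φ : Fin nE → Fin s.nv → ℝ} (h : ∀ E i, 0 ≤ φ E i) {E : Fin nE} {i : Fin s.nv}
    (hi : 0 < φ E i) : 0 < M.quad φ := by
  refine Finset.sum_pos' (fun E _ => mul_nonneg (by positivity) (Finset.sum_nonneg fun i _ =>
    mul_nonneg (h E i) (abs_nonneg _))) ⟨E, Finset.mem_univ _, ?_⟩
  refine mul_pos (div_pos s.volume_real_refElem_pos (Nat.cast_pos.2 s.nv_pos)) ?_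
  exact Finset.sum_pos' (fun i _ => mul_nonneg (h E i) (abs_nonneg _))
    ⟨i, Finset.mem_univ _, mul_pos hi (M.J_pos E (s.refVert_mem i))⟩

variable (c : Coefficients M.toCells)

theorem Avert_symm (E : Fin nE) (i : Fin s.nv) (σ τ : Mat d) :
    frob (Cells.Avert c E i σ) τ = frob (Cells.Avert c E i τ) σ := by
  rw [frob_comm (Cells.Avert c E i τ)]
  exact c.A_symm E _ (M.P_mem E i) σ τ

theorem Avert_nonneg (E : Fin nE) (i : Fin s.nv) (τ : Mat d) :
    0 ≤ frob (Cells.Avert c E i τ) τ := by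
  by_cases h : τ = 0
  · simp [h, frob]
  · exact (c.A_pos E _ (M.P_mem E i) τ h).le

/-- A nonzero field has a nonzero vertex value by unisolvence, and the Piola transformation is
invertible there. -/
theorem formσσ_pos {τ : Fin nE → Vec d → Mat d} (hτ : τ ∈ M.Xh ΓN) (h : τ ≠ 0) :
    0 < Cells.formσσ c τ τ := by
  obtain ⟨E, i, hi⟩ : ∃ E i, M.sVert τ E i ≠ 0 := by
    by_contra hcon
    push Not at hcon
    refine h (funext fun E => funext fun x => funext fun a => ?_)
    refine congrFun (s.bdm_eq_zero (hτ.1 E a) fun i => ?_) x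
    have h1 := (smul_eq_zero.1 (hcon E i)).resolve_left
      (inv_ne_zero (M.J_pos E (s.refVert_mem i)).ne')
    have hu : IsUnit (M.DF E (s.refVert i))ᵀ.det := by
      rw [Matrix.det_transpose]
      exact isUnit_iff_ne_zero.2 (M.det_ne_zero E _ (s.refVert_mem i))
    have h2 : τ E (s.refVert i) = 0 := by
      rw [← Matrix.mul_nonsing_inv_cancel_right _ (τ E (s.refVert i)) hu, h1, Matrix.zero_mul]
    exact congrFun h2 a
  exact quad_pos (fun E i => Avert_nonneg c E i _) (c.A_pos E _ (M.P_mem E i) _ hi)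

theorem formzz_pos {z : Fin nE → Vec d → Vec d} (hz : z ∈ M.Zh ΓN) (h : z ≠ 0) :
    0 < Cells.formzz c z z := by
  have hK : ∀ E i, (c.K E (M.pt (M.cell E i)))⁻¹.PosDef := fun E i =>
    (c.K_pos E _ (M.P_mem E i)).inv
  obtain ⟨E, i, hi⟩ : ∃ E i, M.velocity z E (s.refVert i) ≠ 0 := by
    by_contra hcon
    push Not at hcon
    refine h (funext fun E => s.bdm_eq_zero (hz.1 E) fun i => ?_)
    have h1 := (smul_eq_zero.1 (hcon E i)).resolve_left
      (inv_ne_zero (M.J_pos E (s.refVert_mem i)).ne')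
    exact Matrix.eq_zero_of_mulVec_eq_zero (M.det_ne_zero E _ (s.refVert_mem i)) h1
  refine quad_pos (fun E i => ?_) (E := E) (i := i) ?_
  · rw [dotProduct_comm]
    simpa using (hK E i).posSemidef.dotProduct_mulVec_nonneg (M.velocity z E (s.refVert i))
  · rw [dotProduct_comm]
    simpa using (hK E i).dotProduct_mulVec_pos hi

theorem formσσ_symm (σ τ : Fin nE → Vec d → Mat d) :
    Cells.formσσ c σ τ = Cells.formσσ c τ σ := by
  simp only [Cells.formσσ, Avert_symm c _ _ (M.sVert σ _ _)]

theorem formzz_symm (z ζ : Fin nE → Vec d → Vec d) :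
    Cells.formzz c z ζ = Cells.formzz c ζ z := by
  simp only [Cells.formzz]
  congr 1
  funext E i
  have hK : ((c.K E (M.pt (M.cell E i)))⁻¹)ᵀ = (c.K E (M.pt (M.cell E i)))⁻¹ :=
    (c.K_pos E _ (M.P_mem E i)).inv.isHermitian
  rw [dotProduct_comm, Matrix.dotProduct_mulVec, ← Matrix.mulVec_transpose, hK]

theorem formpp_symm (p w : Wh nE) : Cells.formpp c p w = Cells.formpp c w p := by
  rw [Cells.formpp_eq, Cells.formpp_eq]
  congr 1
  · exact Finset.sum_congr rfl fun E _ => by ring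
  · congr 2
    funext E i
    rw [mul_smul c.α, mul_smul c.α, map_smul, map_smul _ c.α, frob_smul_left, frob_smul_left,
      Avert_symm]

/-- Completing the square: the expression is `(c₀ p, p) + (A(τ - αpI), τ - αpI)_Q`. It needs the
same quadrature rule in all three forms. -/
theorem formpp_sub_nonneg (p : Wh nE) (τ : Fin nE → Vec d → Mat d) :
    0 ≤ Cells.formpp c p p - 2 * Cells.formσp c τ p + Cells.formσσ c τ τ := by
  have h1 : 0 ≤ ∑ E, c.c₀ * p E * p E * ∫ x in s.refElem, M.J E x := by
    refine Finset.sum_nonneg fun E _ => mul_nonneg ?_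
      (integral_nonneg fun x => abs_nonneg _)
    rw [mul_assoc]
    exact mul_nonneg c.c₀_nonneg (mul_self_nonneg _)
  have h2 := quad_nonneg (M := M) fun E i =>
    Avert_nonneg c E i (M.sVert τ E i + (-(c.α * p E)) • (1 : Mat d))
  have h3 : ∀ E i, frob (Cells.Avert c E i (M.sVert τ E i + (-(c.α * p E)) • (1 : Mat d)))
      (M.sVert τ E i + (-(c.α * p E)) • (1 : Mat d)) =
      (frob (Cells.Avert c E i (M.sVert τ E i)) (M.sVert τ E i) +
        (-(2 * c.α)) * frob (Cells.Avert c E i (M.sVert τ E i)) (p E • (1 : Mat d))) +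
        c.α * frob (Cells.Avert c E i ((c.α * p E) • (1 : Mat d))) (p E • (1 : Mat d)) := by
    intro E i
    simp only [map_add, map_smul, frob_add_left, frob_add_right, frob_smul_left, frob_smul_right]
    rw [Avert_symm c E i 1 (M.sVert τ E i)]
    ring
  simp only [h3] at h2
  rw [M.quad_add, M.quad_add, M.quad_smul, M.quad_smul] at h2
  rw [Cells.formpp_eq, Cells.formσp, Cells.formσσ]
  linarith

end Mesh
end Biot

end

/-! ### From the discrete forms to the matrices -/

theorem proposition7p3 {d : ℕ} (hd : d = 2 ∨ d = 3) (s : Biot.Shape d)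
    (Ω : Set (Biot.Vec d)) (hΩo : IsOpen Ω) (hΩc : IsConnected Ω)
    (Γu Γp : Biot.BoundarySplit Ω) :
    ∃ h₀ : ℝ, 0 < h₀ ∧ ∀ (nE nV : ℕ) (M : Biot.Mesh s Ω nE nV),
      M.Resolves Γu → M.Resolves Γp → M.AtMostOneNeumann Γu →
      (s.IsSquare → M.FineEnough Γu h₀) →
      ∀ (c : Biot.Coefficients M.toCells) (Δt : ℝ), 0 < Δt →
      ∀ (X V Q Z W : Type) [Fintype X] [Fintype V] [Fintype Q] [Fintype Z] [Fintype W]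
        [DecidableEq X] [DecidableEq V] [DecidableEq Q] [DecidableEq Z] [DecidableEq W]
        (bX : Module.Basis X ℝ (M.Xh Γu.N)) (bV : Module.Basis V ℝ (Biot.Vh d nE))
        (bQ : Module.Basis Q ℝ M.Qh) (bZ : Module.Basis Z ℝ (M.Zh Γp.N))
        (bW : Module.Basis W ℝ (Biot.Wh nE)) (B : Biot.Blocks X V Q Z W),
      B = Biot.assemble c bX bV bQ bZ bW →
        -- the eliminations can be carried out
        (B.σσ.PosDef ∧ B.zz.PosDef ∧ B.γσγ.PosDef ∧
          ∀ (σ : X → ℝ) (u : V → ℝ) (γ : Q → ℝ) (z : Z → ℝ) (p : W → ℝ) (f : V → ℝ) (g : W → ℝ),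
            B.IsSolution Δt σ u γ z p f g ↔
              (σ = -(B.σσ⁻¹ *ᵥ (B.σuᵀ *ᵥ u + B.σγᵀ *ᵥ γ + B.σpᵀ *ᵥ p)) ∧
               z = -(B.zz⁻¹ *ᵥ (B.zpᵀ *ᵥ p)) ∧
               γ = -(B.γσγ⁻¹ *ᵥ (B.γσp *ᵥ p + B.uσγᵀ *ᵥ u)) ∧
               B.reduced Δt *ᵥ Sum.elim u p = Sum.elim f g)) ∧
        -- block-skew-symmetry
        B.A21 = -B.A12ᵀ ∧
        -- the diagonal blocks are symmetric and positive definite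
        B.A11.PosDef ∧ (B.A22 Δt).PosDef ∧
        -- the whole matrix is positive definite
        ∀ x : V ⊕ W → ℝ, x ≠ 0 → 0 < x ⬝ᵥ (B.reduced Δt *ᵥ x) := by 
  obtain ⟨h₀, hpos, hker⟩ := Biot.exists_fineness hd s hΩo hΩc Γu
  refine ⟨h₀, hpos, fun nE nV M hMu hMp hone hfine c Δt hΔt X V Q Z W => ?_⟩
  intro _ _ _ _ _ _ _ _ _ _ bX bV bQ bZ bW B hB
  have hσσ : B.σσ = Matrix.of fun i j => Biot.Cells.bilinσσ c Γu.N (bX j) (bX i) := by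
    rw [hB]; rfl
  have hσu : B.σu = Matrix.of fun i j => M.bilinσu Γu.N (bX j) (bV i) := by rw [hB]; rfl
  have hσγ : B.σγ = Matrix.of fun i j => Biot.Cells.bilinσγ Γu.N (bX j) (bQ i) := by rw [hB]; rfl
  have hσp : B.σp = Matrix.of fun i j => Biot.Cells.bilinσp c Γu.N (bX j) (bW i) := by
    rw [hB]; rfl
  have hzz : B.zz = Matrix.of fun i j => Biot.Cells.bilinzz c Γp.N (bZ j) (bZ i) := by
    rw [hB]; rfl
  have hzp : B.zp = Matrix.of fun i j => M.bilinzp Γp.N (bZ j) (bW i) := by rw [hB]; rfl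
  have hpp : B.pp = Matrix.of fun i j => Biot.Cells.bilinpp c (bW j) (bW i) := by rw [hB]; rfl
  have pσσ : B.σσ.PosDef := by
    rw [hσσ]
    exact Biot.posDef_of_bilinear bX (fun σ τ => Biot.Mesh.formσσ_symm c σ τ) fun τ hτ =>
      Biot.Mesh.formσσ_pos c τ.2 fun h => hτ (Subtype.ext h)
  have pzz : B.zz.PosDef := by
    rw [hzz]
    exact Biot.posDef_of_bilinear bZ (fun z ζ => Biot.Mesh.formzz_symm c z ζ) fun z hz =>
      Biot.Mesh.formzz_pos c z.2 fun h => hz (Subtype.ext h)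
  have spp : B.ppᵀ = B.pp := by
    rw [hpp]
    ext i j
    exact Biot.Mesh.formpp_symm c (bW i) (bW j)
  have hk : ∀ u γ, B.σuᵀ *ᵥ u + B.σγᵀ *ᵥ γ = 0 → u = 0 ∧ γ = 0 := by
    intro u γ h
    rw [hσu, hσγ, Biot.of_transpose_mulVec, Biot.of_transpose_mulVec] at h
    -- The vector equation `h` is the orthogonality of the pair to each basis stress; linearity
    -- extends it to all of `X_h`.
    obtain ⟨h1, h2⟩ := hker nE nV M hMu hone hfine (bV.equivFun.symm u) (bQ.equivFun.symm γ)
      ⟨(bQ.equivFun.symm γ).2, fun τ hτ => Biot.basis_induction bX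
        (Ψ := (M.bilinσu Γu.N).flip (bV.equivFun.symm u) +
          (Biot.Cells.bilinσγ Γu.N).flip (bQ.equivFun.symm γ)) (fun j => congrFun h j) ⟨τ, hτ⟩⟩
    exact ⟨(LinearEquiv.map_eq_zero_iff _).1 h1,
      (LinearEquiv.map_eq_zero_iff _).1 (Subtype.ext h2)⟩
  have kzp : ∀ p, B.zpᵀ *ᵥ p = 0 → p = 0 := by
    intro p h
    rw [hzp, Biot.of_transpose_mulVec] at h
    refine (LinearEquiv.map_eq_zero_iff bW.equivFun.symm).1 ?_
    exact M.flow_kernel (by omega) hΩo hΩc hMp fun z hz => Biot.basis_induction bZ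
      (Ψ := (M.bilinzp Γp.N).flip (bW.equivFun.symm p)) (fun j => congrFun h j) ⟨z, hz⟩
  have hs : ∀ p y, 0 ≤ p ⬝ᵥ (B.pp *ᵥ p) - 2 * (y ⬝ᵥ (B.σpᵀ *ᵥ p)) + y ⬝ᵥ (B.σσ *ᵥ y) := by
    intro p y
    have e : y ⬝ᵥ (B.σpᵀ *ᵥ p) = p ⬝ᵥ (B.σp *ᵥ y) := by
      rw [Matrix.mulVec_transpose, dotProduct_comm, Matrix.dotProduct_mulVec]
    rw [e, hpp, hσp, hσσ, Biot.dotProduct_of_mulVec, Biot.dotProduct_of_mulVec,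
      Biot.dotProduct_of_mulVec]
    exact Biot.Mesh.formpp_sub_nonneg c _ _
  have p11 := Biot.Blocks.A11_posDef pσσ hk
  have p22 := Biot.Blocks.A22_posDef hΔt pσσ pzz spp hk kzp hs
  have h21 := Biot.Blocks.A21_eq pσσ hk
  exact ⟨⟨pσσ, pzz, Biot.Blocks.γσγ_posDef pσσ hk, fun σ u γ z p f g =>
    Biot.Blocks.isSolution_iff pσσ pzz hk σ u γ z p f g⟩, h21, p11, p22,
    Biot.Blocks.reduced_pos p11 p22 h21⟩
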